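/- **Binomial Theorem.** Let $k$ be a field. A *variety* is an algebraic space of finite presentation over $k$; write $\mathrm{Var}_k$ for the category of varieties and, for a finite group $G$, $\mathrm{Var}_k^G$ for the category of varieties with a $G$-action and $G$-equivariant morphisms. Let $K_0(\mathrm{Var}_k^G)$ be the free abelian group on isomorphism classes $\{X\}$ of $G$-varieties modulo the relations * $\{X\}=\{X\setminus Z\}+\{Z\}$ for every closed $G$-invariant subvariety $Z\subset X$, * $\{E\}=\{\mathbb A^d\times X\}$ for every $G$-equivariant vector bundle $E\to X$ of rank $d$ (with $G$ acting trivially on $\mathbb A^d$). It is a commutative ring under the product of $G$-varieties; $\mathbb L=\{\mathbb A^1\}$ (trivial action), and $K_0(\mathrm{Var}_k)$ is the case $G=1$. Let $\boxtimes\colon K_0(\mathrm{Var}_k^G)\times K_0(\mathrm{Var}_k^H)\to K_0(\mathrm{Var}_k^{G\times H})$ be the biadditive map induced by $(X,Y)\mapsto X\times Y$, and, for an injective homomorphism $H\to G$ of finite groups, let $\mathrm{Ind}_H^G\colon K_0(\mathrm{Var}_k^H)\to K_0(\mathrm{Var}_k^G)$ be the additive map induced by $X\mapsto G\times^H X$.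 Let $\Sigma_n$ be the symmetric group on $n$ letters, regard $\Sigma_i\times\Sigma_j$ as a subgroup of $\Sigma_{i+j}$ acting on the first $i$ and the last $j$ letters, and for a variety $X$ let $X^{[n]}$ be the $n$-fold power of $X$ with $\Sigma_n$ permuting the factors. On the additive group $\mathcal K=\prod_{n\ge 0}K_0(\mathrm{Var}_k^{\Sigma_n})$ define $$(a*b)_n=\sum_{i+j=n}\mathrm{Ind}_{\Sigma_i\times\Sigma_j}^{\Sigma_n}(a_i\boxtimes b_j).$$ Then: 1. $(\mathcal K,+,*)$ is a commutative ring with identity $(1,0,0,\dots)$, and $\mathcal U=\{a\in\mathcal K: a_0=1\}$ is a group under $*$. 2. There is a unique group homomorphism $\exp\colon (K_0(\mathrm{Var}_k),+)\to(\mathcal U,*)$ such that $\exp(\{X\})_n=\{X^{[n]}\}$ for every variety $X$ and every $n\ge 0$. 3. Set $x^{[n]}:=\exp(x)_n\in K_0(\mathrm{Var}_k^{\Sigma_n})$ for $x\in K_0(\mathrm{Var}_k)$ and $n\ge0$, so that $x\mapsto x^{[n]}$ extends $X\mapsto X^{[n]}$ in the sense that $\{X\}^{[n]}=\{X^{[n]}\}$.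 For all $x,y\in K_0(\mathrm{Var}_k)$ and all $n\ge 0$, $$(x+y)^{[n]}=\sum_{i+j=n}\mathrm{Ind}_{\Sigma_i\times\Sigma_j}^{\Sigma_n}\bigl(x^{[i]}\boxtimes y^{[j]}\bigr).$$ 4. For every vector bundle $E\to X$ of rank $d$ in $\mathrm{Var}_k$ and every $n\ge 0$, $\{E\}^{[n]}=\mathbb L^{dn}\,\{X\}^{[n]}$ in $K_0(\mathrm{Var}_k^{\Sigma_n})$. -/

import Mathlib

open CategoryTheory Limits AlgebraicGeometry MonoidalCategory Opposite

universe u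

namespace EquivariantVarieties

noncomputable section

section Varieties

variable (k : Type u) [Field k]

/-- The category of `k`-schemes. -/
abbrev Sch : Type (u + 1) := Over (Spec (CommRingCat.of k))

/-- Presheaves of sets on the category of `k`-schemes. -/
abbrev PSh : Type (u + 1) := (Sch k)ᵒᵖ ⥤ Type u

/-- The big étale topology on the category of `k`-schemes. -/
abbrev etale : GrothendieckTopology (Sch k) :=
  Scheme.etaleTopology.over (Spec (CommRingCat.of k))

/-- A morphism of presheaves is `Rep k P` if it is representable by schemes and all its base
changes to schemes have the property `P`. -/
abbrev Rep (P : MorphismProperty Scheme.{u}) : MorphismProperty (PSh k) :=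
  (P.inverseImage (Over.forget (Spec (CommRingCat.of k)))).presheaf

/-- Quasi-compact morphisms of schemes. -/
def quasiCompact : MorphismProperty Scheme.{u} := fun _ _ f ↦ QuasiCompact f

/-- Closed immersions of schemes. -/
def closedImmersion : MorphismProperty Scheme.{u} := fun _ _ f ↦ IsClosedImmersion f

/-- Surjective étale morphisms of schemes. -/
def etaleSurjective : MorphismProperty Scheme.{u} := fun _ _ f ↦ Etale f ∧ Surjective f

/-- The diagonal of a presheaf. -/
abbrev diagonal (X : PSh k) : X ⟶ X ⊗ X := CartesianMonoidalCategory.lift (𝟙 X) (𝟙 X)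

/-- A variety over `k` is an algebraic space of finite presentation over `k`: an étale sheaf on
`k`-schemes whose diagonal is representable (by schemes) and quasi-compact, and which admits an
étale surjection from a scheme of finite presentation over `k`. -/
structure IsVariety (X : PSh k) : Prop where
  isSheaf : Presieve.IsSheaf (etale k) X
  diagonal : Rep k quasiCompact (diagonal k X)
  atlas : ∃ (U : Sch k) (p : yoneda.obj U ⟶ X), LocallyOfFinitePresentation U.hom ∧
    QuasiCompact U.hom ∧ Rep k etaleSurjective p

variable {k}

lemma isPullback_of {P X Y Z : PSh k} {a : P ⟶ X} {b : P ⟶ Y} {f : X ⟶ Z} {g : Y ⟶ Z}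
    (w : ∀ T p, f.app T (a.app T p) = g.app T (b.app T p))
    (h₁ : ∀ T p q, a.app T p = a.app T q → b.app T p = b.app T q → p = q)
    (h₂ : ∀ T x y, f.app T x = g.app T y → ∃ p, a.app T p = x ∧ b.app T p = y) :
    IsPullback a b f g := by
  apply IsPullback.of_forall_isPullback_app
  intro T
  rw [Types.isPullback_iff]
  exact ⟨by ext p; exact w T p, fun p q h ↦ h₁ T p q h.1 h.2, fun x y h ↦ h₂ T x y h⟩

lemma Rep.of_isPullback {P : MorphismProperty Scheme.{u}} {A X Y Z : PSh k} {a : A ⟶ X}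
    {b : A ⟶ Y} {f : X ⟶ Z} {g : Y ⟶ Z} (h : IsPullback a b f g) (hf : Rep k P f) :
    Rep k P b :=
  (MorphismProperty.relative_isStableUnderBaseChange _).of_isPullback h hf

lemma Rep.whiskerRight {P : MorphismProperty Scheme.{u}} {X X' : PSh k} {f : X ⟶ X'}
    (hf : Rep k P f) (Y : PSh k) : Rep k P (f ▷ Y) := by
  refine Rep.of_isPullback (a := CartesianMonoidalCategory.fst X Y)
    (g := CartesianMonoidalCategory.fst X' Y) (isPullback_of ?_ ?_ ?_) hf
  · intro T p; rfl
  · intro T p q h h'; exact Prod.ext h (congrArg Prod.snd h' :)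
  · intro T x y h; exact ⟨(x, y.2), rfl, Prod.ext h rfl⟩

lemma Rep.whiskerLeft {P : MorphismProperty Scheme.{u}} {X X' : PSh k} {f : X ⟶ X'}
    (hf : Rep k P f) (Y : PSh k) : Rep k P (Y ◁ f) := by
  refine Rep.of_isPullback (a := CartesianMonoidalCategory.snd Y X)
    (g := CartesianMonoidalCategory.snd Y X') (isPullback_of ?_ ?_ ?_) hf
  · intro T p; rfl
  · intro T p q h h'; exact Prod.ext (congrArg Prod.fst h' :) h
  · intro T x y h; exact ⟨(y.1, x), rfl, Prod.ext rfl h⟩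

lemma Rep.comp {P : MorphismProperty Scheme.{u}} [P.IsStableUnderComposition] {X Y Z : PSh k}
    {f : X ⟶ Y} {g : Y ⟶ Z} (hf : Rep k P f) (hg : Rep k P g) : Rep k P (f ≫ g) :=
  MorphismProperty.comp_mem _ _ _ hf hg

lemma Rep.tensorHom {P : MorphismProperty Scheme.{u}} [P.IsStableUnderComposition]
    {X X' Y Y' : PSh k} {f : X ⟶ X'} {g : Y ⟶ Y'} (hf : Rep k P f) (hg : Rep k P g) :
    Rep k P (f ⊗ₘ g) := by
  rw [MonoidalCategory.tensorHom_def]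
  exact (hf.whiskerRight Y).comp (hg.whiskerLeft X')

lemma Rep.comp_iso {P : MorphismProperty Scheme.{u}} {X Y Z : PSh k} {f : X ⟶ Y}
    (hf : Rep k P f) (e : Y ≅ Z) : Rep k P (f ≫ e.hom) :=
  (MorphismProperty.cancel_right_of_respectsIso _ f e.hom).2 hf

lemma Rep.iso_comp {P : MorphismProperty Scheme.{u}} {X Y Z : PSh k} {f : Y ⟶ Z}
    (hf : Rep k P f) (e : X ≅ Y) : Rep k P (e.hom ≫ f) :=
  (MorphismProperty.cancel_left_of_respectsIso _ e.hom f).2 hf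

instance : etaleSurjective.{u}.IsMultiplicative where
  id_mem _ := ⟨inferInstance, inferInstance⟩
  comp_mem f g hf hg := by
    obtain ⟨_, _⟩ := hf
    obtain ⟨_, _⟩ := hg
    exact ⟨inferInstance, inferInstance⟩

instance : quasiCompact.{u}.RespectsIso where
  precomp f hf g hg := by
    have : QuasiCompact g := hg
    have : IsIso f := hf
    exact (inferInstance : QuasiCompact (f ≫ g))
  postcomp f hf g hg := by
    have : QuasiCompact g := hg
    have : IsIso f := hf
    exact (inferInstance : QuasiCompact (g ≫ f))

instance : quasiCompact.{u}.IsStableUnderComposition where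
  comp_mem f g hf hg := by
    have : QuasiCompact f := hf
    have : QuasiCompact g := hg
    exact (inferInstance : QuasiCompact (f ≫ g))

instance : etaleSurjective.{u}.RespectsIso where
  precomp f hf g hg := by
    obtain ⟨_, _⟩ := hg
    have : IsIso f := hf
    exact ⟨inferInstance, inferInstance⟩
  postcomp f hf g hg := by
    obtain ⟨_, _⟩ := hg
    have : IsIso f := hf
    exact ⟨inferInstance, inferInstance⟩

lemma IsVariety.of_iso {X Y : PSh k} (e : X ≅ Y) (hX : IsVariety k X) : IsVariety k Y where
  isSheaf := Presieve.isSheaf_iso _ e hX.isSheaf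
  diagonal := by
    have : EquivariantVarieties.diagonal k Y =
        e.symm.hom ≫ EquivariantVarieties.diagonal k X ≫ (e ⊗ᵢ e).hom := by
      ext T y
      · simp
      · simp
    rw [this]
    exact (hX.diagonal.comp_iso _).iso_comp _
  atlas := by
    obtain ⟨U, p, h₁, h₂, h₃⟩ := hX.atlas
    exact ⟨U, p ≫ e.hom, h₁, h₂, h₃.comp_iso e⟩

lemma isSheaf_tensor {X Y : PSh k} (hX : Presieve.IsSheaf (etale k) X)
    (hY : Presieve.IsSheaf (etale k) Y) : Presieve.IsSheaf (etale k) (X ⊗ Y) := by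
  intro T R hR x hx
  obtain ⟨a, ha, ha'⟩ := hX R hR (fun T' f hf ↦ (x f hf).1)
    (fun _ _ _ g₁ g₂ f₁ f₂ h₁ h₂ w ↦ congrArg Prod.fst (hx g₁ g₂ h₁ h₂ w))
  obtain ⟨b, hb, hb'⟩ := hY R hR (fun T' f hf ↦ (x f hf).2)
    (fun _ _ _ g₁ g₂ f₁ f₂ h₁ h₂ w ↦ congrArg Prod.snd (hx g₁ g₂ h₁ h₂ w))
  refine ⟨(a, b), fun T' f hf ↦ Prod.ext (ha f hf) (hb f hf), fun y hy ↦ Prod.ext ?_ ?_⟩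
  · exact ha' _ fun T' f hf ↦ congrArg Prod.fst (hy f hf)
  · exact hb' _ fun T' f hf ↦ congrArg Prod.snd (hy f hf)

/-- The presheaf `X × Y` is represented by the product of schemes representing `X` and `Y`. -/
lemma exists_prod (U V : Sch k) :
    ∃ (W : Sch k), Nonempty (yoneda.obj W ≅ yoneda.obj U ⊗ yoneda.obj V) ∧
      (LocallyOfFinitePresentation U.hom → LocallyOfFinitePresentation V.hom →
        LocallyOfFinitePresentation W.hom) ∧
      (QuasiCompact U.hom → QuasiCompact V.hom → QuasiCompact W.hom) := by
  let W : Sch k := Over.mk (pullback.fst U.hom V.hom ≫ U.hom)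
  let p : W ⟶ U := Over.homMk (pullback.fst U.hom V.hom) rfl
  let q : W ⟶ V := Over.homMk (pullback.snd U.hom V.hom) pullback.condition.symm
  let e : yoneda.obj W ⟶ yoneda.obj U ⊗ yoneda.obj V :=
    CartesianMonoidalCategory.lift (yoneda.map p) (yoneda.map q)
  have he : ∀ T, Function.Bijective (e.app T) := by
    refine fun T ↦ ⟨fun (f : unop T ⟶ W) (g : unop T ⟶ W) h ↦ ?_,
      fun (x : (unop T ⟶ U) × (unop T ⟶ V)) ↦ ?_⟩
    · apply Over.OverMorphism.ext
      apply pullback.hom_ext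
      · exact congrArg (fun x : (unop T ⟶ U) × (unop T ⟶ V) ↦ x.1.left) h
      · exact congrArg (fun x : (unop T ⟶ U) × (unop T ⟶ V) ↦ x.2.left) h
    · refine ⟨(Over.homMk (pullback.lift x.1.left x.2.left (by simp)) (by
        simp only [W, Over.mk_hom, pullback.lift_fst_assoc, Over.w]) : unop T ⟶ W), ?_⟩
      refine Prod.ext (Over.OverMorphism.ext ?_) (Over.OverMorphism.ext ?_)
      · exact pullback.lift_fst _ _ _
      · exact pullback.lift_snd _ _ _
  have : ∀ T, IsIso (e.app T) := fun T ↦ (isIso_iff_bijective _).2 (he T)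
  have : IsIso e := NatIso.isIso_of_isIso_app e
  refine ⟨W, ⟨asIso e⟩, ?_, ?_⟩
  · intro h₁ h₂
    exact (inferInstance : LocallyOfFinitePresentation (pullback.fst U.hom V.hom ≫ U.hom))
  · intro h₁ h₂
    exact (inferInstance : QuasiCompact (pullback.fst U.hom V.hom ≫ U.hom))

lemma IsVariety.tensor {X Y : PSh k} (hX : IsVariety k X) (hY : IsVariety k Y) :
    IsVariety k (X ⊗ Y) where
  isSheaf := isSheaf_tensor hX.isSheaf hY.isSheaf
  diagonal := by
    let e : (X ⊗ X) ⊗ (Y ⊗ Y) ≅ (X ⊗ Y) ⊗ (X ⊗ Y) := NatIso.ofComponents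
      (fun T ↦ (Equiv.prodProdProdComm (X.obj T) (X.obj T) (Y.obj T) (Y.obj T)).toIso)
      (by intros; rfl)
    have : EquivariantVarieties.diagonal k (X ⊗ Y) = (EquivariantVarieties.diagonal k X ⊗ₘ
        EquivariantVarieties.diagonal k Y) ≫ e.hom := by
      rfl
    rw [this]
    exact (hX.diagonal.tensorHom hY.diagonal).comp_iso _
  atlas := by
    obtain ⟨U, p, h₁, h₂, h₃⟩ := hX.atlas
    obtain ⟨V, q, h₁', h₂', h₃'⟩ := hY.atlas
    obtain ⟨W, ⟨e⟩, h, h'⟩ := exists_prod U V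
    exact ⟨W, e.hom ≫ (p ⊗ₘ q), h h₁ h₁', h' h₂ h₂', (h₃.tensorHom h₃').iso_comp e⟩

instance : Scheme.etaleTopology.{u}.Subcanonical := by
  refine .of_le (K := Scheme.fppfTopology) ?_
  refine Precoverage.toGrothendieck_mono ?_
  refine Scheme.precoverage_mono ?_
  intro X Y f hf
  exact ⟨inferInstance, inferInstance⟩
/-- Separated schemes of finite presentation over `k` are varieties. -/
lemma isVariety_yoneda (U : Sch k) (h₁ : LocallyOfFinitePresentation U.hom)
    (h₂ : QuasiCompact U.hom) (h₃ : IsSeparated U.hom) : IsVariety k (yoneda.obj U) where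
  isSheaf := GrothendieckTopology.Subcanonical.isSheaf_of_isRepresentable _
  diagonal := by
    refine MorphismProperty.relative.of_exists fun T g ↦ ?_
    let a : T ⟶ U := (yonedaEquiv g).1
    let b : T ⟶ U := (yonedaEquiv g).2
    have hg : ∀ (T' : (Sch k)ᵒᵖ) (f : unop T' ⟶ T), g.app T' f = (f ≫ a, f ≫ b) := by
      intro T' f
      have h := congrArg (fun φ ↦ φ.app T' f) (yonedaEquiv.symm_apply_apply g)
      exact h.symm
    refine ⟨equalizer a b, yoneda.map (equalizer.ι a b ≫ a), equalizer.ι a b,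
      isPullback_of ?_ ?_ ?_, ?_⟩
    · intro T' (f : unop T' ⟶ equalizer a b)
      refine Eq.trans ?_ (hg T' (f ≫ equalizer.ι a b)).symm
      refine Prod.ext ?_ ?_
      · exact (Category.assoc f (equalizer.ι a b) a).symm
      · change f ≫ equalizer.ι a b ≫ a = (f ≫ equalizer.ι a b) ≫ b
        rw [equalizer.condition a b, Category.assoc]
    · intro T' (f : unop T' ⟶ equalizer a b) (f' : unop T' ⟶ equalizer a b) _ h'
      exact equalizer.hom_ext h'
    · intro T' (f : unop T' ⟶ U) (f' : unop T' ⟶ T) h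
      have h := h.trans (hg T' f')
      have h₁ : f = f' ≫ a := congrArg Prod.fst h
      have h₂ : f = f' ≫ b := congrArg Prod.snd h
      refine ⟨equalizer.lift f' (h₁.symm.trans h₂), ?_, ?_⟩
      · change equalizer.lift f' (h₁.symm.trans h₂) ≫ equalizer.ι a b ≫ a = f
        rw [equalizer.lift_ι_assoc, h₁]
      · exact equalizer.lift_ι f' (h₁.symm.trans h₂)
    · let e : equalizer a b ⟶ T := equalizer.ι a b
      have : IsClosedImmersion e.left :=
        isClosedImmersion_equalizer_ι_left (S := Spec (CommRingCat.of k)) (X := T) (Y := U) a b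
      exact (inferInstanceAs (QuasiCompact e.left))
  atlas := by
    exact ⟨U, 𝟙 _, h₁, h₂, MorphismProperty.id_mem (Rep k etaleSurjective) _⟩

/-- The constant group or set `S`, as the presheaf `T ↦ {locally constant functions T → S}`. It is
represented by the disjoint union of copies of `Spec k` indexed by `S`. -/
def const (S : Type) : PSh k where
  obj T := LocallyConstant (unop T).left S
  map f := TypeCat.ofHom fun c ↦ c.comap f.unop.left.base.hom

lemma mem_etale_of_opens {T : Sch k} {ι : Type} (U : ι → T.left.Opens)
    (hU : ∀ t, ∃ i, t ∈ U i) (R : Sieve T)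
    (hR : ∀ i, R (Over.homMk (U i).ι : Over.mk ((U i).ι ≫ T.hom) ⟶ T)) : R ∈ etale k T := by
  rw [GrothendieckTopology.mem_over_iff]
  refine Scheme.zariskiTopology_le_etaleTopology _ ?_
  refine GrothendieckTopology.superset_covering _ (S := Sieve.ofArrows (fun i ↦ (U i : Scheme.{u}))
    fun i ↦ (U i).ι) ?_ (Precoverage.generate_mem_toGrothendieck ?_)
  · rw [Sieve.ofArrows, Sieve.generate_le_iff]
    rintro _ _ ⟨i⟩
    rw [Sieve.overEquiv_iff]
    exact hR i
  · rw [Scheme.ofArrows_mem_precoverage_iff]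
    refine ⟨fun t ↦ ?_, fun i ↦ inferInstance⟩
    obtain ⟨i, hi⟩ := hU t
    exact ⟨i, by simpa using hi⟩

lemma empty_mem_etale (T : Sch k) [IsEmpty T.left] (R : Sieve T) : R ∈ etale k T :=
  mem_etale_of_opens (ι := PEmpty) PEmpty.elim (fun t ↦ isEmptyElim t) R (fun i ↦ i.elim)

lemma subsingleton_of_isEmpty {F : PSh k} (hF : Presieve.IsSheaf (etale k) F) (T : Sch k)
    [IsEmpty T.left] (x y : F.obj (op T)) : x = y :=
  (hF (⊥ : Sieve T) (empty_mem_etale T _)).isSeparatedFor.ext (fun _ _ h ↦ h.elim)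

/-- The open subscheme of `T` on which a locally constant function has a given value. -/
def valueOpen {T : Sch k} {S : Type} (c : LocallyConstant T.left S) (s : S) : T.left.Opens :=
  ⟨c ⁻¹' {s}, c.isLocallyConstant.isOpen_fiber s⟩

/-- The sieve of morphisms along which a locally constant function becomes constant. -/
def constancySieve {T : Sch k} {S : Type} (c : LocallyConstant T.left S) : Sieve T where
  arrows T' f := ∃ s, ∀ t, c (f.left t) = s
  downward_closed := by
    rintro T' T'' f ⟨s, hs⟩ g
    exact ⟨s, fun t ↦ by simpa using hs (g.left t)⟩

lemma constancySieve_mem {T : Sch k} {S : Type} (c : LocallyConstant T.left S) :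
    constancySieve c ∈ etale k T := by
  refine mem_etale_of_opens (valueOpen c) (fun t ↦ ⟨c t, rfl⟩) _ fun s ↦ ⟨s, fun t ↦ ?_⟩
  exact t.2

/-- Sections of a sheaf can be glued along a locally constant function. -/
lemma existsUnique_glue {F : PSh k} (hF : Presieve.IsSheaf (etale k) F) {T : Sch k} {S : Type}
    (c : LocallyConstant T.left S) (x : S → F.obj (op T)) :
    ∃! y : F.obj (op T), ∀ (T' : Sch k) (f : T' ⟶ T) (s : S), (∀ t, c (f.left t) = s) →
      F.map f.op y = F.map f.op (x s) := by
  classical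
  have key : ∀ (T' : Sch k) (f : T' ⟶ T) (s s' : S), (∀ t, c (f.left t) = s) →
      (∀ t, c (f.left t) = s') → F.map f.op (x s) = F.map f.op (x s') := by
    intro T' f s s' h h'
    rcases isEmpty_or_nonempty T'.left with hT | ⟨⟨t⟩⟩
    · exact subsingleton_of_isEmpty hF T' _ _
    · rw [← h t, ← h' t]
  obtain ⟨y, hy, hy'⟩ := hF (constancySieve c) (constancySieve_mem c)
    (fun T' f hf ↦ F.map f.op (x hf.choose)) (by
      intro T₁ T₂ T' g₁ g₂ f₁ f₂ h₁ h₂ w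
      have e₁ : F.map g₁.op (F.map f₁.op (x h₁.choose)) = F.map (g₁ ≫ f₁).op (x h₁.choose) := by
        simp
      have e₂ : F.map g₂.op (F.map f₂.op (x h₂.choose)) = F.map (g₁ ≫ f₁).op (x h₂.choose) := by
        rw [w]; simp
      refine e₁.trans (Eq.trans ?_ e₂.symm)
      refine key _ _ _ _ (fun t ↦ ?_) (fun t ↦ ?_)
      · simpa using h₁.choose_spec (g₁.left t)
      · rw [w]; simpa using h₂.choose_spec (g₂.left t))
  refine ⟨y, fun T' f s hs ↦ ?_, fun z hz ↦ hy' z fun T' f hf ↦ hz T' f _ hf.choose_spec⟩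
  have h : ∃ s, ∀ t, c (f.left t) = s := ⟨s, hs⟩
  exact (hy f h).trans (key _ _ _ _ h.choose_spec hs)

/-- The section that agrees with `x s` where `c` takes the value `s`. -/
def glue {F : PSh k} (hF : Presieve.IsSheaf (etale k) F) {T : Sch k} {S : Type}
    (c : LocallyConstant T.left S) (x : S → F.obj (op T)) : F.obj (op T) :=
  (existsUnique_glue hF c x).choose

lemma map_glue {F : PSh k} (hF : Presieve.IsSheaf (etale k) F) {T : Sch k} {S : Type}
    (c : LocallyConstant T.left S) (x : S → F.obj (op T)) {T' : Sch k} (f : T' ⟶ T) (s : S)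
    (hs : ∀ t, c (f.left t) = s) : F.map f.op (glue hF c x) = F.map f.op (x s) :=
  (existsUnique_glue hF c x).choose_spec.1 T' f s hs

lemma eq_glue {F : PSh k} (hF : Presieve.IsSheaf (etale k) F) {T : Sch k} {S : Type}
    (c : LocallyConstant T.left S) (x : S → F.obj (op T)) (y : F.obj (op T))
    (hy : ∀ (T' : Sch k) (f : T' ⟶ T) (s : S), (∀ t, c (f.left t) = s) →
      F.map f.op y = F.map f.op (x s)) : y = glue hF c x :=
  (existsUnique_glue hF c x).choose_spec.2 y hy

lemma const_map_apply {S : Type} {T T' : Sch k} (c : LocallyConstant T.left S) (g : T' ⟶ T)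
    (t : T'.left) :
    DFunLike.coe (F := LocallyConstant T'.left S) ((const (k := k) S).map g.op c) t =
      c (g.left t) :=
  rfl

lemma glue_naturality {F : PSh k} (hF : Presieve.IsSheaf (etale k) F) {T T' : Sch k} {S : Type}
    (c : LocallyConstant T.left S) (x : S → F.obj (op T)) (g : T' ⟶ T) :
    F.map g.op (glue hF c x) =
      glue hF ((const (k := k) S).map g.op c) (fun s ↦ F.map g.op (x s)) := by
  refine eq_glue hF _ _ _ fun T'' f s hs ↦ ?_
  have h : ∀ t, c ((f ≫ g).left t) = s := fun t ↦ by
    rw [← hs t]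
    exact Eq.trans (by simp) (const_map_apply c g (f.left t)).symm
  simpa using map_glue hF c x (f ≫ g) s h

section

variable (S : Type)

/-- The disjoint union of copies of `Spec k` indexed by `S`. -/
def constScheme : Sch k :=
  Over.mk (Limits.Sigma.desc fun _ : S ↦ 𝟙 (Spec (CommRingCat.of k)))

/-- The inclusion of a point in the constant scheme. -/
def constPoint (s : S) (T : Sch k) : T ⟶ constScheme S :=
  Over.homMk (T.hom ≫ Limits.Sigma.ι (fun _ : S ↦ Spec (CommRingCat.of k)) s) (by
    simp [constScheme])

lemma comp_constPoint (s : S) {T T' : Sch k} (g : T' ⟶ T) :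
    g ≫ constPoint S s T = constPoint S s T' := by
  apply Over.OverMorphism.ext
  exact Over.w_assoc g _

lemma isSheaf_yoneda (U : Sch k) : Presieve.IsSheaf (etale k) (yoneda.obj U) :=
  GrothendieckTopology.Subcanonical.isSheaf_of_isRepresentable _

/-- The morphism to the constant scheme given by a locally constant function. -/
def toConstScheme {T : Sch k} (c : LocallyConstant T.left S) : T ⟶ constScheme S :=
  glue (isSheaf_yoneda _) c fun s ↦ constPoint S s T

lemma comp_toConstScheme {T T' : Sch k} (c : LocallyConstant T.left S) (g : T' ⟶ T) (s : S)
    (hs : ∀ t, c (g.left t) = s) : g ≫ toConstScheme S c = constPoint S s T' :=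
  (map_glue (isSheaf_yoneda (constScheme S)) c (fun s ↦ constPoint S s T) g s hs).trans
    (comp_constPoint S s g)

lemma toConstScheme_naturality {T T' : Sch k} (c : LocallyConstant T.left S) (g : T' ⟶ T) :
    g ≫ toConstScheme S c = toConstScheme S ((const (k := k) S).map g.op c) := by
  refine (glue_naturality (isSheaf_yoneda _) c _ g).trans ?_
  refine congrArg (glue _ _) (funext fun s ↦ comp_constPoint S s g)

lemma toConstScheme_apply {T : Sch k} (c : LocallyConstant T.left S) (t : T.left) :
    (toConstScheme S c).left t =
      Limits.Sigma.ι (fun _ : S ↦ Spec (CommRingCat.of k)) (c t) (T.hom t) := by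
  let f : Over.mk ((valueOpen c (c t)).ι ≫ T.hom) ⟶ T := Over.homMk (valueOpen c (c t)).ι
  have h₁ := comp_toConstScheme S c f (c t) (fun t ↦ t.2)
  have h₂ := congrArg (fun z ↦ z.left ⟨t, rfl⟩) h₁
  exact h₂

lemma toConstScheme_injective {T : Sch k} :
    Function.Injective (toConstScheme (T := T) S) := by
  intro c c' h
  apply LocallyConstant.ext
  intro t
  have h₁ := (toConstScheme_apply S c t).symm.trans (h ▸ toConstScheme_apply S c' t)
  exact congrArg Sigma.fst ((sigmaι_eq_iff _ _ _ _ _).1 h₁)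

lemma toConstScheme_surjective {T : Sch k} :
    Function.Surjective (toConstScheme (T := T) S) := by
  intro y
  let ι := Limits.Sigma.ι (fun _ : S ↦ Spec (CommRingCat.of k))
  let d : (∐ fun _ : S ↦ Spec (CommRingCat.of k)) ⟶ Spec (CommRingCat.of k) :=
    Limits.Sigma.desc fun _ : S ↦ 𝟙 (Spec (CommRingCat.of k))
  let z : T.left ⟶ (∐ fun _ : S ↦ Spec (CommRingCat.of k)) := y.left
  have hz : z ≫ d = T.hom := Over.w y
  have hd : ∀ s, ι s ≫ d = 𝟙 _ := fun s ↦ by simp [ι, d]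
  have hex : ∀ t, ∃ s, z t ∈ (ι s).opensRange := by
    intro t
    obtain ⟨s, x, hx⟩ := (sigmaOpenCover fun _ : S ↦ Spec (CommRingCat.of k)).exists_eq (z t)
    exact ⟨s, x, hx⟩
  choose c₀ hc₀ using hex
  have huniq : ∀ t s, z t ∈ (ι s).opensRange → c₀ t = s := by
    rintro t s ⟨x, hx⟩
    obtain ⟨x', hx'⟩ := hc₀ t
    exact congrArg Sigma.fst ((sigmaι_eq_iff _ _ _ _ _).1 (hx'.trans hx.symm))
  let c : LocallyConstant T.left S := ⟨c₀, by
    rw [IsLocallyConstant.iff_exists_open]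
    intro t
    refine ⟨z ⁻¹ᵁ (ι (c₀ t)).opensRange, (z ⁻¹ᵁ (ι (c₀ t)).opensRange).2, hc₀ t, ?_⟩
    intro t' ht'
    exact huniq t' _ ht'⟩
  refine ⟨c, (eq_glue (isSheaf_yoneda (constScheme S)) c _ y fun T' f s hs ↦ ?_).symm⟩
  refine Eq.trans ?_ (comp_constPoint S s f).symm
  change f ≫ y = constPoint S s T'
  apply Over.OverMorphism.ext
  change f.left ≫ z = T'.hom ≫ ι s
  have hr : Set.range (f.left ≫ z) ⊆ Set.range (ι s) := by
    rintro _ ⟨t, rfl⟩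
    have := hc₀ (f.left t)
    rw [show c₀ (f.left t) = s from hs t] at this
    simpa using this
  rw [← IsOpenImmersion.lift_fac (ι s) (f.left ≫ z) hr]
  congr 1
  rw [← Category.comp_id (IsOpenImmersion.lift _ _ hr), ← hd s, IsOpenImmersion.lift_fac_assoc,
    Category.assoc, hz]
  exact Over.w f

/-- The constant sheaf is represented by the constant scheme. -/
def constIso : const (k := k) S ≅ yoneda.obj (constScheme S) :=
  NatIso.ofComponents (fun T ↦ (Equiv.ofBijective (toConstScheme (T := unop T) S)
    ⟨toConstScheme_injective S, toConstScheme_surjective S⟩).toIso) (by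
      intro T T' g
      ext c
      exact (toConstScheme_naturality S c g.unop).symm)

lemma isVariety_const [Finite S] : IsVariety k (const S) := by
  have : IsAffine (∐ fun _ : S ↦ Spec (CommRingCat.of k)) := inferInstance
  refine (isVariety_yoneda (constScheme S) ?_ ?_ ?_).of_iso (constIso S).symm
  · have h : ∀ s : S, LocallyOfFinitePresentation (𝟙 (Spec (CommRingCat.of k))) :=
      fun _ ↦ inferInstance
    have : IsZariskiLocalAtSource @LocallyOfFinitePresentation :=
      HasRingHomProperty.instIsZariskiLocalAtSource (P := @LocallyOfFinitePresentation)
        (Q := RingHom.FinitePresentation)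
    exact IsZariskiLocalAtSource.sigmaDesc h
  · have : IsAffineHom (Limits.Sigma.desc fun _ : S ↦ 𝟙 (Spec (CommRingCat.of k))) :=
      inferInstance
    exact (inferInstance :
      QuasiCompact (Limits.Sigma.desc fun _ : S ↦ 𝟙 (Spec (CommRingCat.of k))))
  · exact (inferInstance :
      IsSeparated (Limits.Sigma.desc fun _ : S ↦ 𝟙 (Spec (CommRingCat.of k))))

end

lemma isVariety_unit : IsVariety k (𝟙_ (PSh k)) := by
  let e : const (k := k) Unit ≅ 𝟙_ (PSh k) := NatIso.ofComponents (fun T ↦ Equiv.toIso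
    { toFun := fun _ ↦ PUnit.unit
      invFun := fun _ ↦ LocallyConstant.const _ ()
      left_inv := fun c ↦ LocallyConstant.ext fun t ↦ rfl
      right_inv := fun _ ↦ rfl }) (fun f ↦ rfl)
  exact (isVariety_const Unit).of_iso e

variable (k) in
/-- The category of varieties over `k`. -/
abbrev Var : Type (u + 1) := ObjectProperty.FullSubcategory (IsVariety k)

instance : ObjectProperty.IsMonoidal (IsVariety k) where
  prop_unit := isVariety_unit
  prop_tensor _ _ h₁ h₂ := h₁.tensor h₂

variable (k) in
/-- The category of varieties over `k` with an action of `G`, and equivariant morphisms. -/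
abbrev GVar (G : Type) [Group G] : Type (u + 1) := Action (Var k) G

section Equivariant

variable {G : Type} [Group G]

/-- The presheaf underlying a `G`-variety. -/
abbrev GVar.psh (X : GVar k G) : PSh k := X.V.obj

/-- The morphism of presheaves underlying an equivariant morphism. -/
abbrev pshHom {X Y : GVar k G} (f : X ⟶ Y) : X.psh ⟶ Y.psh := f.hom.hom

/-- The action of an element `g` on a `G`-variety. -/
def GVar.act (X : GVar k G) (g : G) : X.psh ⟶ X.psh :=
  (ObjectProperty.ι (IsVariety k)).map (X.ρ g)

lemma GVar.act_one (X : GVar k G) : X.act 1 = 𝟙 _ := by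
  rw [GVar.act, Action.ρ_one]
  rfl

lemma GVar.act_mul (X : GVar k G) (g h : G) : X.act (g * h) = X.act h ≫ X.act g := by
  rw [GVar.act, map_mul]
  rfl

lemma GVar.act_mul_apply (X : GVar k G) (g h : G) {T : (Sch k)ᵒᵖ} (x : X.psh.obj T) :
    (X.act (g * h)).app T x = (X.act g).app T ((X.act h).app T x) := by
  rw [GVar.act_mul]
  rfl

lemma GVar.act_one_apply (X : GVar k G) {T : (Sch k)ᵒᵖ} (x : X.psh.obj T) :
    (X.act 1).app T x = x := by
  rw [GVar.act_one]
  rfl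

lemma GVar.act_inv_act (X : GVar k G) (g : G) {T : (Sch k)ᵒᵖ} (x : X.psh.obj T) :
    (X.act g⁻¹).app T ((X.act g).app T x) = x := by
  rw [← GVar.act_mul_apply, inv_mul_cancel, GVar.act_one_apply]

lemma act_comm {X Y : GVar k G} (f : X ⟶ Y) (g : G) :
    X.act g ≫ pshHom f = pshHom f ≫ Y.act g :=
  congrArg (ObjectProperty.ι (IsVariety k)).map (f.comm g)

/-- A presheaf that is a variety, with an action of `G`, as a `G`-variety. -/
def GVar.of (X : PSh k) (hX : IsVariety k X) (a : G → (X ⟶ X)) (h₁ : a 1 = 𝟙 X)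
    (hm : ∀ g h, a (g * h) = a h ≫ a g) : GVar k G where
  V := ⟨X, hX⟩
  ρ := 
    { toFun := fun g ↦ ObjectProperty.homMk (a g)
      map_one' := by rw [h₁]; rfl
      map_mul' := fun g h ↦ by rw [hm]; rfl }

/-- An equivariant morphism of presheaves as a morphism of `G`-varieties. -/
def GVar.homMk {X Y : GVar k G} (f : X.psh ⟶ Y.psh) (hf : ∀ g, X.act g ≫ f = f ≫ Y.act g) :
    X ⟶ Y where
  hom := ObjectProperty.homMk f
  comm g := ObjectProperty.hom_ext _ (hf g)

/-- An equivariant isomorphism of presheaves as an isomorphism of `G`-varieties. -/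
def GVar.isoMk {X Y : GVar k G} (e : X.psh ≅ Y.psh)
    (he : ∀ g, X.act g ≫ e.hom = e.hom ≫ Y.act g) : X ≅ Y where
  hom := GVar.homMk e.hom he
  inv := GVar.homMk e.inv fun g ↦ by
    rw [Iso.comp_inv_eq, Category.assoc, he, Iso.inv_hom_id_assoc]
  hom_inv_id := Action.hom_ext _ _ (ObjectProperty.hom_ext _ e.hom_inv_id)
  inv_hom_id := Action.hom_ext _ _ (ObjectProperty.hom_ext _ e.inv_hom_id)

end Equivariant

section Relations

/-- `i : Z ⟶ X` is a closed immersion and `j : U ⟶ X` is the inclusion of the complement of its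
image, which is the subfunctor of those points `x : T ⟶ X` for which `T ×[X] Z` is empty. -/
structure IsClosedDecomposition {Z U X : PSh k} (i : Z ⟶ X) (j : U ⟶ X) : Prop where
  closed : Rep k closedImmersion i
  injective : ∀ T : Sch k, Function.Injective (j.app (op T))
  mem_range_iff : ∀ (T : Sch k) (x : X.obj (op T)), x ∈ Set.range (j.app (op T)) ↔
    ∀ (T' : Sch k) (f : T' ⟶ T), Nonempty T'.left → X.map f.op x ∉ Set.range (i.app (op T'))

/-- The `T`-points of `E` that lie over a given `T`-point `x` of `X`. -/
def Fib {E X : PSh k} (p : E ⟶ X) {T : Sch k} (x : X.obj (op T)) : Type u :=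
  {e : E.obj (op T) // p.app (op T) e = x}

/-- Restriction of points in a fibre along a morphism of `k`-schemes. -/
def Fib.res {E X : PSh k} {p : E ⟶ X} {T T' : Sch k} {x : X.obj (op T)} (f : T' ⟶ T)
    (e : Fib p x) : Fib p (X.map f.op x) :=
  ⟨E.map f.op e.1, by rw [NatTrans.naturality_apply, e.2]⟩

/-- The map on fibres induced by a commutative square. -/
def Fib.map {E X E' X' : PSh k} {p : E ⟶ X} {p' : E' ⟶ X'} (a : E ⟶ E') (b : X ⟶ X')
    (w : p ≫ b = a ≫ p') {T : Sch k} {x : X.obj (op T)} (e : Fib p x) :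
    Fib p' (b.app (op T) x) :=
  ⟨a.app (op T) e.1, by
    have := congrArg (fun φ ↦ φ.app (op T) e.1) w
    refine this.symm.trans ?_
    exact congrArg (b.app (op T)) e.2⟩

/-- A module structure, over the ring of functions on `T`, on the set of `T`-points of `E` over each
`T`-point of `X`. -/
class FibreModule {E X : PSh k} (p : E ⟶ X) where
  addCommGroup : ∀ {T : Sch k} (x : X.obj (op T)), AddCommGroup (Fib p x)
  module : ∀ {T : Sch k} (x : X.obj (op T)), Module Γ(T.left, ⊤) (Fib p x)

attribute [reducible, instance] FibreModule.addCommGroup FibreModule.module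

/-- The module structures on the fibres make `p : E ⟶ X` a vector bundle of rank `d`: they are
compatible with restriction and étale locally on the base there is a basis of `d` sections. -/
structure FibreModule.IsLocallyFree {E X : PSh k} (p : E ⟶ X) [FibreModule p] (d : ℕ) :
    Prop where
  res_add : ∀ {T T' : Sch k} (f : T' ⟶ T) {x : X.obj (op T)} (e e' : Fib p x),
    (e + e').res f = e.res f + e'.res f
  res_smul : ∀ {T T' : Sch k} (f : T' ⟶ T) {x : X.obj (op T)} (r : Γ(T.left, ⊤)) (e : Fib p x),
    (r • e).res f = f.left.appTop r • e.res f
  exists_basis : ∀ {T : Sch k} (x : X.obj (op T)), ∃ R ∈ etale k T,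
    ∀ (T' : Sch k) (f : T' ⟶ T), R f → ∃ b : Fin d → Fib p (X.map f.op x),
      ∀ (T'' : Sch k) (g : T'' ⟶ T'),
        Function.Bijective fun r : Fin d → Γ(T''.left, ⊤) ↦ ∑ i, r i • (b i).res g

/-- `p : E ⟶ X` is a vector bundle of rank `d` (for some choice of linear structure). -/
def IsVectorBundle {E X : PSh k} (p : E ⟶ X) (d : ℕ) : Prop :=
  ∃ _ : FibreModule p, FibreModule.IsLocallyFree p d

/-- A commutative square induces linear maps on the fibres of the vertical morphisms. -/
structure IsFibrewiseLinear {E X E' X' : PSh k} {p : E ⟶ X} {p' : E' ⟶ X'} [FibreModule p]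
    [FibreModule p'] (a : E ⟶ E') (b : X ⟶ X') (w : p ≫ b = a ≫ p') : Prop where
  map_add : ∀ {T : Sch k} {x : X.obj (op T)} (e e' : Fib p x),
    (e + e').map a b w = e.map a b w + e'.map a b w
  map_smul : ∀ {T : Sch k} {x : X.obj (op T)} (r : Γ(T.left, ⊤)) (e : Fib p x),
    (r • e).map a b w = r • e.map a b w

/-- The equivariant morphism `p : E ⟶ X` is a `G`-equivariant vector bundle of rank `d`: it is a
vector bundle, and `G` acts on it by linear maps between fibres. -/
def IsEquivariantVectorBundle {G : Type} [Group G] {E X : GVar k G} (p : E ⟶ X) (d : ℕ) : Prop :=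
  ∃ _ : FibreModule (pshHom p), FibreModule.IsLocallyFree (pshHom p) d ∧
    ∀ g, IsFibrewiseLinear (E.act g) (X.act g) (act_comm p g).symm

section Pullback

variable {E X E' X' : PSh k} {p : E ⟶ X} {p' : E' ⟶ X'}

lemma Fib.add_congr [FibreModule p] {T : Sch k} {x y : X.obj (op T)} (h : x = y)
    {e₁ e₂ : Fib p x} {e₁' e₂' : Fib p y} (h₁ : e₁.1 = e₁'.1) (h₂ : e₂.1 = e₂'.1) :
    (e₁ + e₂).1 = (e₁' + e₂').1 := by
  subst h
  obtain rfl := Subtype.ext h₁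
  obtain rfl := Subtype.ext h₂
  rfl

lemma Fib.smul_congr [FibreModule p] {T : Sch k} {x y : X.obj (op T)} (h : x = y)
    (r : Γ(T.left, ⊤)) {e : Fib p x} {e' : Fib p y} (h₁ : e.1 = e'.1) :
    (r • e).1 = (r • e').1 := by
  subst h
  obtain rfl := Subtype.ext h₁
  rfl

/-- The fibre over a point only depends on the point. -/
def Fib.cast {T : Sch k} {x y : X.obj (op T)} (h : x = y) : Fib p x ≃ Fib p y :=
  Equiv.cast (congrArg _ h)

lemma Fib.cast_val {T : Sch k} {x y : X.obj (op T)} (h : x = y) (e : Fib p x) :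
    (Fib.cast h e).1 = e.1 := by
  subst h
  rfl

lemma Fib.sum_congr [FibreModule p] {T : Sch k} {x y : X.obj (op T)} (h : x = y) {d : ℕ}
    (r : Fin d → Γ(T.left, ⊤)) {e : Fin d → Fib p x} {e' : Fin d → Fib p y}
    (h₁ : ∀ i, (e i).1 = (e' i).1) :
    Fib.cast h (∑ i, r i • e i) = ∑ i, r i • e' i := by
  subst h
  obtain rfl : e = e' := funext fun i ↦ Subtype.ext (h₁ i)
  rfl

variable (a : E' ⟶ E) (b : X' ⟶ X) (w : p' ≫ b = a ≫ p)

/-- Module structures on fibres are pulled back along a cartesian square. -/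
abbrev FibreModule.pullback [FibreModule p]
    (hw : ∀ {T : Sch k} (x : X'.obj (op T)),
      Function.Bijective (Fib.map a b w : Fib p' x → Fib p (b.app (op T) x))) :
    FibreModule p' where
  addCommGroup x := (Equiv.ofBijective _ (hw x)).addCommGroup
  module {T} x :=
    letI := (Equiv.ofBijective _ (hw x)).addCommGroup
    (Equiv.ofBijective _ (hw x)).module Γ(T.left, ⊤)

lemma Fib.map_res_val {T T' : Sch k} (f : T' ⟶ T) {x : X'.obj (op T)} (e : Fib p' x) :
    ((e.res f).map a b w).1 = ((e.map a b w).res f).1 :=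
  congrArg (fun φ ↦ φ e.1) (a.naturality f.op)

variable [FibreModule p]
    (hw : ∀ {T : Sch k} (x : X'.obj (op T)),
      Function.Bijective (Fib.map a b w : Fib p' x → Fib p (b.app (op T) x)))

lemma FibreModule.isFibrewiseLinear_pullback :
    letI := FibreModule.pullback a b w hw
    IsFibrewiseLinear a b w :=
  letI := FibreModule.pullback a b w hw
  { map_add := fun {_ x} _ _ ↦ (Equiv.ofBijective _ (hw x)).apply_symm_apply _
    map_smul := fun {_ x} _ _ ↦ (Equiv.ofBijective _ (hw x)).apply_symm_apply _ }

lemma FibreModule.isLocallyFree_pullback {d : ℕ} (hp : FibreModule.IsLocallyFree p d) :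
    letI := FibreModule.pullback a b w hw
    FibreModule.IsLocallyFree p' d := by
  let := FibreModule.pullback a b w hw
  have hlin := FibreModule.isFibrewiseLinear_pullback a b w hw
  have hb : ∀ {T T' : Sch k} (f : T' ⟶ T) (x : X'.obj (op T)),
      b.app (op T') (X'.map f.op x) = X.map f.op (b.app (op T) x) :=
    fun f x ↦ NatTrans.naturality_apply b f.op x
  refine ⟨?_, ?_, ?_⟩
  · intro T T' f x e e'
    apply (hw _).1
    apply Subtype.ext
    rw [Fib.map_res_val, hlin.map_add, hlin.map_add, hp.res_add]
    exact Fib.add_congr (hb f x).symm (Fib.map_res_val a b w f e).symm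
      (Fib.map_res_val a b w f e').symm
  · intro T T' f x r e
    apply (hw _).1
    apply Subtype.ext
    rw [Fib.map_res_val, hlin.map_smul, hlin.map_smul, hp.res_smul]
    exact Fib.smul_congr (hb f x).symm _ (Fib.map_res_val a b w f e).symm
  · intro T x
    obtain ⟨R, hR, h⟩ := hp.exists_basis (b.app (op T) x)
    refine ⟨R, hR, fun T' f hf ↦ ?_⟩
    obtain ⟨v, hv⟩ := h T' f hf
    choose v' hv' using fun i ↦ (hw (X'.map f.op x)).2 (Fib.cast (hb f x).symm (v i))
    refine ⟨v', fun T'' g ↦ ?_⟩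
    have e : X.map g.op (X.map f.op (b.app (op T) x)) =
        b.app (op T'') (X'.map g.op (X'.map f.op x)) := by
      rw [hb, hb]
    have hbij := (Fib.cast (p := p) e).bijective.comp (hv T'' g)
    refine (Function.Bijective.of_comp_iff' (hw (X'.map g.op (X'.map f.op x))) _).1 ?_
    convert! hbij using 1
    funext r
    have hsum : ∀ r : Fin d → Γ(T''.left, ⊤), (∑ i, r i • (v' i).res g).map a b w =
        ∑ i, r i • ((v' i).res g).map a b w := by
      intro r
      let φ : Fib p' (X'.map g.op (X'.map f.op x)) →+ Fib p _ := AddMonoidHom.mk' (Fib.map a b w)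
        hlin.map_add
      refine (map_sum φ _ _).trans (Finset.sum_congr rfl fun i _ ↦ hlin.map_smul _ _)
    refine (hsum r).trans (Fib.sum_congr e r fun i ↦ ?_).symm
    rw [Fib.map_res_val]
    change E.map g.op _ = E.map g.op _
    rw [hv', Fib.cast_val]

end Pullback

end Relations

section GrothendieckRing

variable (k)

/-- Affine `d`-space, as a variety over `k`. -/
def affineSpace (d : ℕ) : Var k where
  obj := yoneda.obj (Over.mk (𝔸(ULift.{u} (Fin d); Spec (CommRingCat.of k)) ↘
    Spec (CommRingCat.of k)))
  property := isVariety_yoneda _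
    (inferInstanceAs (LocallyOfFinitePresentation (𝔸(ULift.{u} (Fin d); _) ↘ _)))
    (inferInstanceAs (QuasiCompact (𝔸(ULift.{u} (Fin d); _) ↘ _)))
    (inferInstanceAs (IsSeparated (𝔸(ULift.{u} (Fin d); _) ↘ _)))

variable (G : Type) [Group G]

/-- The free abelian group on the isomorphism classes of `G`-varieties. It is a commutative ring
with the multiplication that is induced by the product of `G`-varieties. -/
abbrev FreeVar : Type (u + 1) := FreeAbelianGroup (Skeleton (GVar k G))

variable {k G}

/-- The generator given by a `G`-variety. -/
abbrev FreeVar.mk (X : GVar k G) : FreeVar k G := FreeAbelianGroup.of (toSkeleton X)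

variable (k G)

/-- The defining relations of the Grothendieck group of `G`-varieties. -/
def K0.relations : Set (FreeVar k G) :=
  {z | ∃ (X Z U : GVar k G) (i : Z ⟶ X) (j : U ⟶ X),
    IsClosedDecomposition (pshHom i) (pshHom j) ∧
      z = FreeVar.mk X - (FreeVar.mk U + FreeVar.mk Z)} ∪
  {z | ∃ (E X : GVar k G) (p : E ⟶ X) (d : ℕ), IsEquivariantVectorBundle p d ∧
    z = FreeVar.mk E - FreeVar.mk (Action.trivial G (affineSpace k d) ⊗ X)}

variable {k G}

lemma FreeVar.mk_tensor (X Y : GVar k G) :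
    FreeVar.mk (X ⊗ Y) = FreeVar.mk X * FreeVar.mk Y := by
  rw [FreeVar.mk, Skeleton.toSkeleton_tensorObj, FreeAbelianGroup.of_mul]

lemma IsClosedDecomposition.whiskerLeft {Z U X : PSh k} {i : Z ⟶ X} {j : U ⟶ X}
    (h : IsClosedDecomposition i j) (Y : PSh k) : IsClosedDecomposition (Y ◁ i) (Y ◁ j) where
  closed := h.closed.whiskerLeft Y
  injective T x y hxy := Prod.ext (congrArg Prod.fst hxy :) (h.injective T (congrArg Prod.snd hxy :))
  mem_range_iff T x := by
    have h₁ : x ∈ Set.range ((Y ◁ j).app (op T)) ↔ x.2 ∈ Set.range (j.app (op T)) :=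
      ⟨fun ⟨y, hy⟩ ↦ ⟨y.2, congrArg Prod.snd hy⟩, fun ⟨y, hy⟩ ↦ ⟨(x.1, y), Prod.ext rfl hy⟩⟩
    have h₂ : ∀ (T' : Sch k) (f : T' ⟶ T), (Y ⊗ X).map f.op x ∈ Set.range ((Y ◁ i).app (op T')) ↔
        X.map f.op x.2 ∈ Set.range (i.app (op T')) := fun T' f ↦
      ⟨fun ⟨y, hy⟩ ↦ ⟨y.2, congrArg Prod.snd hy⟩,
        fun ⟨y, hy⟩ ↦ ⟨(Y.map f.op x.1, y), Prod.ext rfl hy⟩⟩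
    rw [h₁, h.mem_range_iff]
    simp_rw [h₂]

lemma IsFibrewiseLinear.of_comm {E X E' X' : PSh k} {p : E ⟶ X} {p' : E' ⟶ X'} [FibreModule p]
    [FibreModule p'] {a : E' ⟶ E} {b : X' ⟶ X} {w : p' ≫ b = a ≫ p}
    (h : IsFibrewiseLinear a b w)
    (hw : ∀ {T : Sch k} (x : X'.obj (op T)),
      Function.Injective (Fib.map a b w : Fib p' x → Fib p (b.app (op T) x)))
    {α : E ⟶ E} {β : X ⟶ X} {v : p ≫ β = α ≫ p} (hv : IsFibrewiseLinear α β v)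
    {α' : E' ⟶ E'} {β' : X' ⟶ X'} (v' : p' ≫ β' = α' ≫ p') (hα : α' ≫ a = a ≫ α)
    (hβ : β' ≫ b = b ≫ β) : IsFibrewiseLinear α' β' v' := by
  have hval : ∀ {T : Sch k} {x : X'.obj (op T)} (e : Fib p' x),
      ((e.map α' β' v').map a b w).1 = ((e.map a b w).map α β v).1 := fun e ↦
    congrArg (fun φ ↦ φ.app _ e.1) hα
  have hβ' : ∀ {T : Sch k} (x : X'.obj (op T)),
      b.app (op T) (β'.app (op T) x) = β.app (op T) (b.app (op T) x) := fun x ↦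
    congrArg (fun φ ↦ φ.app _ x) hβ
  refine ⟨fun {T x} e e' ↦ ?_, fun {T x} r e ↦ ?_⟩
  · apply hw
    apply Subtype.ext
    rw [hval, h.map_add, h.map_add, hv.map_add]
    exact Fib.add_congr (hβ' x).symm (hval e).symm (hval e').symm
  · apply hw
    apply Subtype.ext
    rw [hval, h.map_smul, h.map_smul, hv.map_smul]
    exact Fib.smul_congr (hβ' x).symm _ (hval e).symm

lemma IsEquivariantVectorBundle.whiskerLeft {E X : GVar k G} {p : E ⟶ X} {d : ℕ}
    (h : IsEquivariantVectorBundle p d) (Y : GVar k G) :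
    IsEquivariantVectorBundle (Y ◁ p) d := by
  obtain ⟨_, hp, hlin⟩ := h
  let a : (Y ⊗ E).psh ⟶ E.psh := CartesianMonoidalCategory.snd Y.psh E.psh
  let b : (Y ⊗ X).psh ⟶ X.psh := CartesianMonoidalCategory.snd Y.psh X.psh
  have w : pshHom (Y ◁ p) ≫ b = a ≫ pshHom p := rfl
  have hw : ∀ {T : Sch k} (x : (Y ⊗ X).psh.obj (op T)),
      Function.Bijective (Fib.map a b w : Fib (pshHom (Y ◁ p)) x → _) := by
    intro T x
    refine ⟨fun e e' h ↦ Subtype.ext (Prod.ext ?_ ?_), fun e ↦ ?_⟩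
    · exact (congrArg Prod.fst (e.2.trans e'.2.symm) :)
    · exact (congrArg Subtype.val h :)
    · exact ⟨⟨(x.1, e.1), Prod.ext rfl e.2⟩, rfl⟩
  let := FibreModule.pullback a b w hw
  have h₁ := FibreModule.isFibrewiseLinear_pullback a b w hw
  exact ⟨inferInstance, FibreModule.isLocallyFree_pullback a b w hw hp, fun g ↦
    h₁.of_comm (fun x ↦ (hw x).1) (hlin g) _ rfl rfl⟩

lemma K0.mk_mul_mem_relations (Y : GVar k G) {z : FreeVar k G} (hz : z ∈ K0.relations k G) :
    FreeVar.mk Y * z ∈ K0.relations k G := by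
  rcases hz with ⟨X, Z, U, i, j, h, rfl⟩ | ⟨E, X, p, d, h, rfl⟩
  · refine Or.inl ⟨Y ⊗ X, Y ⊗ Z, Y ⊗ U, Y ◁ i, Y ◁ j, h.whiskerLeft Y.psh, ?_⟩
    simp only [FreeVar.mk_tensor]
    ring
  · refine Or.inr ⟨Y ⊗ E, Y ⊗ X, Y ◁ p, d, h.whiskerLeft Y, ?_⟩
    simp only [FreeVar.mk_tensor]
    ring

variable (k G) in
/-- The subgroup generated by the defining relations is an ideal. -/
def K0.ideal : Ideal (FreeVar k G) where
  __ := AddSubgroup.closure (K0.relations k G)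
  smul_mem' r z hz := by
    change z ∈ AddSubgroup.closure (K0.relations k G) at hz
    change r * z ∈ AddSubgroup.closure (K0.relations k G)
    induction hz using AddSubgroup.closure_induction with
    | mem z hz =>
      induction r using FreeAbelianGroup.induction_on with
      | zero => simp
      | of x =>
        obtain ⟨Y, rfl⟩ : ∃ Y, toSkeleton Y = x := ⟨x.out, Quotient.out_eq _⟩
        exact AddSubgroup.subset_closure (K0.mk_mul_mem_relations Y hz)
      | neg x hx => simpa using hx
      | add x y hx hy => rw [add_mul]; exact add_mem hx hy
    | zero => simp
    | add x y _ _ hx hy => rw [mul_add]; exact add_mem hx hy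
    | neg x _ hx => simpa using hx

variable (k G) in
/-- The Grothendieck ring of `G`-varieties over `k`. -/
abbrev K0 : Type (u + 1) := FreeVar k G ⧸ K0.ideal k G

/-- The class of a `G`-variety in the Grothendieck ring. -/
def K0.cls (X : GVar k G) : K0 k G := Ideal.Quotient.mk _ (FreeVar.mk X)

variable (k G) in
/-- The Lefschetz class: the class of the affine line with trivial action. -/
def K0.lefschetz : K0 k G := K0.cls (Action.trivial G (affineSpace k 1))

lemma K0.cls_eq_of_iso {X Y : GVar k G} (e : X ≅ Y) : K0.cls X = K0.cls Y :=
  congrArg (fun x ↦ Ideal.Quotient.mk _ (FreeAbelianGroup.of x)) (Quotient.sound ⟨e⟩)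

lemma K0.cls_tensor (X Y : GVar k G) : K0.cls (X ⊗ Y) = K0.cls X * K0.cls Y := by
  rw [K0.cls, FreeVar.mk_tensor, map_mul, K0.cls, K0.cls]

lemma K0.cls_eq_add {X Z U : GVar k G} {i : Z ⟶ X} {j : U ⟶ X}
    (h : IsClosedDecomposition (pshHom i) (pshHom j)) :
    K0.cls X = K0.cls U + K0.cls Z := by
  rw [K0.cls, K0.cls, K0.cls, ← map_add, Ideal.Quotient.mk_eq_mk_iff_sub_mem]
  exact AddSubgroup.subset_closure (Or.inl ⟨X, Z, U, i, j, h, rfl⟩)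

lemma K0.cls_eq_of_isEquivariantVectorBundle {E X : GVar k G} {p : E ⟶ X} {d : ℕ}
    (h : IsEquivariantVectorBundle p d) :
    K0.cls E = K0.cls (Action.trivial G (affineSpace k d) ⊗ X) := by
  rw [K0.cls, K0.cls, Ideal.Quotient.mk_eq_mk_iff_sub_mem]
  exact AddSubgroup.subset_closure (Or.inr ⟨E, X, p, d, h, rfl⟩)

/-- An additive map defined on generators that respects the relations. -/
def K0.lift {A : Type*} [AddCommGroup A] (F : GVar k G → A)
    (h₀ : ∀ X Y : GVar k G, Nonempty (X ≅ Y) → F X = F Y)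
    (h₁ : ∀ (X Z U : GVar k G) (i : Z ⟶ X) (j : U ⟶ X),
      IsClosedDecomposition (pshHom i) (pshHom j) → F X = F U + F Z)
    (h₂ : ∀ (E X : GVar k G) (p : E ⟶ X) (d : ℕ), IsEquivariantVectorBundle p d →
      F E = F (Action.trivial G (affineSpace k d) ⊗ X)) : K0 k G →+ A :=
  let φ : FreeVar k G →+ A := FreeAbelianGroup.lift (Quotient.lift F h₀)
  QuotientAddGroup.lift (K0.ideal k G).toAddSubgroup φ (by
    have hφ : ∀ X : GVar k G, φ (FreeVar.mk X) = F X := fun X ↦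
      FreeAbelianGroup.lift_apply_of _ _
    suffices h : AddSubgroup.closure (K0.relations k G) ≤ φ.ker from h
    rw [AddSubgroup.closure_le]
    rintro _ (⟨X, Z, U, i, j, h, rfl⟩ | ⟨E, X, p, d, h, rfl⟩)
    · simp [AddMonoidHom.mem_ker, hφ, h₁ _ _ _ _ _ h]
    · simp [AddMonoidHom.mem_ker, hφ, h₂ _ _ _ _ h])

lemma K0.lift_cls {A : Type*} [AddCommGroup A] (F : GVar k G → A) (h₀ h₁ h₂) (X : GVar k G) :
    K0.lift F h₀ h₁ h₂ (K0.cls X) = F X :=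
  FreeAbelianGroup.lift_apply_of _ _

end GrothendieckRing

section Operations

variable {G H : Type} [Group G] [Group H]

/-- Restriction of the group action along a homomorphism. -/
abbrev GVar.res (φ : H →* G) (X : GVar k G) : GVar k H := (Action.res (Var k) φ).obj X

/-- Restriction of the group action along a homomorphism, on Grothendieck groups. -/
def K0.res (φ : H →* G) : K0 k G →+ K0 k H :=
  K0.lift (fun X ↦ K0.cls (X.res φ))
    (fun _ _ h ↦ h.elim fun e ↦ K0.cls_eq_of_iso ((Action.res (Var k) φ).mapIso e))
    (fun _ _ _ i j h ↦ K0.cls_eq_add (i := (Action.res (Var k) φ).map i)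
      (j := (Action.res (Var k) φ).map j) h)
    (by
      intro E X p d h
      obtain ⟨_, h, hl⟩ := h
      exact K0.cls_eq_of_isEquivariantVectorBundle
        (p := (Action.res (Var k) φ).map p) ⟨_, h, fun g ↦ hl (φ g)⟩)

lemma K0.res_cls (φ : H →* G) (X : GVar k G) : K0.res φ (K0.cls X) = K0.cls (X.res φ) :=
  K0.lift_cls _ _ _ _ X

/-- The product of a `G`-variety and an `H`-variety, with its natural action of `G × H`. -/
def GVar.box (X : GVar k G) (Y : GVar k H) : GVar k (G × H) :=
  X.res (MonoidHom.fst G H) ⊗ Y.res (MonoidHom.snd G H)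

/-- The outer product on Grothendieck groups. -/
def K0.box (x : K0 k G) (y : K0 k H) : K0 k (G × H) :=
  K0.res (MonoidHom.fst G H) x * K0.res (MonoidHom.snd G H) y

lemma K0.box_cls (X : GVar k G) (Y : GVar k H) :
    K0.box (K0.cls X) (K0.cls Y) = K0.cls (X.box Y) := by
  rw [K0.box, K0.res_cls, K0.res_cls, GVar.box, K0.cls_tensor]

section Ind

variable (φ : H →* G) (X : GVar k H)

/-- Two pairs `(c, x)` and `(c', x')`, where `c` and `c'` are locally constant functions on `T` with
values in `G` and `x` and `x'` are `T`-points of `X`, are equivalent if étale locally on `T` they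
are of the form `(γ h, x)` and `(γ, h x)` for an element `h` of `H`. -/
def indSetoid (T : Sch k) : Setoid (LocallyConstant T.left G × X.psh.obj (op T)) where
  r p q := ∃ R ∈ etale k T, ∀ (T' : Sch k) (f : T' ⟶ T), R f → ∃ h : H,
    (∀ t, p.1 (f.left t) = q.1 (f.left t) * φ h) ∧
      (X.act h).app (op T') (X.psh.map f.op p.2) = X.psh.map f.op q.2
  iseqv := by
    refine ⟨fun p ↦ ?_, ?_, ?_⟩
    · refine ⟨⊤, GrothendieckTopology.top_mem _ _, fun T' f _ ↦ ⟨1, fun t ↦ by simp, ?_⟩⟩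
      rw [GVar.act_one]
      rfl
    · rintro p q ⟨R, hR, h⟩
      refine ⟨R, hR, fun T' f hf ↦ ?_⟩
      obtain ⟨a, h₁, h₂⟩ := h T' f hf
      refine ⟨a⁻¹, fun t ↦ by simp [h₁ t], ?_⟩
      rw [← h₂, X.act_inv_act]
    · rintro p q r ⟨R, hR, h⟩ ⟨R', hR', h'⟩
      refine ⟨R ⊓ R', GrothendieckTopology.intersection_covering _ hR hR', fun T' f hf ↦ ?_⟩
      obtain ⟨a, h₁, h₂⟩ := h T' f hf.1
      obtain ⟨b, h₁', h₂'⟩ := h' T' f hf.2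
      refine ⟨b * a, fun t ↦ by rw [h₁ t, h₁' t, map_mul, mul_assoc], ?_⟩
      rw [X.act_mul_apply, h₂, h₂']

/-- The presheaf `G ×ᴴ X`, the quotient of `G × X` by the action of `H`. -/
def indPsh : PSh k where
  obj T := Quotient (indSetoid φ X (unop T))
  map {T T'} f := TypeCat.ofHom (Quotient.map
    (fun p ↦ ((const (k := k) G).map f p.1, X.psh.map f p.2)) (by
      rintro p q ⟨R, hR, h⟩
      refine ⟨R.pullback f.unop, GrothendieckTopology.pullback_stable _ _ hR, fun T'' g hg ↦ ?_⟩
      obtain ⟨a, h₁, h₂⟩ := h T'' (g ≫ f.unop) hg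
      have e : ∀ x, X.psh.map g.op (X.psh.map f x) = X.psh.map (g ≫ f.unop).op x := fun x ↦ by
        simp
      have e' : ∀ t, f.unop.left (g.left t) = (g ≫ f.unop).left t := fun t ↦ by simp
      refine ⟨a, fun t ↦ ?_, ?_⟩
      · have := h₁ t
        rw [← e'] at this
        exact this
      · rw [e, e, h₂]))
  map_id T := by
    ext x
    induction x using Quotient.inductionOn with
    | _ p => exact congrArg (Quotient.mk _) (Prod.ext
        (congrArg (fun φ ↦ φ p.1) ((const (k := k) G).map_id T))
        (congrArg (fun φ ↦ φ p.2) (X.psh.map_id T)))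
  map_comp f g := by
    ext x
    induction x using Quotient.inductionOn with
    | _ p => exact congrArg (Quotient.mk _) (Prod.ext
        (congrArg (fun φ ↦ φ p.1) ((const (k := k) G).map_comp f g))
        (congrArg (fun φ ↦ φ p.2) (X.psh.map_comp f g)))

/-- The point of `G ×ᴴ X` given by a pair `(c, x)`. -/
def indMk {T : Sch k} (c : LocallyConstant T.left G) (x : X.psh.obj (op T)) :
    (indPsh φ X).obj (op T) :=
  Quotient.mk _ (c, x)

/-- The action of `G` on `G ×ᴴ X`. -/
def indAct (g : G) : indPsh φ X ⟶ indPsh φ X where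
  app T := TypeCat.ofHom (Quotient.map
    (fun p : LocallyConstant (unop T).left G × _ ↦ (p.1.map (g * ·), p.2)) (by
      rintro p q ⟨R, hR, h⟩
      refine ⟨R, hR, fun T' f hf ↦ ?_⟩
      obtain ⟨a, h₁, h₂⟩ := h T' f hf
      exact ⟨a, fun t ↦ by simp [h₁ t, mul_assoc], h₂⟩))
  naturality T T' f := by
    ext x
    induction x using Quotient.inductionOn with
    | _ p => rfl

lemma indAct_one : indAct φ X 1 = 𝟙 _ := by
  ext T x
  induction x using Quotient.inductionOn with
  | _ p =>
    exact congrArg (Quotient.mk _) (Prod.ext (LocallyConstant.ext fun t ↦ one_mul _) rfl)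

lemma indAct_mul (g g' : G) : indAct φ X (g * g') = indAct φ X g' ≫ indAct φ X g := by
  ext T x
  induction x using Quotient.inductionOn with
  | _ p =>
    exact congrArg (Quotient.mk _) (Prod.ext (LocallyConstant.ext fun t ↦ mul_assoc _ _ _) rfl)

variable {X} in
/-- The morphism induced by an equivariant morphism. -/
def indMap {Y : GVar k H} (f : X ⟶ Y) : indPsh φ X ⟶ indPsh φ Y where
  app T := TypeCat.ofHom (Quotient.map
    (fun p : LocallyConstant (unop T).left G × _ ↦ (p.1, (pshHom f).app T p.2)) (by
      rintro p q ⟨R, hR, h⟩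
      refine ⟨R, hR, fun T' g hg ↦ ?_⟩
      obtain ⟨a, h₁, h₂⟩ := h T' g hg
      refine ⟨a, h₁, ?_⟩
      have e : ∀ x, Y.psh.map g.op ((pshHom f).app T x) = (pshHom f).app _ (X.psh.map g.op x) :=
        fun x ↦ (NatTrans.naturality_apply (pshHom f) g.op x).symm
      rw [e, e, ← h₂]
      exact (congrArg (fun ψ ↦ ψ.app _ (X.psh.map g.op p.2)) (act_comm f a)).symm))
  naturality T T' g := by
    ext x
    induction x using Quotient.inductionOn with
    | _ p =>
      refine congrArg (Quotient.mk _) (Prod.ext rfl ?_)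
      exact NatTrans.naturality_apply (pshHom f) g p.2

/-- Choosing representatives of the cosets gives a map from `(G/H) × X` to `G ×ᴴ X`. -/
def indRep : const (k := k) (G ⧸ φ.range) ⊗ X.psh ⟶ indPsh φ X where
  app T := TypeCat.ofHom fun p ↦
    indMk φ X (LocallyConstant.map Quotient.out (p.1 : LocallyConstant (unop T).left _)) p.2
  naturality T T' f := by
    ext x
    rfl

lemma exists_out (γ : G) : ∃ h : H, γ = Quotient.out (γ : G ⧸ φ.range) * φ h := by
  obtain ⟨h, hh⟩ := QuotientGroup.eq.1 (QuotientGroup.out_eq' (γ : G ⧸ φ.range))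
  exact ⟨h, by rw [hh]; group⟩

/-- The element of `H` that relates an element of `G` to the representative of its coset. -/
def outElt (γ : G) : H := (exists_out φ γ).choose

lemma outElt_spec (γ : G) : γ = Quotient.out (γ : G ⧸ φ.range) * φ (outElt φ γ) :=
  (exists_out φ γ).choose_spec

lemma isSheaf_const (S : Type) [Finite S] : Presieve.IsSheaf (etale k) (const (k := k) S) :=
  (isVariety_const S).isSheaf

lemma GVar.isSheaf (X : GVar k H) : Presieve.IsSheaf (etale k) X.psh := X.V.property.isSheaf

variable {φ} [Finite G]

lemma indRep_bijective (hφ : Function.Injective φ) (T : (Sch k)ᵒᵖ) :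
    Function.Bijective ((indRep φ X).app T) := by
  constructor
  · rintro ⟨s, x⟩ ⟨s', x'⟩ h
    obtain ⟨R, hR, h⟩ := Quotient.exact h
    have key : ∀ (T' : Sch k) (f : T' ⟶ unop T), R f →
        (const (k := k) (G ⧸ φ.range)).map f.op s = (const (k := k) (G ⧸ φ.range)).map f.op s' ∧
        X.psh.map f.op x = X.psh.map f.op x' := by
      intro T' f hf
      rcases isEmpty_or_nonempty T'.left with hT | ⟨⟨t⟩⟩
      · exact ⟨subsingleton_of_isEmpty (isSheaf_const _) T' _ _,
          subsingleton_of_isEmpty X.isSheaf T' _ _⟩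
      · obtain ⟨a, h₁, h₂⟩ := h T' f hf
        change ∀ t, Quotient.out (DFunLike.coe (F := LocallyConstant _ _) s (f.left t)) =
          Quotient.out (DFunLike.coe (F := LocallyConstant _ _) s' (f.left t)) * φ a at h₁
        have h₃ : ∀ t, DFunLike.coe (F := LocallyConstant _ _) s (f.left t) =
            DFunLike.coe (F := LocallyConstant _ _) s' (f.left t) := by
          intro t
          rw [← QuotientGroup.out_eq' (DFunLike.coe (F := LocallyConstant _ _) s (f.left t)), h₁,
            QuotientGroup.mk_mul_of_mem _ (MonoidHom.mem_range.2 ⟨a, rfl⟩), QuotientGroup.out_eq']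
        refine ⟨LocallyConstant.ext h₃, ?_⟩
        have h₄ := h₁ t
        rw [h₃ t, left_eq_mul, map_eq_one_iff φ hφ] at h₄
        subst h₄
        rw [GVar.act_one_apply] at h₂
        exact h₂
    refine Prod.ext ?_ ?_
    · exact ((isSheaf_const _) R hR).isSeparatedFor.ext fun T' f hf ↦ (key T' f hf).1
    · exact (X.isSheaf R hR).isSeparatedFor.ext fun T' f hf ↦ (key T' f hf).2
  · intro z
    induction z using Quotient.inductionOn with
    | _ p =>
      obtain ⟨c, x⟩ := p
      refine ⟨(LocallyConstant.map (fun γ : G ↦ (γ : G ⧸ φ.range)) c,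
        glue X.isSheaf c fun γ ↦ (X.act (outElt φ γ)).app T x), Quotient.sound ?_⟩
      refine ⟨constancySieve c, constancySieve_mem c, fun T' f ⟨γ, hγ⟩ ↦
        ⟨(outElt φ γ)⁻¹, fun t ↦ ?_, ?_⟩⟩
      · change Quotient.out ((c (f.left t) : G) : G ⧸ φ.range) = c (f.left t) * _
        rw [hγ, map_inv, eq_mul_inv_iff_mul_eq]
        exact (outElt_spec φ γ).symm
      · have := map_glue X.isSheaf c (fun γ ↦ (X.act (outElt φ γ)).app T x) f γ hγ
        refine (congrArg _ this).trans ?_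
        refine (congrArg _ (NatTrans.naturality_apply (X.act (outElt φ γ)) f.op x).symm).trans ?_
        exact GVar.act_inv_act _ _ _

/-- After choosing representatives, `G ×ᴴ X` is isomorphic to `(G/H) × X`. -/
def indIso (hφ : Function.Injective φ) :
    const (k := k) (G ⧸ φ.range) ⊗ X.psh ≅ indPsh φ X :=
  NatIso.ofComponents (fun T ↦ (Equiv.ofBijective _ (indRep_bijective X hφ T)).toIso)
    (fun f ↦ (indRep φ X).naturality f)

lemma indIso_hom (hφ : Function.Injective φ) : (indIso X hφ).hom = indRep φ X := rfl

/-- The `G`-variety `G ×ᴴ X` that is induced from an `H`-variety `X`. -/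
def GVar.ind (φ : H →* G) (hφ : Function.Injective φ) (X : GVar k H) : GVar k G :=
  GVar.of (indPsh φ X) (((isVariety_const _).tensor X.V.property).of_iso (indIso X hφ))
    (indAct φ X) (indAct_one φ X) (indAct_mul φ X)

/-- The equivariant morphism induced by an equivariant morphism. -/
def GVar.indHom (hφ : Function.Injective φ) {X Y : GVar k H} (f : X ⟶ Y) :
    GVar.ind φ hφ X ⟶ GVar.ind φ hφ Y :=
  GVar.homMk (indMap φ f) fun g ↦ by
    ext T x
    induction x using Quotient.inductionOn with
    | _ p => rfl

lemma GVar.indHom_comp (hφ : Function.Injective φ) {X Y Z : GVar k H} (f : X ⟶ Y) (g : Y ⟶ Z) :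
    GVar.indHom hφ (f ≫ g) = GVar.indHom hφ f ≫ GVar.indHom hφ g := by
  refine Action.hom_ext _ _ (ObjectProperty.hom_ext _ ?_)
  ext T x
  induction x using Quotient.inductionOn with
  | _ p => rfl

lemma GVar.indHom_id (hφ : Function.Injective φ) (X : GVar k H) :
    GVar.indHom hφ (𝟙 X) = 𝟙 _ := by
  refine Action.hom_ext _ _ (ObjectProperty.hom_ext _ ?_)
  ext T x
  induction x using Quotient.inductionOn with
  | _ p => rfl

/-- The isomorphism induced by an equivariant isomorphism. -/
def GVar.indMapIso (hφ : Function.Injective φ) {X Y : GVar k H} (e : X ≅ Y) :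
    GVar.ind φ hφ X ≅ GVar.ind φ hφ Y where
  hom := GVar.indHom hφ e.hom
  inv := GVar.indHom hφ e.inv
  hom_inv_id := by rw [← GVar.indHom_comp, e.hom_inv_id, GVar.indHom_id]
  inv_hom_id := by rw [← GVar.indHom_comp, e.inv_hom_id, GVar.indHom_id]

lemma indIso_naturality (hφ : Function.Injective φ) {X Y : GVar k H} (f : X ⟶ Y) :
    (indIso X hφ).hom ≫ indMap φ f = (_ ◁ pshHom f) ≫ (indIso Y hφ).hom :=
  rfl

lemma IsClosedDecomposition.of_iso {Z U X Z' U' X' : PSh k} {i : Z ⟶ X} {j : U ⟶ X}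
    (h : IsClosedDecomposition i j) {i' : Z' ⟶ X'} {j' : U' ⟶ X'} (eZ : Z ≅ Z') (eU : U ≅ U')
    (eX : X ≅ X') (hi : eZ.hom ≫ i' = i ≫ eX.hom) (hj : eU.hom ≫ j' = j ≫ eX.hom) :
    IsClosedDecomposition i' j' := by
  have hi' : i' = eZ.symm.hom ≫ i ≫ eX.hom := by simp [← hi]
  have hj' : j' = eU.symm.hom ≫ j ≫ eX.hom := by simp [← hj]
  have bij : ∀ {A B : PSh k} (e : A ≅ B) (T : (Sch k)ᵒᵖ), Function.Bijective (e.hom.app T) :=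
    fun e T ↦ (isIso_iff_bijective _).1 inferInstance
  have rg : ∀ {A A' B B' : PSh k} {m : A ⟶ B} {m' : A' ⟶ B'} (eA : A ≅ A') (eB : B ≅ B'),
      eA.hom ≫ m' = m ≫ eB.hom → ∀ (T : (Sch k)ᵒᵖ) (x : B.obj T),
      eB.hom.app T x ∈ Set.range (m'.app T) ↔ x ∈ Set.range (m.app T) := by
    intro A A' B B' m m' eA eB hm T x
    have hm' : ∀ y, m'.app T (eA.hom.app T y) = eB.hom.app T (m.app T y) := fun y ↦
      congrArg (fun ψ ↦ ψ.app T y) hm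
    constructor
    · rintro ⟨y, hy⟩
      obtain ⟨y, rfl⟩ := (bij eA T).2 y
      exact ⟨y, (bij eB T).1 ((hm' y).symm.trans hy)⟩
    · rintro ⟨y, rfl⟩
      exact ⟨_, hm' y⟩
  refine ⟨?_, ?_, ?_⟩
  · have : Rep k closedImmersion i := h.closed
    rw [hi']
    exact (this.comp_iso eX).iso_comp eZ.symm
  · intro T
    rw [hj']
    exact (bij eX _).1.comp ((h.injective T).comp (bij eU.symm _).1)
  · intro T x
    obtain ⟨x, rfl⟩ := (bij eX _).2 x
    rw [rg eU eX hj, h.mem_range_iff]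
    refine forall_congr' fun T' ↦ forall_congr' fun f ↦ imp_congr_right fun _ ↦ not_congr ?_
    rw [← rg eZ eX hi]
    exact iff_of_eq (congrArg (· ∈ Set.range (i'.app (op T')))
      (NatTrans.naturality_apply eX.hom f.op x))

lemma IsClosedDecomposition.ind (hφ : Function.Injective φ) {X Z U : GVar k H} {i : Z ⟶ X}
    {j : U ⟶ X} (h : IsClosedDecomposition (pshHom i) (pshHom j)) :
    IsClosedDecomposition (pshHom (GVar.indHom hφ i)) (pshHom (GVar.indHom hφ j)) :=
  (h.whiskerLeft (const (G ⧸ φ.range))).of_iso (indIso Z hφ) (indIso U hφ) (indIso X hφ)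
    (indIso_naturality hφ i) (indIso_naturality hφ j)

/-- The projection of `G ×ᴴ X` to `G/H`. -/
def indFst (hφ : Function.Injective φ) : indPsh φ X ⟶ const (G ⧸ φ.range) :=
  (indIso X hφ).inv ≫ CartesianMonoidalCategory.fst _ _

/-- The projection of `G ×ᴴ X` to `X` that is given by the choice of representatives. -/
def indSnd (hφ : Function.Injective φ) : indPsh φ X ⟶ X.psh :=
  (indIso X hφ).inv ≫ CartesianMonoidalCategory.snd _ _

lemma indRep_surjective (hφ : Function.Injective φ) {T : (Sch k)ᵒᵖ} (z : (indPsh φ X).obj T) :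
    ∃ (s : LocallyConstant (unop T).left (G ⧸ φ.range)) (x : X.psh.obj T),
      z = indMk φ X (s.map Quotient.out) x := by
  obtain ⟨p, rfl⟩ := (indRep_bijective X hφ T).2 z
  exact ⟨p.1, p.2, rfl⟩

lemma indInv_indMk (hφ : Function.Injective φ) {T : (Sch k)ᵒᵖ}
    (s : LocallyConstant (unop T).left (G ⧸ φ.range)) (x : X.psh.obj T) :
    (indIso X hφ).inv.app T (indMk φ X (s.map Quotient.out) x) = (s, x) :=
  congrArg (fun ψ ↦ ψ.app T ((s, x) : (const (k := k) (G ⧸ φ.range) ⊗ X.psh).obj T))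
    (indIso X hφ).hom_inv_id

lemma indFst_indMk (hφ : Function.Injective φ) {T : (Sch k)ᵒᵖ}
    (s : LocallyConstant (unop T).left (G ⧸ φ.range)) (x : X.psh.obj T) :
    (indFst X hφ).app T (indMk φ X (s.map Quotient.out) x) = s :=
  congrArg Prod.fst (indInv_indMk X hφ s x)

lemma indSnd_indMk (hφ : Function.Injective φ) {T : (Sch k)ᵒᵖ}
    (s : LocallyConstant (unop T).left (G ⧸ φ.range)) (x : X.psh.obj T) :
    (indSnd X hφ).app T (indMk φ X (s.map Quotient.out) x) = x :=
  congrArg Prod.snd (indInv_indMk X hφ s x)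

/-- Where the coset of a point of `G ×ᴴ X` is constant, `G` acts through an element of `H`. -/
lemma indSnd_indAct (hφ : Function.Injective φ) (g : G) {T : Sch k} (z : (indPsh φ X).obj (op T))
    (s : G ⧸ φ.range) (hs : ∀ t, DFunLike.coe (F := LocallyConstant T.left (G ⧸ φ.range))
      ((indFst X hφ).app (op T) z) t = s) :
    (indSnd X hφ).app (op T) ((indAct φ X g).app (op T) z) =
      (X.act (outElt φ (g * s.out))).app (op T) ((indSnd X hφ).app (op T) z) := by
  obtain ⟨c, x, rfl⟩ := indRep_surjective X hφ z
  rw [indFst_indMk] at hs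
  rw [indSnd_indMk]
  have h : (indAct φ X g).app (op T) (indMk φ X (c.map Quotient.out) x) =
      indMk φ X ((LocallyConstant.const T.left ((g * s.out : G) : G ⧸ φ.range)).map Quotient.out)
        ((X.act (outElt φ (g * s.out))).app (op T) x) := by
    refine Quotient.sound ⟨⊤, GrothendieckTopology.top_mem _ _, fun T' f _ ↦
      ⟨outElt φ (g * s.out), fun t ↦ ?_, ?_⟩⟩
    · change g * (DFunLike.coe (F := LocallyConstant T.left (G ⧸ φ.range)) c (f.left t)).out =
        Quotient.out ((g * s.out : G) : G ⧸ φ.range) * _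
      rw [hs (f.left t)]
      exact outElt_spec φ _
    · exact NatTrans.naturality_apply (X.act _) f.op x
  rw [h, indSnd_indMk]

lemma Fib.map_res {E X E' X' : PSh k} {p : E ⟶ X} {p' : E' ⟶ X'} (a : E ⟶ E') (b : X ⟶ X')
    (w : p ≫ b = a ≫ p') {T T' : Sch k} (f : T' ⟶ T) {x : X.obj (op T)} (e : Fib p x) :
    ((e.res f).map a b w).1 = ((e.map a b w).res f).1 :=
  congrArg (fun φ ↦ φ e.1) (a.naturality f.op)

lemma Fib.ext_of_cover {E X : PSh k} (hE : Presieve.IsSheaf (etale k) E) {p : E ⟶ X} {T : Sch k}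
    {x : X.obj (op T)} (e e' : Fib p x) (R : Sieve T) (hR : R ∈ etale k T)
    (h : ∀ (T' : Sch k) (f : T' ⟶ T), R f → (e.res f).1 = (e'.res f).1) : e = e' :=
  Subtype.ext ((hE R hR).isSeparatedFor.ext h)

lemma IsFibrewiseLinear.of_locally_comm {E X E' X' : PSh k} {p : E ⟶ X} {p' : E' ⟶ X'}
    [FibreModule p] [FibreModule p'] {d : ℕ} (hp' : FibreModule.IsLocallyFree p' d)
    (hE' : Presieve.IsSheaf (etale k) E') {a : E' ⟶ E} {b : X' ⟶ X} {w : p' ≫ b = a ≫ p}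
    (h : IsFibrewiseLinear a b w)
    (hw : ∀ {T : Sch k} (x : X'.obj (op T)),
      Function.Injective (Fib.map a b w : Fib p' x → Fib p (b.app (op T) x)))
    {α' : E' ⟶ E'} {β' : X' ⟶ X'} (v' : p' ≫ β' = α' ≫ p')
    (hloc : ∀ (T : Sch k) (x : X'.obj (op T)), ∃ R ∈ etale k T, ∀ (T' : Sch k) (f : T' ⟶ T), R f →
      ∃ (α : E ⟶ E) (β : X ⟶ X) (v : p ≫ β = α ≫ p), IsFibrewiseLinear α β v ∧
        (∀ e : Fib p' (X'.map f.op x),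
          a.app (op T') (α'.app (op T') e.1) = α.app (op T') (a.app (op T') e.1)) ∧
        b.app (op T') (β'.app (op T') (X'.map f.op x)) =
          β.app (op T') (b.app (op T') (X'.map f.op x))) :
    IsFibrewiseLinear α' β' v' := by
  have hβ : ∀ {T T' : Sch k} (f : T' ⟶ T) (x : X'.obj (op T)),
      β'.app (op T') (X'.map f.op x) = X'.map f.op (β'.app (op T) x) :=
    fun f x ↦ NatTrans.naturality_apply β' f.op x
  refine ⟨fun {T x} e e' ↦ ?_, fun {T x} r e ↦ ?_⟩
  · obtain ⟨R, hR, hloc⟩ := hloc T x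
    refine Fib.ext_of_cover hE' _ _ R hR fun T' f hf ↦ ?_
    obtain ⟨α, β, v, hv, hα, hb⟩ := hloc T' f hf
    have hval : ∀ e : Fib p' (X'.map f.op x),
        ((e.map α' β' v').map a b w).1 = ((e.map a b w).map α β v).1 := hα
    have key : ∀ e e' : Fib p' (X'.map f.op x),
        (e + e').map α' β' v' = e.map α' β' v' + e'.map α' β' v' := by
      intro e e'
      apply hw
      apply Subtype.ext
      rw [hval, h.map_add, h.map_add, hv.map_add]
      exact Fib.add_congr hb.symm (hval e).symm (hval e').symm
    rw [← Fib.map_res, hp'.res_add, key, hp'.res_add]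
    exact Fib.add_congr (hβ f x) (Fib.map_res _ _ _ f e) (Fib.map_res _ _ _ f e')
  · obtain ⟨R, hR, hloc⟩ := hloc T x
    refine Fib.ext_of_cover hE' _ _ R hR fun T' f hf ↦ ?_
    obtain ⟨α, β, v, hv, hα, hb⟩ := hloc T' f hf
    have hval : ∀ e : Fib p' (X'.map f.op x),
        ((e.map α' β' v').map a b w).1 = ((e.map a b w).map α β v).1 := hα
    have key : ∀ (r : Γ(T'.left, ⊤)) (e : Fib p' (X'.map f.op x)),
        (r • e).map α' β' v' = r • e.map α' β' v' := by
      intro r e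
      apply hw
      apply Subtype.ext
      rw [hval, h.map_smul, h.map_smul, hv.map_smul]
      exact Fib.smul_congr hb.symm _ (hval e).symm
    rw [← Fib.map_res, hp'.res_smul, key, hp'.res_smul]
    exact Fib.smul_congr (hβ f x) _ (Fib.map_res _ _ _ f e)

lemma indFst_indMap (hφ : Function.Injective φ) {X Y : GVar k H} (f : X ⟶ Y) {T : (Sch k)ᵒᵖ}
    (z : (indPsh φ X).obj T) :
    (indFst Y hφ).app T ((indMap φ f).app T z) = (indFst X hφ).app T z := by
  obtain ⟨s, x, rfl⟩ := indRep_surjective X hφ z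
  exact (indFst_indMk Y hφ s ((pshHom f).app T x)).trans (indFst_indMk X hφ s x).symm

lemma indSnd_indMap (hφ : Function.Injective φ) {X Y : GVar k H} (f : X ⟶ Y) {T : (Sch k)ᵒᵖ}
    (z : (indPsh φ X).obj T) :
    (indSnd Y hφ).app T ((indMap φ f).app T z) =
      (pshHom f).app T ((indSnd X hφ).app T z) := by
  obtain ⟨s, x, rfl⟩ := indRep_surjective X hφ z
  exact (indSnd_indMk Y hφ s ((pshHom f).app T x)).trans
    (congrArg _ (indSnd_indMk X hφ s x).symm)

lemma indInv_ext (hφ : Function.Injective φ) {X : GVar k H} {T : (Sch k)ᵒᵖ}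
    {z z' : (indPsh φ X).obj T} (h₁ : (indFst X hφ).app T z = (indFst X hφ).app T z')
    (h₂ : (indSnd X hφ).app T z = (indSnd X hφ).app T z') : z = z' := by
  obtain ⟨s, x, rfl⟩ := indRep_surjective X hφ z
  obtain ⟨s', x', rfl⟩ := indRep_surjective X hφ z'
  rw [indFst_indMk, indFst_indMk] at h₁
  rw [indSnd_indMk, indSnd_indMk] at h₂
  rw [h₁, h₂]

lemma IsEquivariantVectorBundle.ind (hφ : Function.Injective φ) {E X : GVar k H} {p : E ⟶ X}
    {d : ℕ} (h : IsEquivariantVectorBundle p d) :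
    IsEquivariantVectorBundle (GVar.indHom hφ p) d := by
  obtain ⟨_, hp, hlin⟩ := h
  let p' : (GVar.ind φ hφ E).psh ⟶ (GVar.ind φ hφ X).psh := pshHom (GVar.indHom hφ p)
  let a : (GVar.ind φ hφ E).psh ⟶ E.psh := indSnd E hφ
  let b : (GVar.ind φ hφ X).psh ⟶ X.psh := indSnd X hφ
  have w : p' ≫ b = a ≫ pshHom p := by
    ext T z
    exact indSnd_indMap hφ p z
  have hw : ∀ {T : Sch k} (x : (GVar.ind φ hφ X).psh.obj (op T)),
      Function.Bijective (Fib.map a b w : Fib p' x → _) := by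
    intro T x
    refine ⟨fun e e' h ↦ Subtype.ext (indInv_ext hφ ?_ (congrArg Subtype.val h)), fun e ↦ ?_⟩
    · refine (indFst_indMap hφ p e.1).symm.trans (Eq.trans ?_ (indFst_indMap hφ p e'.1))
      exact congrArg ((indFst X hφ).app (op T)) (e.2.trans e'.2.symm)
    · let ε : (indPsh φ E).obj (op T) := indMk φ E (LocallyConstant.map Quotient.out
        ((indFst X hφ).app (op T) x : LocallyConstant _ _)) e.1
      have hε : (indSnd E hφ).app (op T) ε = e.1 := indSnd_indMk _ _ _ _
      refine ⟨⟨ε, indInv_ext hφ ?_ ?_⟩, Subtype.ext hε⟩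
      · exact (indFst_indMap hφ p ε).trans (indFst_indMk _ _ _ _)
      · refine (indSnd_indMap hφ p ε).trans ?_
        rw [hε]
        exact e.2
  let inst : FibreModule p' := FibreModule.pullback a b w hw
  have h₁ := FibreModule.isFibrewiseLinear_pullback a b w hw
  have h₂ := FibreModule.isLocallyFree_pullback a b w hw hp
  refine ⟨inst, h₂, fun g ↦ ?_⟩
  refine h₁.of_locally_comm h₂ (GVar.ind φ hφ E).isSheaf (fun x ↦ (hw x).1) _ ?_
  intro T x
  let c : LocallyConstant T.left (G ⧸ φ.range) := (indFst X hφ).app (op T) x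
  refine ⟨constancySieve c, constancySieve_mem c, fun T' f ⟨s, hs⟩ ↦ ?_⟩
  have hs' : (indFst X hφ).app (op T') ((indPsh φ X).map f.op x) =
      LocallyConstant.const T'.left s := by
    refine (NatTrans.naturality_apply (indFst X hφ) f.op x).trans ?_
    exact LocallyConstant.ext hs
  refine ⟨_, _, _, hlin (outElt φ (g * s.out)), fun e ↦ ?_, ?_⟩
  · refine indSnd_indAct E hφ g e.1 s fun t ↦ ?_
    have : (indFst E hφ).app (op T') e.1 = LocallyConstant.const T'.left s := by
      refine (indFst_indMap hφ p e.1).symm.trans (Eq.trans ?_ hs')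
      exact congrArg ((indFst X hφ).app (op T')) e.2
    rw [this]
    rfl
  · refine indSnd_indAct X hφ g _ s fun t ↦ ?_
    exact congrArg (fun c : LocallyConstant T'.left (G ⧸ φ.range) ↦ c t) hs'

/-- The projection of `G ×ᴴ (A × X)` to a factor `A` on which `H` acts trivially. -/
def indTrivialFst (A : Var k) : indPsh φ (Action.trivial H A ⊗ X) ⟶ A.obj where
  app T := TypeCat.ofHom (Quotient.lift
    (fun p : LocallyConstant (unop T).left G × (GVar.psh (Action.trivial H A ⊗ X)).obj T ↦
      (p.2.1 : A.obj.obj T)) (by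
      rintro p q ⟨R, hR, h⟩
      refine (A.property.isSheaf R hR).isSeparatedFor.ext fun T' f hf ↦ ?_
      obtain ⟨a, h₁, h₂⟩ := h T' f hf
      exact congrArg Prod.fst h₂))
  naturality T T' f := by
    ext x
    induction x using Quotient.inductionOn with
    | _ p => rfl

/-- The projection of `A × X` to `X`, where `H` acts trivially on `A`. -/
def trivialSnd (A : Var k) : Action.trivial H A ⊗ X ⟶ X :=
  GVar.homMk (CartesianMonoidalCategory.snd A.obj X.psh) (fun _ ↦ rfl)

/-- Induction commutes with products with a variety with trivial action. -/
def indTrivial (A : Var k) :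
    indPsh φ (Action.trivial H A ⊗ X) ⟶ A.obj ⊗ indPsh φ X :=
  CartesianMonoidalCategory.lift (indTrivialFst X A)
    (indMap φ (trivialSnd X A))

lemma indTrivial_bijective (hφ : Function.Injective φ) (A : Var k) (T : (Sch k)ᵒᵖ) :
    Function.Bijective ((indTrivial (φ := φ) X A).app T) := by
  have h₁ := indRep_bijective (Action.trivial H A ⊗ X) hφ T
  have h₂ := indRep_bijective X hφ T
  rw [← Function.Bijective.of_comp_iff _ h₁]
  constructor
  · rintro ⟨s, a, x⟩ ⟨s', a', x'⟩ h
    have h₃ : a = a' := congrArg Prod.fst h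
    have h₄ : (indRep φ X).app T (s, x) = (indRep φ X).app T (s', x') := congrArg Prod.snd h
    have h₅ := h₂.1 h₄
    have h₆ : s = s' := congrArg Prod.fst h₅
    have h₇ : x = x' := congrArg Prod.snd h₅
    rw [h₃, h₆, h₇]
  · rintro ⟨a, z⟩
    obtain ⟨⟨s, x⟩, rfl⟩ := h₂.2 z
    exact ⟨(s, a, x), rfl⟩

/-- Induction commutes with products with a variety with trivial action. -/
def GVar.indTrivialIso (hφ : Function.Injective φ) (A : Var k) :
    GVar.ind φ hφ (Action.trivial H A ⊗ X) ≅ Action.trivial G A ⊗ GVar.ind φ hφ X :=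
  GVar.isoMk (NatIso.ofComponents (fun T ↦ (Equiv.ofBijective _
    (indTrivial_bijective X hφ A T)).toIso) (fun f ↦ (indTrivial X A).naturality f)) (by
      intro g
      ext T x
      induction x using Quotient.inductionOn with
      | _ p => rfl)

/-- Induction of varieties with group actions, on Grothendieck groups. -/
def K0.ind (φ : H →* G) (hφ : Function.Injective φ) : K0 k H →+ K0 k G :=
  K0.lift (fun X ↦ K0.cls (GVar.ind φ hφ X))
    (fun _ _ h ↦ h.elim fun e ↦ K0.cls_eq_of_iso (GVar.indMapIso hφ e))
    (fun _ _ _ _ _ h ↦ K0.cls_eq_add (h.ind hφ))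
    (fun _ X _ d h ↦ (K0.cls_eq_of_isEquivariantVectorBundle (h.ind hφ)).trans
      (K0.cls_eq_of_iso (GVar.indTrivialIso X hφ (affineSpace k d)).symm))

lemma K0.ind_cls (hφ : Function.Injective φ) (X : GVar k H) :
    K0.ind φ hφ (K0.cls X) = K0.cls (GVar.ind φ hφ X) :=
  K0.lift_cls _ _ _ _ X

end Ind

end Operations

section Powers

/-- The `n`-fold power of a presheaf. -/
def powPsh (X : PSh k) (n : ℕ) : PSh k where
  obj T := Fin n → X.obj T
  map f := TypeCat.ofHom fun x i ↦ X.map f (x i)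

lemma isVariety_powPsh {X : PSh k} (hX : IsVariety k X) (n : ℕ) : IsVariety k (powPsh X n) := by
  induction n with
  | zero =>
    exact isVariety_unit.of_iso (NatIso.ofComponents (fun T ↦ Equiv.toIso
      { toFun := fun _ ↦ Fin.elim0
        invFun := fun _ ↦ PUnit.unit
        left_inv := fun _ ↦ rfl
        right_inv := fun _ ↦ funext fun i ↦ i.elim0 })
      (fun f ↦ by ext x; exact funext fun i ↦ i.elim0))
  | succ n ih =>
    exact (hX.tensor ih).of_iso (NatIso.ofComponents (fun T ↦
      (Fin.consEquiv fun _ ↦ X.obj T).toIso)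
      (fun f ↦ by
        ext x
        refine funext fun i ↦ ?_
        refine Fin.cases ?_ (fun i ↦ ?_) i
        · rfl
        · rfl))

/-- The action of a permutation on the `n`-fold power. -/
def powAct (X : PSh k) (n : ℕ) (σ : Equiv.Perm (Fin n)) : powPsh X n ⟶ powPsh X n where
  app T := TypeCat.ofHom fun x i ↦ x (σ⁻¹ i)

/-- The symmetric power `X^[n]` of a variety `X`: the `n`-fold power with the action of the symmetric
group that permutes the factors. -/
def GVar.pow (X : Var k) (n : ℕ) : GVar k (Equiv.Perm (Fin n)) :=
  GVar.of (powPsh X.obj n) (isVariety_powPsh X.property n) (powAct X.obj n)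
    (by ext; rfl) (fun σ τ ↦ by ext; rfl)

/-- The embedding of the product of symmetric groups `Σ_i × Σ_j` in the symmetric group `Σ_n`, where
`i + j = n`, that is given by the action on the first `i` and the last `j` elements. -/
def young {i j n : ℕ} (h : i + j = n) :
    Equiv.Perm (Fin i) × Equiv.Perm (Fin j) →* Equiv.Perm (Fin n) :=
  ((finSumFinEquiv.trans (finCongr h)).permCongrHom.toMonoidHom).comp
    (Equiv.Perm.sumCongrHom (Fin i) (Fin j))

lemma young_injective {i j n : ℕ} (h : i + j = n) : Function.Injective (young h) :=
  (finSumFinEquiv.trans (finCongr h)).permCongrHom.injective.comp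
    Equiv.Perm.sumCongrHom_injective

variable (k) in
/-- The Grothendieck ring of varieties over `k`, without group action. -/
abbrev K0Var : Type (u + 1) := K0 k Unit

/-- The class of a variety in the Grothendieck ring of varieties. -/
def K0Var.cls (X : Var k) : K0Var k := K0.cls (Action.trivial Unit X)

/-- The class of `G ×ᴴ (x × y)`, where `H = Σ_i × Σ_j` and `G = Σ_n`. -/
def inductionProduct {i j n : ℕ} (h : i + j = n) (x : K0 k (Equiv.Perm (Fin i)))
    (y : K0 k (Equiv.Perm (Fin j))) : K0 k (Equiv.Perm (Fin n)) :=
  K0.ind (young h) (young_injective h) (K0.box x y)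

variable (k) in
/-- The product of the Grothendieck groups for all symmetric groups. -/
abbrev SymSeq : Type (u + 1) := ∀ n : ℕ, K0 k (Equiv.Perm (Fin n))

/-- The product of sequences that is given by the induction product: its component in degree `n` is
the sum over all `(i, j)` with `i + j = n`. -/
def SymSeq.star (a b : SymSeq k) : SymSeq k := fun n ↦
  ∑ p : {p : ℕ × ℕ // p ∈ Finset.HasAntidiagonal.antidiagonal n},
    inductionProduct (Finset.HasAntidiagonal.mem_antidiagonal.1 p.2) (a p.1.1) (b p.1.2)

variable (k) in
/-- The sequence that is `1` in degree `0` and `0` in all other degrees. -/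
def SymSeq.unit : SymSeq k := Pi.single 0 1

end Powers

end Varieties

end

end EquivariantVarieties

open EquivariantVarieties

/-!
The induction product is understood through a criterion that recognizes induced varieties. If
`φ : H →* G` is injective, then a `G`-variety `Y` is isomorphic to `G ×ᴴ X` as soon as there is an
`H`-equivariant morphism `X ⟶ Y` whose translates by elements of `G` cover `Y` étale locally, and for
which a coincidence of translates only arises from the action of `H` (`IsInducing`, `IsInduced`). It
shows that induction is transitive and compatible with exterior products and with conjugation, and so
the induction product makes the sequences of classes a commutative ring. A sequence with constant
term `1` is invertible, by recursion, and `UnitSeq` is the resulting group.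

The exponential map is the homomorphism out of the Grothendieck group that sends the class of `X` to
the sequence of its symmetric powers. Two relations have to be verified. For a decomposition of `X`
into a closed subvariety `Z` and its complement `U`, the power `X ^ n` is filtered by the open
subvarieties on which fewer than `c` components meet `Z`. The difference of two consecutive steps, on
which exactly `c` components belong to `Z`, is the induced variety of `U ^ (n - c) × Z ^ c`
(`isClosedDecomposition_stratum`). It is closed in the larger step since over a scheme it is the
disjoint union, over the sets of `c` indices, of the closed subschemes on which these components belong
to `Z`. The sum over the strata is the induction product (`cls_pow_eq_star`). For a vector bundle `E` of
rank `d` over `X`, the power `E ^ n` is an equivariant vector bundle of rank `d * n` over `X ^ n`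
(`cls_pow_of_isVectorBundle`).

Uniqueness holds because the classes of varieties generate the Grothendieck group, and the binomial
formula says that the exponential map is additive.
-/

namespace EquivariantVarieties

noncomputable section

variable {k : Type u} [Field k]

/-! ### Local properties of sheaves -/

lemma map_map {F : PSh k} {T T' T'' : Sch k} (g : T'' ⟶ T') (f : T' ⟶ T) (x : F.obj (op T)) :
    F.map g.op (F.map f.op x) = F.map (g ≫ f).op x := by
  simp

lemma app_map {F F' : PSh k} (α : F ⟶ F') {T T' : Sch k} (f : T' ⟶ T) (x : F.obj (op T)) :
    α.app (op T') (F.map f.op x) = F'.map f.op (α.app (op T) x) :=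
  NatTrans.naturality_apply α f.op x

lemma separated {F : PSh k} (hF : Presieve.IsSheaf (etale k) F) {T : Sch k} {R : Sieve T}
    (hR : R ∈ etale k T) {x y : F.obj (op T)}
    (h : ∀ (T' : Sch k) (f : T' ⟶ T), R f → F.map f.op x = F.map f.op y) : x = y :=
  (hF R hR).isSeparatedFor.ext h

/-- The image of an injective morphism of sheaves is determined locally. -/
lemma mem_range_of_locally {A B : PSh k} (hA : Presieve.IsSheaf (etale k) A)
    (hB : Presieve.IsSheaf (etale k) B) (ι : A ⟶ B)
    (hι : ∀ T : Sch k, Function.Injective (ι.app (op T))) {T : Sch k} (b : B.obj (op T))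
    {R : Sieve T} (hR : R ∈ etale k T)
    (h : ∀ (T' : Sch k) (f : T' ⟶ T), R f → B.map f.op b ∈ Set.range (ι.app (op T'))) :
    b ∈ Set.range (ι.app (op T)) := by
  choose a ha using h
  obtain ⟨x, hx, -⟩ := hA R hR (fun T' f hf ↦ a T' f hf) (by
    intro T₁ T₂ T' g₁ g₂ f₁ f₂ h₁ h₂ w
    apply hι
    rw [app_map, app_map, ha, ha, map_map, map_map, w])
  refine ⟨x, separated hB hR fun T' f hf ↦ ?_⟩
  rw [← app_map, hx f hf, ha]

/-- A covering sieve of a nonempty scheme contains a morphism from a nonempty scheme. -/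
lemma exists_nonempty_of_mem_etale {T : Sch k} (hT : Nonempty T.left) {R : Sieve T}
    (hR : R ∈ etale k T) : ∃ (T' : Sch k) (f : T' ⟶ T), R f ∧ Nonempty T'.left := by
  by_contra! h
  have : LocallyConstant.const T.left true = LocallyConstant.const T.left false :=
    separated (isSheaf_const Bool) hR fun T' f hf ↦
      have := h T' f hf
      subsingleton_of_isEmpty (isSheaf_const Bool) T' _ _
  obtain ⟨t⟩ := hT
  exact Bool.noConfusion (congrArg (fun c : LocallyConstant T.left Bool ↦ c t) this)

/-! ### Recognizing induced varieties -/

variable {G H : Type} [Group G] [Group H]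

/-- The morphism `f` from an `H`-variety to a `G`-variety is equivariant along `φ`, injective, and
the translates of its image that belong to different cosets of `H` are disjoint. -/
structure IsInducing (φ : H →* G) {X : GVar k H} {Y : GVar k G} (f : X.psh ⟶ Y.psh) : Prop where
  equivariant : ∀ (h : H) {T : Sch k} (x : X.psh.obj (op T)),
    f.app (op T) ((X.act h).app (op T) x) = (Y.act (φ h)).app (op T) (f.app (op T) x)
  injective : ∀ T : Sch k, Function.Injective (f.app (op T))
  mem_range : ∀ {T : Sch k}, Nonempty T.left → ∀ (g : G) (x x' : X.psh.obj (op T)),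
    (Y.act g).app (op T) (f.app (op T) x) = f.app (op T) x' → g ∈ φ.range

/-- The morphism `f` identifies its target with the variety induced from its source: the
target is the disjoint union of the translates of the image, indexed by the cosets of `H`. -/
structure IsInduced (φ : H →* G) {X : GVar k H} {Y : GVar k G} (f : X.psh ⟶ Y.psh) : Prop
    extends IsInducing φ f where
  locally_mem : ∀ {T : Sch k} (y : Y.psh.obj (op T)), ∃ R ∈ etale k T,
    ∀ (T' : Sch k) (p : T' ⟶ T), R p → ∃ (g : G) (x : X.psh.obj (op T')),
      Y.psh.map p.op y = (Y.act g).app (op T') (f.app (op T') x)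

section

variable {φ : H →* G} {X : GVar k H} {Y : GVar k G} {f : X.psh ⟶ Y.psh}

lemma act_injective (Y : GVar k G) (g : G) (T : Sch k) :
    Function.Injective ((Y.act g).app (op T)) :=
  Function.LeftInverse.injective (g := (Y.act g⁻¹).app (op T)) fun y ↦ Y.act_inv_act g y

lemma act_act_inv (Y : GVar k G) (g : G) {T : (Sch k)ᵒᵖ} (y : Y.psh.obj T) :
    (Y.act g).app T ((Y.act g⁻¹).app T y) = y := by
  simpa using Y.act_inv_act g⁻¹ y

lemma IsInducing.exists_act (hf : IsInducing φ f) {T : Sch k} (hT : Nonempty T.left) {g : G}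
    {x x' : X.psh.obj (op T)}
    (h : (Y.act g).app (op T) (f.app (op T) x) = f.app (op T) x') :
    ∃ a : H, φ a = g ∧ (X.act a).app (op T) x = x' := by
  obtain ⟨a, rfl⟩ := hf.mem_range hT g x x' h
  exact ⟨a, rfl, hf.injective T ((hf.equivariant a x).trans h)⟩

variable (f) in
/-- The map `(c, x) ↦ c • f x`, which descends to `G ×ᴴ X` if `f` is equivariant. -/
def translate {T : Sch k} (c : LocallyConstant T.left G) (x : X.psh.obj (op T)) :
    Y.psh.obj (op T) :=
  glue Y.isSheaf c fun g ↦ (Y.act g).app (op T) (f.app (op T) x)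

lemma map_translate {T T' : Sch k} (c : LocallyConstant T.left G) (x : X.psh.obj (op T))
    (p : T' ⟶ T) (g : G) (hg : ∀ t, c (p.left t) = g) :
    Y.psh.map p.op (translate f c x) =
      (Y.act g).app (op T') (f.app (op T') (X.psh.map p.op x)) := by
  rw [translate, map_glue Y.isSheaf c _ p g hg, app_map, app_map]

lemma translate_naturality {T T' : Sch k} (c : LocallyConstant T.left G) (x : X.psh.obj (op T))
    (p : T' ⟶ T) : translate f ((const (k := k) G).map p.op c) (X.psh.map p.op x) =
      Y.psh.map p.op (translate f c x) := by
  refine Eq.trans ?_ (glue_naturality Y.isSheaf c _ p).symm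
  refine congrArg (glue Y.isSheaf _) (funext fun g ↦ ?_)
  rw [app_map, app_map]

/-- The morphism `G ×ᴴ X ⟶ Y` that extends an equivariant morphism `f : X ⟶ Y`. -/
def indDescPsh (hf : IsInducing φ f) : indPsh φ X ⟶ Y.psh where
  app T := TypeCat.ofHom (Quotient.lift
    (fun p : LocallyConstant (unop T).left G × X.psh.obj (op (unop T)) ↦ translate f p.1 p.2) (by
      rintro ⟨c, x⟩ ⟨c', x'⟩ ⟨R, hR, h⟩
      refine separated Y.isSheaf (GrothendieckTopology.intersection_covering _ hR
        (constancySieve_mem c')) fun T' p hp ↦ ?_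
      obtain ⟨a, h₁, h₂⟩ := h T' p hp.1
      obtain ⟨g, hg⟩ := hp.2
      rw [map_translate c' x' p g hg, map_translate c x p (g * φ a) fun t ↦ by
        rw [← hg t]; exact h₁ t]
      rw [GVar.act_mul_apply, ← hf.equivariant]
      exact congrArg _ (congrArg _ h₂)))
  naturality T T' p := by
    ext z
    induction z using Quotient.inductionOn with
    | _ q => exact translate_naturality q.1 q.2 p.unop

lemma indDescPsh_indMk (hf : IsInducing φ f) {T : Sch k} (c : LocallyConstant T.left G)
    (x : X.psh.obj (op T)) :
    (indDescPsh hf).app (op T) (indMk φ X c x) = translate f c x :=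
  rfl

lemma map_indMk_of_const {T T' : Sch k} (c : LocallyConstant T.left G) (x : X.psh.obj (op T))
    (p : T' ⟶ T) (g : G) (hg : ∀ t, c (p.left t) = g) :
    (indPsh φ X).map p.op (indMk φ X c x) =
      indMk φ X (LocallyConstant.const _ g) (X.psh.map p.op x) :=
  congrArg (fun c ↦ indMk φ X c (X.psh.map p.op x)) (LocallyConstant.ext hg)

lemma indDescPsh_injective (hf : IsInducing φ f) (T : Sch k) :
    Function.Injective ((indDescPsh hf).app (op T)) := by
  intro z z' h
  induction z using Quotient.inductionOn with
  | _ p =>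
  induction z' using Quotient.inductionOn with
  | _ p' =>
  obtain ⟨c, x⟩ := p
  obtain ⟨c', x'⟩ := p'
  change translate f c x = translate f c' x' at h
  refine Quotient.sound ⟨_, GrothendieckTopology.intersection_covering _ (constancySieve_mem c)
    (constancySieve_mem c'), fun T' p hp ↦ ?_⟩
  obtain ⟨⟨g, hg⟩, g', hg'⟩ := hp
  rcases isEmpty_or_nonempty T'.left with hT | hT
  · exact ⟨1, fun t ↦ isEmptyElim t, subsingleton_of_isEmpty X.isSheaf T' _ _⟩
  · have h₁ := congrArg (Y.psh.map p.op) h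
    rw [map_translate c x p g hg, map_translate c' x' p g' hg'] at h₁
    have h₂ := congrArg ((Y.act g'⁻¹).app (op T')) h₁
    rw [Y.act_inv_act, ← GVar.act_mul_apply] at h₂
    obtain ⟨a, ha, ha'⟩ := hf.exists_act hT h₂
    refine ⟨a, fun t ↦ ?_, ha'⟩
    rw [ha, hg', hg, mul_inv_cancel_left]

lemma act_mem_range_indDescPsh (hf : IsInducing φ f) (g : G) {T : Sch k} (x : X.psh.obj (op T)) :
    (Y.act g).app (op T) (f.app (op T) x) ∈ Set.range ((indDescPsh hf).app (op T)) := by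
  refine ⟨indMk φ X (LocallyConstant.const _ g) x, ?_⟩
  have h₁ := map_translate (f := f) (LocallyConstant.const _ g) x (𝟙 T) g (fun _ ↦ rfl)
  simp only [op_id, Functor.map_id_apply] at h₁
  exact (indDescPsh_indMk _ _ _).trans h₁

lemma exists_cover_of_mem_range_indDescPsh (hf : IsInducing φ f) {T : Sch k}
    {y : Y.psh.obj (op T)} (hy : y ∈ Set.range ((indDescPsh hf).app (op T))) :
    ∃ R ∈ etale k T, ∀ (T' : Sch k) (p : T' ⟶ T), R p → ∃ (g : G) (x : X.psh.obj (op T')),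
      Y.psh.map p.op y = (Y.act g).app (op T') (f.app (op T') x) := by
  obtain ⟨z, rfl⟩ := hy
  induction z using Quotient.inductionOn with
  | _ q =>
  exact ⟨_, constancySieve_mem q.1, fun T' p ⟨g, hg⟩ ↦
    ⟨g, X.psh.map p.op q.2, map_translate q.1 q.2 p g hg⟩⟩

variable (φ X) in
/-- The inclusion of `X` in `G ×ᴴ X` as the component of the identity coset. -/
def indUnit : X.psh ⟶ indPsh φ X where
  app T := TypeCat.ofHom fun x ↦ indMk φ X (LocallyConstant.const _ 1) x

variable [Finite G]

/-- The equivariant morphism `G ×ᴴ X ⟶ Y` that extends an equivariant morphism `f : X ⟶ Y`. -/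
def GVar.indDesc (hφ : Function.Injective φ) (hf : IsInducing φ f) : GVar.ind φ hφ X ⟶ Y :=
  GVar.homMk (indDescPsh hf) fun g ↦ by
    ext T z
    induction z using Quotient.inductionOn with
    | _ p =>
    obtain ⟨c, x⟩ := p
    change translate f (c.map (g * ·)) x = (Y.act g).app T (translate f c x)
    refine separated Y.isSheaf (constancySieve_mem c) fun T' p hp ↦ ?_
    obtain ⟨g', hg'⟩ := hp
    rw [map_translate _ x p (g * g') fun t ↦ by simp [hg' t], ← app_map,
      map_translate c x p g' hg', GVar.act_mul_apply]

lemma isInduced_ind (hφ : Function.Injective φ) (X : GVar k H) :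
    IsInduced φ (X := X) (Y := GVar.ind φ hφ X) (indUnit φ X) where
  equivariant a T x := by
    refine Quotient.sound ⟨⊤, GrothendieckTopology.top_mem _ _, fun T' p _ ↦ ⟨a⁻¹, fun t ↦ ?_, ?_⟩⟩
    · simp
    · exact (congrArg _ (app_map _ _ _).symm).trans (X.act_inv_act a _)
  injective T x x' h := by
    obtain ⟨R, hR, h⟩ := Quotient.exact h
    refine separated X.isSheaf hR fun T' p hp ↦ ?_
    rcases isEmpty_or_nonempty T'.left with hT | ⟨⟨t⟩⟩
    · exact subsingleton_of_isEmpty X.isSheaf T' _ _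
    · obtain ⟨a, h₁, h₂⟩ := h T' p hp
      have h₃ : φ a = 1 := by simpa using (h₁ t).symm
      rw [map_eq_one_iff φ hφ] at h₃
      subst h₃
      rwa [GVar.act_one_apply] at h₂
  mem_range {T} hT g x x' h := by
    obtain ⟨R, hR, h⟩ := Quotient.exact h
    obtain ⟨T', p, hp, ⟨t⟩⟩ := exists_nonempty_of_mem_etale hT hR
    obtain ⟨a, h₁, -⟩ := h T' p hp
    exact ⟨a, by simpa using (h₁ t).symm⟩
  locally_mem {T} z := by
    induction z using Quotient.inductionOn with
    | _ q =>
    obtain ⟨c, x⟩ := q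
    refine ⟨_, constancySieve_mem c, fun T' p ⟨g, hg⟩ ↦ ⟨g, X.psh.map p.op x, ?_⟩⟩
    refine (map_indMk_of_const c x p g hg).trans ?_
    exact congrArg (fun c ↦ indMk φ X c (X.psh.map p.op x))
      (LocallyConstant.ext fun t ↦ (mul_one g).symm)

lemma IsInduced.indDescPsh_bijective (hφ : Function.Injective φ) (hf : IsInduced φ f) (T : Sch k) :
    Function.Bijective ((indDescPsh hf.toIsInducing).app (op T)) := by
  refine ⟨indDescPsh_injective _ T, fun y ↦ ?_⟩
  obtain ⟨R, hR, h⟩ := hf.locally_mem y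
  refine mem_range_of_locally (GVar.ind φ hφ X).isSheaf Y.isSheaf _ (indDescPsh_injective _) y hR
    fun T' p hp ↦ ?_
  obtain ⟨g, x, hg⟩ := h T' p hp
  rw [hg]
  exact act_mem_range_indDescPsh _ g x

/-- A morphism that satisfies the criterion presents its target as the induced variety. -/
def IsInduced.iso (hφ : Function.Injective φ) (hf : IsInduced φ f) : GVar.ind φ hφ X ≅ Y :=
  GVar.isoMk (NatIso.ofComponents (fun T ↦ (Equiv.ofBijective _
    (hf.indDescPsh_bijective hφ (unop T))).toIso) (fun p ↦ (indDescPsh hf.toIsInducing).naturality p))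
    (act_comm (GVar.indDesc hφ hf.toIsInducing))

lemma IsInduced.ind_cls (hφ : Function.Injective φ) (hf : IsInduced φ f) :
    K0.ind φ hφ (K0.cls X) = K0.cls Y := by
  rw [K0.ind_cls]
  exact K0.cls_eq_of_iso (hf.iso hφ)

end

section

variable {G' H' : Type} [Group G'] [Group H'] {φ : H →* G} {X : GVar k H} {Y : GVar k G}
  {f : X.psh ⟶ Y.psh}

lemma act_app_map (Y : GVar k G) (g : G) {T T' : Sch k} (p : T' ⟶ T) (y : Y.psh.obj (op T)) :
    (Y.act g).app (op T') (Y.psh.map p.op y) = Y.psh.map p.op ((Y.act g).app (op T) y) :=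
  app_map (Y.act g) p y

lemma IsInduced.comp {ψ : G →* G'} {Z : GVar k G'} {f' : Y.psh ⟶ Z.psh} (hf : IsInduced φ f)
    (hf' : IsInduced ψ f') : IsInduced (ψ.comp φ) (X := X) (Y := Z) (f ≫ f') where
  equivariant a T x := by
    refine (congrArg _ (hf.equivariant a x)).trans ?_
    exact hf'.equivariant (φ a) _
  injective T := (hf'.injective T).comp (hf.injective T)
  mem_range hT g x x' h := by
    obtain ⟨b, rfl, hb⟩ := hf'.exists_act hT h
    obtain ⟨a, rfl, -⟩ := hf.exists_act hT hb
    exact ⟨a, rfl⟩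
  locally_mem {T} z := by
    obtain ⟨R, hR, h⟩ := hf'.locally_mem z
    choose g y h using h
    choose S hS hS' using fun (T' : Sch k) (p : T' ⟶ T) (hp : R p) ↦ hf.locally_mem (y T' p hp)
    refine ⟨Sieve.bind R (fun T' p hp ↦ S T' p hp), GrothendieckTopology.bind_covering _ hR
      (fun T' p hp ↦ hS T' p hp), ?_⟩
    rintro T'' _ ⟨T', q, p, hp, hq, rfl⟩
    obtain ⟨b, x, hx⟩ := hS' T' p hp T'' q hq
    refine ⟨g T' p hp * ψ b, x, ?_⟩
    rw [← map_map, h T' p hp, ← act_app_map, ← app_map, hx, hf'.equivariant, GVar.act_mul_apply]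
    rfl

lemma IsInduced.box {φ' : H' →* G'} {X' : GVar k H'} {Y' : GVar k G'} {f' : X'.psh ⟶ Y'.psh}
    (hf : IsInduced φ f) (hf' : IsInduced φ' f') :
    IsInduced (φ.prodMap φ') (X := X.box X') (Y := Y.box Y') (f ⊗ₘ f') where
  equivariant a T x := Prod.ext (hf.equivariant a.1 _) (hf'.equivariant a.2 _)
  injective T x x' h :=
    Prod.ext (hf.injective T (congrArg Prod.fst h)) (hf'.injective T (congrArg Prod.snd h))
  mem_range hT g x x' h := by
    obtain ⟨a, ha⟩ := hf.mem_range hT g.1 x.1 x'.1 (congrArg Prod.fst h)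
    obtain ⟨a', ha'⟩ := hf'.mem_range hT g.2 x.2 x'.2 (congrArg Prod.snd h)
    exact ⟨(a, a'), Prod.ext ha ha'⟩
  locally_mem {T} y := by
    obtain ⟨R, hR, h⟩ := hf.locally_mem y.1
    obtain ⟨R', hR', h'⟩ := hf'.locally_mem y.2
    refine ⟨R ⊓ R', GrothendieckTopology.intersection_covering _ hR hR', fun T' p hp ↦ ?_⟩
    obtain ⟨g, x, hx⟩ := h T' p hp.1
    obtain ⟨g', x', hx'⟩ := h' T' p hp.2
    exact ⟨(g, g'), (x, x'), Prod.ext hx hx'⟩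

/-- Replacing the component of the identity coset by a translate conjugates the homomorphism. -/
lemma IsInduced.comp_act (hf : IsInduced φ f) (g₀ : G) :
    IsInduced ((MulAut.conj g₀).toMonoidHom.comp φ) (X := X) (Y := Y) (f ≫ Y.act g₀) where
  equivariant a T x := by
    refine (congrArg _ (hf.equivariant a x)).trans ?_
    refine (Y.act_mul_apply _ _ _).symm.trans (Eq.trans ?_ (Y.act_mul_apply _ _ _))
    simp
    rfl
  injective T := (act_injective Y g₀ T).comp (hf.injective T)
  mem_range hT g x x' h := by
    have h' : (Y.act (g * g₀)).app _ (f.app _ x) = (Y.act g₀).app _ (f.app _ x') :=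
      (Y.act_mul_apply _ _ _).trans h
    have h₂ := congrArg ((Y.act g₀⁻¹).app _) h'
    rw [Y.act_inv_act, ← GVar.act_mul_apply] at h₂
    obtain ⟨a, ha⟩ := hf.mem_range hT _ _ _ h₂
    exact ⟨a, by simp [ha, mul_assoc]⟩
  locally_mem {T} y := by
    obtain ⟨R, hR, h⟩ := hf.locally_mem y
    refine ⟨R, hR, fun T' p hp ↦ ?_⟩
    obtain ⟨g, x, hx⟩ := h T' p hp
    refine ⟨g * g₀⁻¹, x, ?_⟩
    refine hx.trans (Eq.trans ?_ (Y.act_mul_apply _ _ _).symm)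
    exact congrArg _ (Y.act_inv_act g₀ _).symm

lemma isInduced_of_iso (α : H ≃* G) (e : X.psh ≅ Y.psh)
    (he : ∀ a, X.act a ≫ e.hom = e.hom ≫ Y.act (α a)) :
    IsInduced α.toMonoidHom (X := X) (Y := Y) e.hom where
  equivariant a T x := congrArg (fun ψ ↦ ψ.app (op T) x) (he a)
  injective T := ((isIso_iff_bijective _).1 inferInstance).1
  mem_range hT g x x' h := ⟨α.symm g, α.apply_symm_apply g⟩
  locally_mem {T} y := ⟨⊤, GrothendieckTopology.top_mem _ _, fun T' p _ ↦ by
    obtain ⟨x, hx⟩ := ((isIso_iff_bijective (e.hom.app (op T'))).1 inferInstance).2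
      (Y.psh.map p.op y)
    exact ⟨1, x, by rw [hx, GVar.act_one_apply]⟩⟩

end

/-! ### Additive maps on Grothendieck groups -/

/-- The Grothendieck group is generated by the classes of varieties. -/
@[elab_as_elim]
lemma K0.induction_on {P : K0 k G → Prop} (x : K0 k G) (zero : P 0)
    (cls : ∀ X, P (K0.cls X)) (neg : ∀ x, P x → P (-x))
    (add : ∀ x y, P x → P y → P (x + y)) : P x := by
  obtain ⟨z, rfl⟩ := Ideal.Quotient.mk_surjective x
  induction z using FreeAbelianGroup.induction_on with
  | zero => simpa using zero
  | of s =>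
    obtain ⟨X, rfl⟩ : ∃ X, toSkeleton X = s := ⟨s.out, Quotient.out_eq _⟩
    exact cls X
  | neg s hs => rw [map_neg]; exact neg _ hs
  | add y z hy hz => rw [map_add]; exact add _ _ hy hz

lemma K0.addHom_ext {A : Type*} [AddCommGroup A] {α β : K0 k G →+ A}
    (h : ∀ X, α (K0.cls X) = β (K0.cls X)) : α = β := by
  ext x
  induction x using K0.induction_on with
  | zero => simp
  | cls X => exact h X
  | neg x hx => simp [hx]
  | add x y hx hy => simp [hx, hy]

lemma K0.box_add (x : K0 k G) (y z : K0 k H) : K0.box x (y + z) = K0.box x y + K0.box x z := by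
  simp [K0.box, mul_add]

lemma K0.add_box (x y : K0 k G) (z : K0 k H) : K0.box (x + y) z = K0.box x z + K0.box y z := by
  simp [K0.box, add_mul]

lemma K0.cls_unit : K0.cls (𝟙_ (GVar k G)) = 1 :=
  rfl

/-! ### Products of symmetric groups -/

section Young

variable {i j l m n : ℕ}

/-- The decomposition of `n` letters into the first `i` and the last `j`. -/
def youngEquiv (h : i + j = n) : Fin i ⊕ Fin j ≃ Fin n :=
  finSumFinEquiv.trans (finCongr h)

lemma youngEquiv_inl_val (h : i + j = n) (a : Fin i) :
    (youngEquiv h (Sum.inl a) : ℕ) = a := by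
  simp [youngEquiv]

lemma youngEquiv_inr_val (h : i + j = n) (b : Fin j) :
    (youngEquiv h (Sum.inr b) : ℕ) = i + b := by
  simp [youngEquiv]

lemma young_inl (h : i + j = n) (p : Equiv.Perm (Fin i) × Equiv.Perm (Fin j)) (a : Fin i) :
    young h p (youngEquiv h (Sum.inl a)) = youngEquiv h (Sum.inl (p.1 a)) := by
  simp [young, youngEquiv, Equiv.permCongrHom]

lemma young_inr (h : i + j = n) (p : Equiv.Perm (Fin i) × Equiv.Perm (Fin j)) (b : Fin j) :
    young h p (youngEquiv h (Sum.inr b)) = youngEquiv h (Sum.inr (p.2 b)) := by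
  simp [young, youngEquiv, Equiv.permCongrHom]

lemma perm_ext_young (h : i + j = n) {σ τ : Equiv.Perm (Fin n)}
    (hl : ∀ a, σ (youngEquiv h (Sum.inl a)) = τ (youngEquiv h (Sum.inl a)))
    (hr : ∀ b, σ (youngEquiv h (Sum.inr b)) = τ (youngEquiv h (Sum.inr b))) : σ = τ := by
  ext x : 1
  obtain ⟨a | b, rfl⟩ := (youngEquiv h).surjective x
  · exact hl a
  · exact hr b

/-- The permutation that exchanges the first `i` and the last `j` letters. -/
def blockSwap (h : i + j = n) (h' : j + i = n) : Equiv.Perm (Fin n) :=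
  ((youngEquiv h).symm.trans (Equiv.sumComm _ _)).trans (youngEquiv h')

/-- The embeddings of `Σ_i × Σ_j` and `Σ_j × Σ_i` are conjugate. -/
lemma conj_blockSwap_young (h : i + j = n) (h' : j + i = n) :
    (MulAut.conj (blockSwap h h')).toMonoidHom.comp (young h) =
      (young h').comp (MulEquiv.prodComm (M := Equiv.Perm (Fin i))
        (N := Equiv.Perm (Fin j))).toMonoidHom := by
  ext1 p
  refine perm_ext_young h' (fun b ↦ ?_) (fun a ↦ ?_)
  · refine Eq.trans ?_ (young_inl h' _ b).symm
    simp [blockSwap, young_inr]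
  · refine Eq.trans ?_ (young_inr h' _ a).symm
    simp [blockSwap, young_inl]

lemma youngEquiv_assoc_inl (h₁ : i + j = m) (h₂ : m + l = n) {m' : ℕ}
    (h₄ : i + m' = n) (a : Fin i) :
    youngEquiv h₂ (Sum.inl (youngEquiv h₁ (Sum.inl a))) = youngEquiv h₄ (Sum.inl a) := by
  apply Fin.ext
  simp [youngEquiv_inl_val]

lemma youngEquiv_assoc_mid (h₁ : i + j = m) (h₂ : m + l = n) {m' : ℕ} (h₃ : j + l = m')
    (h₄ : i + m' = n) (b : Fin j) :
    youngEquiv h₂ (Sum.inl (youngEquiv h₁ (Sum.inr b))) =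
      youngEquiv h₄ (Sum.inr (youngEquiv h₃ (Sum.inl b))) := by
  apply Fin.ext
  simp [youngEquiv_inl_val, youngEquiv_inr_val]

lemma youngEquiv_assoc_inr (h₁ : i + j = m) (h₂ : m + l = n) {m' : ℕ} (h₃ : j + l = m')
    (h₄ : i + m' = n) (c : Fin l) :
    youngEquiv h₂ (Sum.inr c) = youngEquiv h₄ (Sum.inr (youngEquiv h₃ (Sum.inr c))) := by
  apply Fin.ext
  simp only [youngEquiv_inr_val]
  omega

lemma young_comp_assoc (h₁ : i + j = m) (h₂ : m + l = n) {m' : ℕ} (h₃ : j + l = m')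
    (h₄ : i + m' = n) :
    (young h₂).comp ((young h₁).prodMap (MonoidHom.id _)) =
      ((young h₄).comp ((MonoidHom.id _).prodMap (young h₃))).comp
        MulEquiv.prodAssoc.toMonoidHom := by
  ext1 p
  obtain ⟨⟨σ, τ⟩, ρ⟩ := p
  change young h₂ (young h₁ (σ, τ), ρ) = young h₄ (σ, young h₃ (τ, ρ))
  refine perm_ext_young h₂ (fun a ↦ ?_) (fun c ↦ ?_)
  · obtain ⟨a | b, rfl⟩ := (youngEquiv h₁).surjective a
    · rw [young_inl, young_inl, youngEquiv_assoc_inl h₁ h₂ h₄,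
        youngEquiv_assoc_inl h₁ h₂ h₄, young_inl]
    · rw [young_inl, young_inr, youngEquiv_assoc_mid h₁ h₂ h₃ h₄,
        youngEquiv_assoc_mid h₁ h₂ h₃ h₄, young_inr, young_inl]
  · rw [young_inr, youngEquiv_assoc_inr h₁ h₂ h₃ h₄,
        youngEquiv_assoc_inr h₁ h₂ h₃ h₄, young_inr, young_inr]

end Young

/-! ### The induction product -/

section InductionProduct

variable {i j l m n : ℕ}

/-- The induction product as a biadditive map. -/
def inductionProductHom (h : i + j = n) :
    K0 k (Equiv.Perm (Fin i)) →+ K0 k (Equiv.Perm (Fin j)) →+ K0 k (Equiv.Perm (Fin n)) :=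
  AddMonoidHom.mk' (fun x ↦ AddMonoidHom.mk' (fun y ↦ inductionProduct h x y)
    (fun y z ↦ by rw [inductionProduct, K0.box_add, map_add]; rfl))
    (fun x y ↦ by
      ext z
      change inductionProduct h (x + y) z = _
      rw [inductionProduct, K0.add_box, map_add]
      rfl)

lemma inductionProduct_eq_hom (h : i + j = n) (x : K0 k (Equiv.Perm (Fin i)))
    (y : K0 k (Equiv.Perm (Fin j))) : inductionProduct h x y = inductionProductHom h x y :=
  rfl

lemma inductionProduct_cls (h : i + j = n) (X : GVar k (Equiv.Perm (Fin i)))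
    (Y : GVar k (Equiv.Perm (Fin j))) : inductionProduct h (K0.cls X) (K0.cls Y) =
      K0.cls (GVar.ind (young h) (young_injective h) (X.box Y)) := by
  rw [inductionProduct, K0.box_cls, K0.ind_cls]

/-- The varieties induced from `X × Y` and `Y × X` agree since the two embeddings of the product of
symmetric groups are conjugate by the block permutation. -/
lemma inductionProduct_comm (h : i + j = n) (h' : j + i = n) (x : K0 k (Equiv.Perm (Fin i)))
    (y : K0 k (Equiv.Perm (Fin j))) : inductionProduct h x y = inductionProduct h' y x := by
  simp only [inductionProduct_eq_hom]
  induction x using K0.induction_on with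
  | zero => simp
  | neg x hx => simp [hx]
  | add x x' hx hx' => simp [hx, hx']
  | cls X =>
  induction y using K0.induction_on with
  | zero => simp
  | neg x hx => simp [hx]
  | add x x' hx hx' => simp [hx, hx']
  | cls Y =>
  simp only [← inductionProduct_eq_hom, inductionProduct_cls]
  have h₁ := (isInduced_ind (young_injective h) (X.box Y)).comp_act (blockSwap h h')
  have h₂ := (isInduced_of_iso (X := X.box Y) (Y := Y.box X) MulEquiv.prodComm
    (β_ X.psh Y.psh) (fun _ ↦ rfl)).comp (isInduced_ind (young_injective h') (Y.box X))
  rw [conj_blockSwap_young h h'] at h₁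
  have hinj := (young_injective h').comp (MulEquiv.prodComm (M := Equiv.Perm (Fin i))
    (N := Equiv.Perm (Fin j))).injective
  exact (h₁.ind_cls hinj).symm.trans (h₂.ind_cls hinj)

/-- Both sides are induced from `X × Y × Z` along the same embedding, by transitivity of induction. -/
lemma inductionProduct_assoc (h₁ : i + j = m) (h₂ : m + l = n) {m' : ℕ} (h₃ : j + l = m')
    (h₄ : i + m' = n) (x : K0 k (Equiv.Perm (Fin i))) (y : K0 k (Equiv.Perm (Fin j)))
    (z : K0 k (Equiv.Perm (Fin l))) :
    inductionProduct h₂ (inductionProduct h₁ x y) z =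
      inductionProduct h₄ x (inductionProduct h₃ y z) := by
  simp only [inductionProduct_eq_hom]
  induction x using K0.induction_on with
  | zero => simp
  | neg x hx => simp [hx]
  | add x x' hx hx' => simp [hx, hx']
  | cls X =>
  induction y using K0.induction_on with
  | zero => simp
  | neg x hx => simp [hx]
  | add x x' hx hx' => simp [hx, hx']
  | cls Y =>
  induction z using K0.induction_on with
  | zero => simp
  | neg x hx => simp [hx]
  | add x x' hx hx' => simp [hx, hx']
  | cls Z =>
  simp only [← inductionProduct_eq_hom, inductionProduct_cls]
  have hid : ∀ {p : ℕ} (W : GVar k (Equiv.Perm (Fin p))),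
      IsInduced (MonoidHom.id _) (X := W) (Y := W) (𝟙 W.psh) := fun W ↦
    isInduced_of_iso (MulEquiv.refl _) (Iso.refl W.psh) (fun _ ↦ rfl)
  have h := ((isInduced_ind (young_injective h₁) (X.box Y)).box (hid Z)).comp
    (isInduced_ind (young_injective h₂) _)
  have h' := ((isInduced_of_iso (X := (X.box Y).box Z) (Y := X.box (Y.box Z)) MulEquiv.prodAssoc
    (α_ X.psh Y.psh Z.psh) (fun _ ↦ rfl)).comp
    ((hid X).box (isInduced_ind (young_injective h₃) (Y.box Z)))).comp
      (isInduced_ind (young_injective h₄) _)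
  have hinj : Function.Injective ((young h₂).comp ((young h₁).prodMap (MonoidHom.id _))) :=
    (young_injective h₂).comp ((young_injective h₁).prodMap Function.injective_id)
  rw [← MonoidHom.comp_assoc, ← young_comp_assoc h₁ h₂ h₃ h₄] at h'
  exact (h.ind_cls hinj).symm.trans (h'.ind_cls hinj)

lemma one_inductionProduct (h : 0 + n = n) (x : K0 k (Equiv.Perm (Fin n))) :
    inductionProduct h 1 x = x := by
  simp only [inductionProduct_eq_hom]
  induction x using K0.induction_on with
  | zero => simp
  | neg x hx => simp [hx]
  | add x x' hx hx' => simp [hx, hx']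
  | cls X =>
  rw [← inductionProduct_eq_hom, ← K0.cls_unit, inductionProduct_cls, ← K0.ind_cls]
  let e : (GVar.box (𝟙_ (GVar k (Equiv.Perm (Fin 0)))) X).psh ≅ X.psh := λ_ X.psh
  have hy : ∀ p : Equiv.Perm (Fin 0) × Equiv.Perm (Fin n), young h p = p.2 := fun p ↦
    perm_ext_young h (fun a ↦ a.elim0) fun b ↦ by
      have hb : ∀ b, youngEquiv h (Sum.inr b) = b := fun b ↦ Fin.ext (by simp [youngEquiv_inr_val])
      rw [young_inr, hb, hb]
  let α : Equiv.Perm (Fin 0) × Equiv.Perm (Fin n) ≃* Equiv.Perm (Fin n) :=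
    MulEquiv.ofBijective (young h) ⟨young_injective h, fun σ ↦ ⟨(1, σ), hy _⟩⟩
  exact (isInduced_of_iso α e fun a ↦ by
    change _ = e.hom ≫ X.act (young h a)
    rw [hy]
    rfl).ind_cls (young_injective h)

end InductionProduct

/-! ### The ring of sequences -/

namespace SymSeq

/-- The induction product in degree `n` of elements of degrees `i` and `j`, extended by zero to the
degrees with `i + j ≠ n`, so that sums over pairs of degrees can be reindexed without carrying the
equation `i + j = n`. -/
def mulAt (n i j : ℕ) (x : K0 k (Equiv.Perm (Fin i))) (y : K0 k (Equiv.Perm (Fin j))) :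
    K0 k (Equiv.Perm (Fin n)) :=
  if h : i + j = n then inductionProduct h x y else 0

lemma mulAt_of_eq {n i j : ℕ} (h : i + j = n) (x : K0 k (Equiv.Perm (Fin i)))
    (y : K0 k (Equiv.Perm (Fin j))) : mulAt n i j x y = inductionProduct h x y :=
  dif_pos h

lemma mulAt_add {n i j : ℕ} (x : K0 k (Equiv.Perm (Fin i))) (y z : K0 k (Equiv.Perm (Fin j))) :
    mulAt n i j x (y + z) = mulAt n i j x y + mulAt n i j x z := by
  unfold mulAt
  split_ifs
  · simp [inductionProduct_eq_hom]
  · simp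

lemma mulAt_sum {n i j : ℕ} {ι : Type*} (s : Finset ι) (x : K0 k (Equiv.Perm (Fin i)))
    (y : ι → K0 k (Equiv.Perm (Fin j))) :
    mulAt n i j x (∑ a ∈ s, y a) = ∑ a ∈ s, mulAt n i j x (y a) := by
  unfold mulAt
  split_ifs
  · simp [inductionProduct_eq_hom]
  · simp

lemma sum_mulAt {n i j : ℕ} {ι : Type*} (s : Finset ι) (x : ι → K0 k (Equiv.Perm (Fin i)))
    (y : K0 k (Equiv.Perm (Fin j))) :
    mulAt n i j (∑ a ∈ s, x a) y = ∑ a ∈ s, mulAt n i j (x a) y := by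
  unfold mulAt
  split_ifs
  · simp [inductionProduct_eq_hom]
  · simp

lemma mulAt_comm (n i j : ℕ) (x : K0 k (Equiv.Perm (Fin i))) (y : K0 k (Equiv.Perm (Fin j))) :
    mulAt n i j x y = mulAt n j i y x := by
  unfold mulAt
  by_cases h : i + j = n
  · rw [dif_pos h, dif_pos ((add_comm j i).trans h)]
    exact inductionProduct_comm _ _ _ _
  · rw [dif_neg h, dif_neg fun h' ↦ h ((add_comm i j).trans h')]

lemma star_apply (a b : SymSeq k) (n : ℕ) :
    a.star b n = ∑ p ∈ Finset.HasAntidiagonal.antidiagonal n, mulAt n p.1 p.2 (a p.1) (b p.2) := by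
  rw [← Finset.sum_coe_sort]
  exact Finset.sum_congr rfl fun p _ ↦
    (mulAt_of_eq (Finset.HasAntidiagonal.mem_antidiagonal.1 p.2) _ _).symm

lemma star_comm (a b : SymSeq k) : a.star b = b.star a := by
  funext n
  rw [star_apply, star_apply, ← Finset.Nat.sum_antidiagonal_swap]
  exact Finset.sum_congr rfl fun p _ ↦ mulAt_comm _ _ _ _ _

lemma star_assoc (a b c : SymSeq k) : (a.star b).star c = a.star (b.star c) := by
  funext n
  simp only [star_apply, mulAt_sum, sum_mulAt, Finset.sum_sigma']
  refine Finset.sum_nbij' (fun x ↦ ⟨(x.2.1, x.2.2 + x.1.2), (x.2.2, x.1.2)⟩)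
    (fun x ↦ ⟨(x.1.1 + x.2.1, x.2.2), (x.1.1, x.2.1)⟩) ?_ ?_ ?_ ?_ ?_
  · rintro ⟨⟨m, l⟩, i, j⟩ h
    simp only [Finset.mem_sigma, Finset.HasAntidiagonal.mem_antidiagonal] at h ⊢
    obtain ⟨h₁, h₂⟩ := h
    exact ⟨by omega, trivial⟩
  · rintro ⟨⟨i, m⟩, j, l⟩ h
    simp only [Finset.mem_sigma, Finset.HasAntidiagonal.mem_antidiagonal] at h ⊢
    obtain ⟨h₁, h₂⟩ := h
    exact ⟨by omega, trivial⟩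
  · rintro ⟨⟨m, l⟩, i, j⟩ h
    simp only [Finset.mem_sigma, Finset.HasAntidiagonal.mem_antidiagonal] at h ⊢
    obtain ⟨-, rfl⟩ := h
    rfl
  · rintro ⟨⟨i, m⟩, j, l⟩ h
    simp only [Finset.mem_sigma, Finset.HasAntidiagonal.mem_antidiagonal] at h ⊢
    obtain ⟨-, rfl⟩ := h
    rfl
  · rintro ⟨⟨m, l⟩, i, j⟩ h
    simp only [Finset.mem_sigma, Finset.HasAntidiagonal.mem_antidiagonal] at h ⊢
    obtain ⟨h₁, h₂⟩ := h
    have h₃ : i + (j + l) = n := by omega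
    rw [mulAt_of_eq h₁, mulAt_of_eq h₂, mulAt_of_eq h₃, mulAt_of_eq rfl]
    exact inductionProduct_assoc _ _ _ _ _ _ _

lemma unit_succ (n : ℕ) : SymSeq.unit k (n + 1) = 0 :=
  Pi.single_eq_of_ne (M := fun n ↦ K0 k (Equiv.Perm (Fin n))) (Nat.succ_ne_zero n) 1

lemma unit_star (a : SymSeq k) : (SymSeq.unit k).star a = a := by
  funext n
  rw [star_apply, Finset.sum_eq_single (0, n)]
  · rw [mulAt_of_eq (zero_add n)]
    exact one_inductionProduct _ _
  · rintro ⟨i, j⟩ h h'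
    simp only [Finset.HasAntidiagonal.mem_antidiagonal] at h
    have hi : i ≠ 0 := by
      rintro rfl
      exact h' (by rw [← h, zero_add])
    rw [mulAt_of_eq h]
    simp [SymSeq.unit, hi, inductionProduct_eq_hom]
  · simp

lemma star_add (a b c : SymSeq k) : a.star (b + c) = a.star b + a.star c := by
  funext n
  rw [Pi.add_apply, star_apply, star_apply, star_apply, ← Finset.sum_add_distrib]
  exact Finset.sum_congr rfl fun p _ ↦ mulAt_add _ _ _

lemma star_zero_eq_one {a b : SymSeq k} (ha : a 0 = 1) (hb : b 0 = 1) : a.star b 0 = 1 := by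
  rw [star_apply, Finset.Nat.antidiagonal_zero, Finset.sum_singleton]
  change mulAt 0 0 0 (a 0) (b 0) = 1
  rw [ha, hb, mulAt_of_eq (zero_add 0), one_inductionProduct]

/-- The components of the inverse of a sequence with constant term `1`, which are determined
recursively by the equations `∑ a_i b_j = 0` in positive degrees. -/
def inv (a : SymSeq k) : SymSeq k
  | 0 => 1
  | n + 1 => -∑ j : Fin (n + 1), mulAt (n + 1) (n + 1 - j) j (a (n + 1 - j)) (inv a j)

lemma star_inv {a : SymSeq k} (ha : a 0 = 1) : a.star (inv a) = SymSeq.unit k := by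
  funext n
  cases n with
  | zero => exact star_zero_eq_one ha (by rw [inv])
  | succ n =>
    rw [star_comm, star_apply, Finset.Nat.sum_antidiagonal_eq_sum_range_succ_mk,
      Finset.sum_range_succ, Finset.sum_range]
    have h : mulAt (n + 1) (n + 1) (n + 1 - (n + 1)) (inv a (n + 1)) (a (n + 1 - (n + 1))) =
        inv a (n + 1) := by
      have hm : ∀ m, m = 0 → ∀ x, mulAt (n + 1) m (n + 1) (a m) x = x := by
        rintro _ rfl x
        rw [ha, mulAt_of_eq (zero_add _), one_inductionProduct]
      rw [mulAt_comm, hm _ (Nat.sub_self _)]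
    rw [h, inv]
    refine (congrArg (· + _) (Finset.sum_congr rfl fun j _ ↦ mulAt_comm _ _ _ _ _)).trans ?_
    exact (add_neg_cancel _).trans (unit_succ n).symm

end SymSeq

variable (k) in
/-- The sequences with constant term `1`, as a multiplicative group under the product of
sequences. -/
def UnitSeq : Type (u + 1) := {a : SymSeq k // a 0 = 1}

instance : CommGroup (UnitSeq k) where
  mul a b := ⟨a.1.star b.1, SymSeq.star_zero_eq_one a.2 b.2⟩
  one := ⟨SymSeq.unit k, by simp [SymSeq.unit]⟩
  inv a := ⟨SymSeq.inv a.1, by rw [SymSeq.inv]⟩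
  mul_assoc a b c := Subtype.ext (SymSeq.star_assoc _ _ _)
  mul_comm a b := Subtype.ext (SymSeq.star_comm _ _)
  one_mul a := Subtype.ext (SymSeq.unit_star _)
  mul_one a := Subtype.ext ((SymSeq.star_comm _ _).trans (SymSeq.unit_star _))
  inv_mul_cancel a := Subtype.ext ((SymSeq.star_comm _ _).trans (SymSeq.star_inv a.2))

lemma UnitSeq.mul_val (a b : UnitSeq k) : (a * b).1 = a.1.star b.1 :=
  rfl

/-! ### Affine spaces -/

section AffineSpace

variable (k) in
/-- The presheaf of `d`-tuples of functions, which is represented by affine `d`-space. -/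
def vecPsh (d : ℕ) : PSh k where
  obj T := Fin d → Γ((unop T).left, ⊤)
  map f := TypeCat.ofHom fun v i ↦ f.unop.left.appTop (v i)
  map_id T := by
    ext v i
    simp
  map_comp f g := by
    ext v i
    simp
    rfl

/-- The coordinates of a point of affine space. -/
def affineCoord (d : ℕ) {T : Sch k} (x : (affineSpace k d).obj.obj (op T)) (i : Fin d) :
    Γ(T.left, ⊤) :=
  (Over.Hom.left (x : T ⟶ Over.mk (𝔸(ULift.{u} (Fin d); Spec (CommRingCat.of k)) ↘
    Spec (CommRingCat.of k)))).appTop (AffineSpace.coord _ (ULift.up i))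

lemma affineCoord_bijective (d : ℕ) (T : Sch k) :
    Function.Bijective (affineCoord (k := k) d (T := T)) := by
  refine ⟨fun (x : T ⟶ Over.mk _) (y : T ⟶ Over.mk _) h ↦ ?_, fun v ↦ ?_⟩
  · apply Over.OverMorphism.ext
    refine AffineSpace.hom_ext ((Over.w x).trans (Over.w y).symm) fun i ↦ ?_
    exact congrFun h i.down
  · refine ⟨(Over.homMk (AffineSpace.homOfVector T.hom fun i ↦ v i.down)
      (AffineSpace.homOfVector_over _ _) : T ⟶ Over.mk _), funext fun i ↦ ?_⟩
    exact AffineSpace.homOfVector_appTop_coord _ _ _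

lemma affineCoord_map (d : ℕ) {T T' : Sch k} (f : T' ⟶ T)
    (x : (affineSpace k d).obj.obj (op T)) :
    affineCoord d ((affineSpace k d).obj.map f.op x) =
      (vecPsh k d).map f.op (affineCoord d x) := by
  rfl

/-- The presheaf of `d`-tuples of functions is represented by affine `d`-space. -/
def affineIso (d : ℕ) : (affineSpace k d).obj ≅ vecPsh k d :=
  NatIso.ofComponents (fun T ↦ (Equiv.ofBijective _ (affineCoord_bijective d (unop T))).toIso)
    (fun f ↦ by
      ext x
      exact affineCoord_map d f.unop x)

/-- Splitting off the first coordinate. -/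
def vecSuccIso (d : ℕ) : vecPsh k (d + 1) ≅ vecPsh k 1 ⊗ vecPsh k d :=
  NatIso.ofComponents (fun T ↦ Equiv.toIso
    { toFun := fun v : Fin (d + 1) → Γ((unop T).left, ⊤) ↦
        ((fun _ ↦ v 0, fun i ↦ v i.succ) :
          (Fin 1 → Γ((unop T).left, ⊤)) × (Fin d → Γ((unop T).left, ⊤)))
      invFun := fun v : (Fin 1 → Γ((unop T).left, ⊤)) × (Fin d → Γ((unop T).left, ⊤)) ↦
        (Fin.cons (v.1 0) v.2 : Fin (d + 1) → Γ((unop T).left, ⊤))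
      left_inv := fun v ↦ funext fun i ↦ by
        refine Fin.cases ?_ (fun i ↦ ?_) i
        · rfl
        · rfl
      right_inv := fun v ↦ Prod.ext (funext fun i ↦ by
        rw [Subsingleton.elim i 0]
        rfl) rfl })
    (fun f ↦ rfl)

variable {G : Type} [Group G]

lemma cls_trivial_affineSpace (d : ℕ) :
    K0.cls (Action.trivial G (affineSpace k d)) = K0.lefschetz k G ^ d := by
  induction d with
  | zero =>
    rw [pow_zero, ← K0.cls_unit]
    let e : (affineSpace k 0).obj ≅ 𝟙_ (PSh k) := affineIso 0 ≪≫ NatIso.ofComponents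
      (fun T ↦ Equiv.toIso
        { toFun := fun _ ↦ PUnit.unit
          invFun := fun _ ↦ Fin.elim0
          left_inv := fun _ ↦ funext fun i ↦ i.elim0
          right_inv := fun _ ↦ rfl }) (fun f ↦ rfl)
    exact K0.cls_eq_of_iso (GVar.isoMk (X := Action.trivial G _) (Y := 𝟙_ (GVar k G)) e
      fun _ ↦ rfl)
  | succ d ih =>
    rw [pow_succ', ← ih, K0.lefschetz, ← K0.cls_tensor]
    let e : (affineSpace k (d + 1)).obj ≅ (affineSpace k 1).obj ⊗ (affineSpace k d).obj :=
      affineIso (d + 1) ≪≫ vecSuccIso d ≪≫ (affineIso 1 ⊗ᵢ affineIso d).symm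
    exact K0.cls_eq_of_iso (GVar.isoMk (X := Action.trivial G _)
      (Y := Action.trivial G _ ⊗ Action.trivial G _) e fun _ ↦ rfl)

end AffineSpace

/-! ### Powers of vector bundles -/

section PowerBundle

lemma iInf_mem_etale {T : Sch k} {n : ℕ} (R : Fin n → Sieve T) (hR : ∀ i, R i ∈ etale k T) :
    ⨅ i, R i ∈ etale k T := by
  induction n with
  | zero =>
    rw [iInf_of_empty]
    exact GrothendieckTopology.top_mem _ _
  | succ n ih =>
    have : ⨅ i, R i = R 0 ⊓ ⨅ i : Fin n, R i.succ := by
      refine le_antisymm (le_inf (iInf_le _ _) (le_iInf fun i ↦ iInf_le _ _)) (le_iInf fun i ↦ ?_)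
      refine Fin.cases inf_le_left (fun i ↦ ?_) i
      exact inf_le_right.trans (iInf_le _ _)
    rw [this]
    exact GrothendieckTopology.intersection_covering _ (hR _) (ih _ fun i ↦ hR _)

/-- The morphism of `n`-fold powers induced by a morphism of presheaves. -/
def powMap {E X : PSh k} (p : E ⟶ X) (n : ℕ) : powPsh E n ⟶ powPsh X n where
  app T := TypeCat.ofHom fun e i ↦ p.app T (e i)
  naturality T T' f := by
    ext e
    exact funext fun i ↦ NatTrans.naturality_apply p f (e i)

variable {E X : PSh k} {p : E ⟶ X} {n : ℕ}

/-- A component of a point of a power. -/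
def powCoord {T : Sch k} (x : (powPsh X n).obj (op T)) (i : Fin n) : X.obj (op T) :=
  x i

/-- A component of a point in a fibre of the power of a morphism. -/
def Fib.proj {T : Sch k} {x : (powPsh X n).obj (op T)} (e : Fib (powMap p n) x) (i : Fin n) :
    Fib p (powCoord x i) :=
  ⟨e.1 i, congrFun e.2 i⟩

/-- The fibres of the power of a morphism are the products of the fibres. -/
def Fib.projEquiv {T : Sch k} (x : (powPsh X n).obj (op T)) :
    Fib (powMap p n) x ≃ ∀ i, Fib p (powCoord x i) where
  toFun := Fib.proj
  invFun e := ⟨fun i ↦ (e i).1, funext fun i ↦ (e i).2⟩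
  left_inv _ := rfl
  right_inv _ := rfl

instance FibreModule.pow [FibreModule p] : FibreModule (powMap p n) where
  addCommGroup x := (Fib.projEquiv x).addCommGroup
  module {T} x :=
    letI := (Fib.projEquiv (p := p) x).addCommGroup
    (Fib.projEquiv x).module Γ(T.left, ⊤)

lemma Fib.proj_ext {T : Sch k} {x : (powPsh X n).obj (op T)} {e e' : Fib (powMap p n) x}
    (h : ∀ i, e.proj i = e'.proj i) : e = e' :=
  (Fib.projEquiv x).injective (funext h)

lemma Fib.proj_add [FibreModule p] {T : Sch k} {x : (powPsh X n).obj (op T)}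
    (e e' : Fib (powMap p n) x) (i : Fin n) : (e + e').proj i = e.proj i + e'.proj i :=
  rfl

lemma Fib.proj_sum [FibreModule p] {T : Sch k} {x : (powPsh X n).obj (op T)} {ι : Type*}
    (s : Finset ι) (e : ι → Fib (powMap p n) x) (i : Fin n) :
    (∑ a ∈ s, e a).proj i = ∑ a ∈ s, (e a).proj i :=
  map_sum (AddMonoidHom.mk' (fun e : Fib (powMap p n) x ↦ e.proj i) fun e e' ↦ e.proj_add e' i) e s

lemma FibreModule.IsLocallyFree.res_zero [FibreModule p] {d : ℕ}
    (hp : FibreModule.IsLocallyFree p d) {T T' : Sch k} (f : T' ⟶ T) (x : X.obj (op T)) :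
    (0 : Fib p x).res f = 0 :=
  map_zero (AddMonoidHom.mk' (fun e : Fib p x ↦ e.res f) (hp.res_add f))

lemma FibreModule.isLocallyFree_pow [FibreModule p] {d : ℕ}
    (hp : FibreModule.IsLocallyFree p d) : FibreModule.IsLocallyFree (powMap p n) (d * n) where
  res_add f x e e' := Fib.proj_ext fun i ↦ hp.res_add f (e.proj i) (e'.proj i)
  res_smul f x r e := Fib.proj_ext fun i ↦ hp.res_smul f r (e.proj i)
  exists_basis {T} x := by
    choose R hR b hb using fun i : Fin n ↦ hp.exists_basis (powCoord x i)
    refine ⟨⨅ i, R i, iInf_mem_etale R hR, fun T' f hf ↦ ?_⟩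
    have hf' : ∀ i, R i f := fun i ↦ iInf_le R i _ hf
    let ε : Fin d × Fin n → Fib (powMap p n) ((powPsh X n).map f.op x) := fun c ↦
      (Fib.projEquiv _).symm
      (Pi.single (M := fun i ↦ Fib p (X.map f.op (powCoord x i))) c.2 (b c.2 T' f (hf' c.2) c.1))
    have hε : ∀ c, ε (finProdFinEquiv.symm (finProdFinEquiv c)) = ε c := fun c ↦
      congrArg ε (Equiv.symm_apply_apply _ _)
    refine ⟨fun c ↦ ε (finProdFinEquiv.symm c), fun T'' g ↦ ?_⟩
    let x'' : (powPsh X n).obj (op T'') := (powPsh X n).map g.op ((powPsh X n).map f.op x)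
    refine (Function.Bijective.of_comp_iff' (Fib.projEquiv (p := p) x'').bijective _).1 ?_
    let φ : ((Fin d × Fin n) → Γ(T''.left, ⊤)) ≃ (Fin n → Fin d → Γ(T''.left, ⊤)) :=
      (Equiv.curry _ _ _).trans (Equiv.piComm _)
    have hbij := (Function.Bijective.piMap fun i ↦ hb i T' f (hf' i) T'' g).comp
      (φ.bijective.comp (Equiv.arrowCongr finProdFinEquiv.symm (Equiv.refl _)).bijective)
    convert! hbij using 1
    funext r
    funext i
    refine (Fib.proj_sum (p := p) (x := x'') Finset.univ _ i).trans ?_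
    rw [← finProdFinEquiv.sum_comp, Fintype.sum_prod_type]
    refine Finset.sum_congr rfl fun a _ ↦ ?_
    rw [Finset.sum_eq_single i]
    · refine (congrArg (fun e ↦ r _ • (Fib.res g e).proj i) (hε (a, i))).trans ?_
      refine congrArg (r (finProdFinEquiv (a, i)) • Fib.res g ·) ?_
      exact Pi.single_eq_same (M := fun i ↦ Fib p (X.map f.op (powCoord x i))) i _
    · intro j _ hj
      refine (congrArg (fun e ↦ r _ • (Fib.res g e).proj i) (hε (a, j))).trans ?_
      have h : (ε (a, j)).proj i = 0 :=
        Pi.single_eq_of_ne (M := fun i ↦ Fib p (X.map f.op (powCoord x i))) hj.symm _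
      have h' : ((ε (a, j)).res g).proj i = 0 := (congrArg (Fib.res g) h).trans (hp.res_zero g _)
      rw [h', smul_zero]
    · simp

/-- The equivariant morphism of powers induced by a morphism of varieties. -/
def GVar.powHom {E X : Var k} (p : E ⟶ X) (n : ℕ) : GVar.pow E n ⟶ GVar.pow X n :=
  GVar.homMk (powMap p.hom n) fun _ ↦ rfl

lemma isEquivariantVectorBundle_pow {E X : Var k} (p : E ⟶ X) {d : ℕ}
    (h : IsVectorBundle p.hom d) (n : ℕ) :
    IsEquivariantVectorBundle (GVar.powHom p n) (d * n) := by
  obtain ⟨_, hp⟩ := h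
  let inst : FibreModule (pshHom (GVar.powHom p n)) := FibreModule.pow (p := p.hom) (n := n)
  refine ⟨inst, FibreModule.isLocallyFree_pow hp, fun σ ↦ ⟨?_, ?_⟩⟩
  · intro T x e e'
    rfl
  · intro T x r e
    rfl

/-- The symmetric powers of a vector bundle `E ⟶ X` of rank `d`, in the form
`E^[n] = 𝕃 ^ (d n) X^[n]`. -/
lemma cls_pow_of_isVectorBundle {E X : Var k} (p : E ⟶ X) {d : ℕ}
    (h : IsVectorBundle p.hom d) (n : ℕ) :
    K0.cls (GVar.pow E n) =
      K0.lefschetz k (Equiv.Perm (Fin n)) ^ (d * n) * K0.cls (GVar.pow X n) := by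
  rw [K0.cls_eq_of_isEquivariantVectorBundle (isEquivariantVectorBundle_pow p h n), K0.cls_tensor,
    cls_trivial_affineSpace]

end PowerBundle

/-! ### The trivial vector bundle -/

section TrivialBundle

/-- The coordinates of a point in a fibre of the trivial vector bundle. -/
def trivialFibEquiv (X : PSh k) (d : ℕ) {T : Sch k} (x : X.obj (op T)) :
    Fib (CartesianMonoidalCategory.snd (affineSpace k d).obj X) x ≃ (Fin d → Γ(T.left, ⊤)) :=
  Equiv.ofBijective (fun e ↦ affineCoord d e.1.1) (by
    refine ⟨fun e e' h ↦ Subtype.ext (Prod.ext ((affineCoord_bijective d T).1 h)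
      (e.2.trans e'.2.symm)), fun v ↦ ?_⟩
    obtain ⟨a, ha⟩ := (affineCoord_bijective d T).2 v
    exact ⟨⟨(a, x), rfl⟩, ha⟩)

lemma trivialFibEquiv_res (X : PSh k) (d : ℕ) {T T' : Sch k} (f : T' ⟶ T) {x : X.obj (op T)}
    (e : Fib (CartesianMonoidalCategory.snd (affineSpace k d).obj X) x) :
    trivialFibEquiv X d _ (e.res f) =
      fun i ↦ f.left.appTop (trivialFibEquiv X d x e i) :=
  affineCoord_map d f e.1.1

lemma isVectorBundle_snd (X : PSh k) (d : ℕ) :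
    IsVectorBundle (CartesianMonoidalCategory.snd (affineSpace k d).obj X) d := by
  let inst : FibreModule (CartesianMonoidalCategory.snd (affineSpace k d).obj X) :=
    { addCommGroup := fun x ↦ (trivialFibEquiv X d x).addCommGroup
      module := fun {T} x ↦
        letI := (trivialFibEquiv X d x).addCommGroup
        (trivialFibEquiv X d x).module Γ(T.left, ⊤) }
  have hadd : ∀ {T : Sch k} {x : X.obj (op T)}
      (e e' : Fib (CartesianMonoidalCategory.snd (affineSpace k d).obj X) x),
      trivialFibEquiv X d x (e + e') = trivialFibEquiv X d x e + trivialFibEquiv X d x e' :=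
    fun e e' ↦ (trivialFibEquiv X d _).apply_symm_apply _
  have hsmul : ∀ {T : Sch k} {x : X.obj (op T)} (r : Γ(T.left, ⊤))
      (e : Fib (CartesianMonoidalCategory.snd (affineSpace k d).obj X) x),
      trivialFibEquiv X d x (r • e) = r • trivialFibEquiv X d x e :=
    fun r e ↦ (trivialFibEquiv X d _).apply_symm_apply _
  refine ⟨inst, ?_, ?_, ?_⟩
  · intro T T' f x e e'
    apply (trivialFibEquiv X d _).injective
    rw [hadd, trivialFibEquiv_res, trivialFibEquiv_res, trivialFibEquiv_res, hadd]
    exact funext fun i ↦ map_add f.left.appTop.hom _ _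
  · intro T T' f x r e
    apply (trivialFibEquiv X d _).injective
    rw [hsmul, trivialFibEquiv_res, trivialFibEquiv_res, hsmul]
    exact funext fun i ↦ map_mul f.left.appTop.hom _ _
  · intro T x
    refine ⟨⊤, GrothendieckTopology.top_mem _ _, fun T' f _ ↦
      ⟨fun i ↦ (trivialFibEquiv X d _).symm (Pi.single i 1), fun T'' g ↦ ?_⟩⟩
    refine (Function.Bijective.of_comp_iff' (trivialFibEquiv X d _).bijective _).1 ?_
    convert! Function.bijective_id using 1
    funext r
    refine (map_sum (AddMonoidHom.mk' (M := Fib _ (X.map g.op (X.map f.op x)))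
      (G := Fin d → Γ(T''.left, ⊤)) (trivialFibEquiv X d _) hadd) _ _).trans ?_
    have h : ∀ i, trivialFibEquiv X d _ (r i •
        ((trivialFibEquiv X d (X.map f.op x)).symm (Pi.single i 1)).res g) = Pi.single i (r i) := by
      intro i
      rw [hsmul, trivialFibEquiv_res, Equiv.apply_symm_apply]
      funext j
      change r i * g.left.appTop (Pi.single (M := fun _ ↦ Γ(T'.left, ⊤)) i 1 j) = _
      rcases eq_or_ne j i with rfl | hj
      · simp
      · simp [hj]
    exact (Finset.sum_congr rfl fun i _ ↦ h i).trans (Finset.univ_sum_single r)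

end TrivialBundle

/-! ### Subobjects of presheaves -/

section Subobjects

/-- The morphisms `f : T' ⟶ T` along which a `T`-point `x` comes from the source of `ι`. -/
def pointSieve {A B : PSh k} (ι : A ⟶ B) {T : Sch k} (x : B.obj (op T)) : Sieve T where
  arrows T' f := B.map f.op x ∈ Set.range (ι.app (op T'))
  downward_closed := by
    rintro T' T'' f ⟨a, ha⟩ g
    exact ⟨A.map g.op a, by rw [app_map, ha, map_map]⟩

/-- The sieve `S` consists of the morphisms that factor through `m`. -/
def Represents {T M : Sch k} (m : M ⟶ T) (S : Sieve T) : Prop :=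
  ∀ (T' : Sch k) (f : T' ⟶ T), S f ↔ ∃ g, g ≫ m = f

lemma Represents.self {T M : Sch k} {m : M ⟶ T} {S : Sieve T} (h : Represents m S) : S m :=
  (h M m).2 ⟨𝟙 M, Category.id_comp m⟩

lemma Rep.exists_represents {P : MorphismProperty Scheme.{u}} {A B : PSh k} {ι : A ⟶ B}
    (h : Rep k P ι) {T : Sch k} (x : B.obj (op T)) :
    ∃ (M : Sch k) (m : M ⟶ T), P m.left ∧ Represents m (pointSieve ι x) := by
  let g : yoneda.obj T ⟶ B := yonedaEquiv.symm x
  have hg : ∀ (T' : Sch k) (f : T' ⟶ T), g.app (op T') f = B.map f.op x := fun T' f ↦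
    yonedaEquiv_symm_app_apply x (op T') f
  have hm : P (h.rep.snd g).left := h.property_snd g
  refine ⟨h.rep.pullback g, h.rep.snd g, hm, fun T' f ↦ ⟨?_, ?_⟩⟩
  · rintro ⟨a, ha⟩
    refine ⟨h.rep.lift (yonedaEquiv.symm a) f ?_, h.rep.lift_snd _ _ _⟩
    apply yonedaEquiv.injective
    rw [yonedaEquiv_comp, Equiv.apply_symm_apply, ha, yonedaEquiv_comp, yonedaEquiv_yoneda_map, hg]
  · rintro ⟨l, rfl⟩
    refine (pointSieve ι x).downward_closed ⟨yonedaEquiv (h.rep.fst g), ?_⟩ l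
    rw [← yonedaEquiv_comp, h.rep.w, yonedaEquiv_comp, yonedaEquiv_yoneda_map, hg]

/-- An injective morphism has a property if its pullbacks to schemes are represented by morphisms
with this property. -/
lemma Rep.of_represents {P : MorphismProperty Scheme.{u}} [P.RespectsIso] {A B : PSh k} {ι : A ⟶ B}
    (hι : ∀ T : Sch k, Function.Injective (ι.app (op T)))
    (h : ∀ (T : Sch k) (x : B.obj (op T)), ∃ (M : Sch k) (m : M ⟶ T), Mono m ∧ P m.left ∧
      Represents m (pointSieve ι x)) : Rep k P ι := by
  refine MorphismProperty.relative.of_exists fun T g ↦ ?_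
  obtain ⟨M, m, hmono, hm, hM⟩ := h T (yonedaEquiv g)
  have hg : ∀ (T' : Sch k) (f : T' ⟶ T), g.app (op T') f = B.map f.op (yonedaEquiv g) := by
    intro T' f
    conv_lhs => rw [← yonedaEquiv.symm_apply_apply g]
    exact yonedaEquiv_symm_app_apply _ (op T') f
  obtain ⟨a, ha⟩ := hM.self
  have ha' : ∀ (T' : Sch k) (l : T' ⟶ M),
      (yonedaEquiv.symm a).app (op T') l = A.map l.op a := fun T' l ↦
    yonedaEquiv_symm_app_apply a (op T') l
  have hw : ∀ (T' : Sch k) (l : T' ⟶ M), ι.app (op T') ((yonedaEquiv.symm a).app (op T') l) =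
      g.app (op T') (l ≫ m) := by
    intro T' l
    rw [ha', app_map, ha, map_map, hg]
  refine ⟨M, yonedaEquiv.symm a, m, isPullback_of ?_ ?_ ?_, hm⟩
  · intro T' l
    exact hw (unop T') l
  · intro T' (l : unop T' ⟶ M) (l' : unop T' ⟶ M) _ hl
    exact (cancel_mono m).1 hl
  · intro T' y (f : unop T' ⟶ T) hy
    have hy' : ι.app (op (unop T')) y = B.map f.op (yonedaEquiv g) := hy.trans (hg _ f)
    obtain ⟨l, rfl⟩ := (hM _ f).1 ⟨y, hy'⟩
    exact ⟨l, hι _ ((hw _ l).trans hy.symm), rfl⟩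

lemma factors_of_locally {T M : Sch k} (m : M ⟶ T) [Mono m] {T' : Sch k} (f : T' ⟶ T)
    {R : Sieve T'} (hR : R ∈ etale k T')
    (h : ∀ (T'' : Sch k) (p : T'' ⟶ T'), R p → ∃ g, g ≫ m = p ≫ f) : ∃ g, g ≫ m = f :=
  mem_range_of_locally (isSheaf_yoneda M) (isSheaf_yoneda T) (yoneda.map m)
    (fun T' (_ : T' ⟶ M) (_ : T' ⟶ M) hab ↦ (cancel_mono m).1 hab) f hR h

lemma mono_of_left {T M : Sch k} (m : M ⟶ T) [Mono m.left] : Mono m :=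
  (Over.forget _).mono_of_mono_map (inferInstanceAs (Mono m.left))

/-- A point of the underlying space, as a morphism from the spectrum of its residue field. -/
def pointHom {T : Sch k} (t : T.left) :
    Over.mk (T.left.fromSpecResidueField t ≫ T.hom) ⟶ T :=
  Over.homMk (T.left.fromSpecResidueField t)

/-- Covering sieves are jointly surjective. -/
lemma exists_mem_range_of_mem_etale {T : Sch k} {R : Sieve T} (hR : R ∈ etale k T) (t : T.left) :
    ∃ (T' : Sch k) (f : T' ⟶ T) (t' : T'.left), R f ∧ f.left t' = t := by
  have hne : Nonempty (Over.mk (T.left.fromSpecResidueField t ≫ T.hom) : Sch k).left :=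
    inferInstanceAs (Nonempty (Spec (T.left.residueField t)))
  obtain ⟨T', p, hp, ⟨t'⟩⟩ := exists_nonempty_of_mem_etale hne
    (GrothendieckTopology.pullback_stable _ (pointHom t) hR)
  refine ⟨T', p ≫ pointHom t, t', hp, ?_⟩
  exact T.left.fromSpecResidueField_apply t (p.left t')

lemma isSheaf_of_injective {A B : PSh k} (hB : Presieve.IsSheaf (etale k) B) {ι : A ⟶ B}
    (hι : ∀ T : Sch k, Function.Injective (ι.app (op T)))
    (h : ∀ (T : Sch k) (b : B.obj (op T)) (R : Sieve T), R ∈ etale k T →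
      (∀ (T' : Sch k) (f : T' ⟶ T), R f → B.map f.op b ∈ Set.range (ι.app (op T'))) →
      b ∈ Set.range (ι.app (op T))) : Presieve.IsSheaf (etale k) A := by
  intro T R hR x hx
  obtain ⟨b, hb, -⟩ := hB R hR (fun T' f hf ↦ ι.app (op T') (x f hf))
    (fun T₁ T₂ T' g₁ g₂ f₁ f₂ h₁ h₂ w ↦ by
      rw [← app_map, ← app_map, hx g₁ g₂ h₁ h₂ w])
  obtain ⟨a, rfl⟩ := h T b R hR fun T' f hf ↦ ⟨x f hf, (hb f hf).symm⟩
  have ha : ∀ (T' : Sch k) (f : T' ⟶ T) (hf : R f), A.map f.op a = x f hf := fun T' f hf ↦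
    hι T' ((app_map ι f a).trans (hb f hf))
  refine ⟨a, ha, fun a' ha' ↦ hι T ?_⟩
  refine separated hB hR fun T' f hf ↦ ?_
  rw [← app_map, ← app_map, ha' f hf, ha T' f hf]

/-- Open immersions of schemes. -/
def openImmersion : MorphismProperty Scheme.{u} := fun _ _ f ↦ IsOpenImmersion f

instance : openImmersion.{u}.RespectsIso :=
  inferInstanceAs (MorphismProperty.RespectsIso @IsOpenImmersion)

instance : closedImmersion.{u}.RespectsIso :=
  inferInstanceAs (MorphismProperty.RespectsIso @IsClosedImmersion)

/-- An open subspace of a variety is a variety. It is quasi-compact since the atlas of the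
variety is noetherian. -/
lemma IsVariety.of_openImmersion {A B : PSh k} (hB : IsVariety k B) {ι : A ⟶ B}
    (hι : ∀ T : Sch k, Function.Injective (ι.app (op T))) (hA : Presieve.IsSheaf (etale k) A)
    (h : Rep k openImmersion ι) : IsVariety k A where
  isSheaf := hA
  diagonal := by
    refine Rep.of_isPullback (a := ι) (g := ι ⊗ₘ ι) (isPullback_of ?_ ?_ ?_) hB.diagonal
    · intro T a
      rfl
    · intro T a a' haa' _
      exact hι (unop T) haa'
    · intro T b aa hb
      have h₁ : b = ι.app T aa.1 := congrArg Prod.fst hb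
      have h₂ : b = ι.app T aa.2 := congrArg Prod.snd hb
      exact ⟨aa.1, h₁.symm, Prod.ext rfl (hι (unop T) (h₁.symm.trans h₂))⟩
  atlas := by
    obtain ⟨V, p, hV, hV', hp⟩ := hB.atlas
    have : IsOpenImmersion (h.rep.snd p).left := h.property_snd p
    have : IsLocallyNoetherian V.left := LocallyOfFiniteType.isLocallyNoetherian V.hom
    have hw : (h.rep.snd p).left ≫ V.hom = (h.rep.pullback p).hom := Over.w _
    refine ⟨h.rep.pullback p, h.rep.fst p, ?_, ?_, Rep.of_isPullback (h.rep.isPullback p).flip hp⟩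
    · rw [← hw]
      infer_instance
    · rw [← hw]
      infer_instance

end Subobjects

/-! ### Closed subschemes -/

section ClosedSubschemes

lemma exists_represents_inf {T M M' : Sch k} {m : M ⟶ T} {m' : M' ⟶ T} {S S' : Sieve T}
    (hm : IsClosedImmersion m.left) (hm' : IsClosedImmersion m'.left) (h : Represents m S)
    (h' : Represents m' S') : ∃ (N : Sch k) (l : N ⟶ T), IsClosedImmersion l.left ∧
      Represents l (S ⊓ S') ∧ Set.range l.left = Set.range m.left ∩ Set.range m'.left := by
  let a : pullback m.left m'.left ⟶ M.left := pullback.fst m.left m'.left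
  let N : Sch k := Over.mk (a ≫ M.hom)
  let p : N ⟶ M := Over.homMk a
  let q : N ⟶ M' := Over.homMk (pullback.snd m.left m'.left) (by
    simp only [N, a, Over.mk_hom, ← Over.w m', ← Over.w m]
    rw [pullback.condition_assoc])
  have hpq : p ≫ m = q ≫ m' := Over.OverMorphism.ext pullback.condition
  refine ⟨N, p ≫ m, ?_, fun T' f ↦ ⟨?_, ?_⟩, ?_⟩
  · exact (inferInstance : IsClosedImmersion (pullback.fst m.left m'.left ≫ m.left))
  · rintro ⟨h₁, h₂⟩
    obtain ⟨g, rfl⟩ := (h T' f).1 h₁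
    obtain ⟨g', hg'⟩ := (h' T' _).1 h₂
    have hgg : g.left ≫ m.left = g'.left ≫ m'.left := by
      rw [← Over.comp_left, ← Over.comp_left, hg']
    refine ⟨Over.homMk (pullback.lift g.left g'.left hgg) ?_, Over.OverMorphism.ext ?_⟩
    · exact (pullback.lift_fst_assoc _ _ _ _).trans (Over.w g)
    · exact pullback.lift_fst_assoc _ _ _ _
  · rintro ⟨g, rfl⟩
    refine ⟨(h T' _).2 ⟨g ≫ p, Category.assoc _ _ _⟩, (h' T' _).2 ⟨g ≫ q, ?_⟩⟩
    rw [hpq, Category.assoc]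
  · exact Scheme.Pullback.range_fst_comp m.left m'.left

/-- Intersections of closed subschemes. -/
lemma exists_represents_biInf {T : Sch k} {α : Type} [DecidableEq α] (S : α → Sieve T)
    (L : α → Set T.left)
    (h : ∀ a, ∃ (M : Sch k) (m : M ⟶ T), IsClosedImmersion m.left ∧ Represents m (S a) ∧
      Set.range m.left = L a) (A : Finset α) :
    ∃ (M : Sch k) (m : M ⟶ T), IsClosedImmersion m.left ∧ Represents m (⨅ a ∈ A, S a) ∧
      Set.range m.left = ⋂ a ∈ A, L a := by
  induction A using Finset.induction_on with
  | empty =>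
    refine ⟨T, 𝟙 T, (inferInstance : IsClosedImmersion (𝟙 T.left)), fun T' f ↦ ?_, ?_⟩
    · simp
    · simp
  | insert a A _ ih =>
    obtain ⟨M, m, hm, hM, hr⟩ := h a
    obtain ⟨M', m', hm', hM', hr'⟩ := ih
    obtain ⟨N, l, hl, hN, hr''⟩ := exists_represents_inf hm hm' hM hM'
    refine ⟨N, l, hl, ?_, ?_⟩
    · rwa [Finset.iInf_insert]
    · rw [hr'', hr, hr', Finset.set_biInter_insert]

/-- A finite disjoint union of closed subschemes with disjoint images is a closed subscheme. -/
lemma isClosedImmersion_sigmaDesc {α : Type} [Finite α] {M : α → Scheme.{u}} {X : Scheme.{u}}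
    (m : ∀ a, M a ⟶ X) (hm : ∀ a, IsClosedImmersion (m a))
    (hd : ∀ a b x y, m a x = m b y → a = b) : IsClosedImmersion (Limits.Sigma.desc m) := by
  have hs : SurjectiveOnStalks (Limits.Sigma.desc m) :=
    IsZariskiLocalAtSource.sigmaDesc (P := @SurjectiveOnStalks) fun a ↦ inferInstance
  have hex : ∀ z : (∐ M : Scheme.{u}), ∃ a x, Limits.Sigma.ι M a x = z := fun z ↦
    (sigmaOpenCover M).exists_eq z
  have hι : ∀ a x, Limits.Sigma.desc m (Limits.Sigma.ι M a x) = m a x := fun a x ↦ by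
    rw [← Scheme.Hom.comp_apply, Limits.Sigma.ι_desc]
  refine ⟨.of_continuous_injective_isClosedMap (Scheme.Hom.continuous _) ?_ ?_⟩
  · intro z z' hz
    obtain ⟨a, x, rfl⟩ := hex z
    obtain ⟨b, y, rfl⟩ := hex z'
    rw [hι, hι] at hz
    obtain rfl := hd a b x y hz
    rw [(m a).isClosedEmbedding.injective hz]
  · intro C hC
    have : Limits.Sigma.desc m '' C = ⋃ a, m a '' (Limits.Sigma.ι M a ⁻¹' C) := by
      ext t
      simp only [Set.mem_image, Set.mem_iUnion, Set.mem_preimage]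
      constructor
      · rintro ⟨z, hz, rfl⟩
        obtain ⟨a, x, rfl⟩ := hex z
        exact ⟨a, x, hz, (hι a x).symm⟩
      · rintro ⟨a, x, hx, rfl⟩
        exact ⟨_, hx, hι a x⟩
    rw [this]
    exact isClosed_iUnion_of_finite fun a ↦ (m a).isClosedEmbedding.isClosedMap _
      (hC.preimage (Scheme.Hom.continuous _))

end ClosedSubschemes

/-! ### The locus of a closed subspace -/

section Locus

variable {X Z U : PSh k} {i : Z ⟶ X} {j : U ⟶ X}

variable (i) in
/-- The set of those points of `T` at which a `T`-point `x` of `X` meets `Z`. -/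
def locus {T : Sch k} (x : X.obj (op T)) : Set T.left :=
  {t | ∃ (T' : Sch k) (f : T' ⟶ T) (t' : T'.left), pointSieve i x f ∧ f.left t' = t}

lemma pointSieve_map {T T' T'' : Sch k} (f : T' ⟶ T) (x : X.obj (op T)) (g : T'' ⟶ T') :
    pointSieve i (X.map f.op x) g ↔ pointSieve i x (g ≫ f) := by
  change X.map g.op (X.map f.op x) ∈ _ ↔ X.map (g ≫ f).op x ∈ _
  rw [map_map]

lemma mem_locus_map {T T' : Sch k} (f : T' ⟶ T) (x : X.obj (op T)) (t : T'.left) :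
    t ∈ locus i (X.map f.op x) ↔ f.left t ∈ locus i x := by
  constructor
  · rintro ⟨S, g, s, hg, rfl⟩
    exact ⟨S, g ≫ f, s, (pointSieve_map f x g).1 hg, rfl⟩
  · rintro ⟨S, g, s, hg, hs⟩
    obtain ⟨w, hw, hw'⟩ := Scheme.Pullback.exists_preimage_pullback (f := f.left) (g := g.left)
      t s hs.symm
    let a : pullback f.left g.left ⟶ T'.left := pullback.fst f.left g.left
    let W : Sch k := Over.mk (a ≫ T'.hom)
    let p : W ⟶ T' := Over.homMk a
    let q : W ⟶ S := Over.homMk (pullback.snd f.left g.left) (by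
      simp only [W, a, Over.mk_hom, ← Over.w f, ← Over.w g]
      rw [pullback.condition_assoc])
    have hpq : p ≫ f = q ≫ g := Over.OverMorphism.ext pullback.condition
    refine ⟨W, p, w, (pointSieve_map f x p).2 ?_, hw⟩
    rw [hpq]
    exact (pointSieve i x).downward_closed hg q

lemma locus_eq_range {T M : Sch k} {m : M ⟶ T} {x : X.obj (op T)}
    (h : Represents m (pointSieve i x)) : locus i x = Set.range m.left := by
  ext t
  constructor
  · rintro ⟨T', f, t', hf, rfl⟩
    obtain ⟨g, rfl⟩ := (h T' f).1 hf
    exact ⟨g.left t', rfl⟩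
  · rintro ⟨s, rfl⟩
    exact ⟨M, m, s, h.self, rfl⟩

lemma mem_locus_of_mem_range {T : Sch k} {x : X.obj (op T)} (hx : x ∈ Set.range (i.app (op T)))
    (t : T.left) : t ∈ locus i x := by
  refine ⟨T, 𝟙 T, t, ?_, rfl⟩
  change X.map (𝟙 T).op x ∈ _
  rwa [op_id, Functor.map_id_apply]

namespace IsClosedDecomposition

variable (h : IsClosedDecomposition i j)

include h

lemma mem_range_iff_locus {T : Sch k} (x : X.obj (op T)) :
    x ∈ Set.range (j.app (op T)) ↔ ∀ t, t ∉ locus i x := by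
  rw [h.mem_range_iff]
  constructor
  · rintro hx _ ⟨T', f, t', hf, rfl⟩
    exact hx T' f ⟨t'⟩ hf
  · rintro hx T' f ⟨t'⟩ hf
    exact hx _ ⟨T', f, t', hf, rfl⟩

lemma exists_represents {T : Sch k} (x : X.obj (op T)) :
    ∃ (M : Sch k) (m : M ⟶ T), IsClosedImmersion m.left ∧ Represents m (pointSieve i x) ∧
      Set.range m.left = locus i x := by
  obtain ⟨M, m, hm, hM⟩ := h.closed.exists_represents x
  exact ⟨M, m, hm, hM, (locus_eq_range hM).symm⟩

lemma isClosed_locus {T : Sch k} (x : X.obj (op T)) : IsClosed (locus i x) := by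
  obtain ⟨M, m, hm, -, hr⟩ := h.exists_represents x
  rw [← hr]
  exact m.left.isClosedEmbedding.isClosed_range

lemma closed_injective (T : Sch k) : Function.Injective (i.app (op T)) := by
  have hle : closedImmersion.inverseImage (Over.forget (Spec (CommRingCat.of k))) ≤
      MorphismProperty.monomorphisms (Sch k) := by
    intro A B f hf
    have : IsClosedImmersion f.left := hf
    exact mono_of_left f
  have : Mono i := MorphismProperty.presheaf_monomorphisms_le_monomorphisms _
    (MorphismProperty.relative_monotone hle _ h.closed)
  exact (mono_iff_injective _).1 (inferInstance : Mono (i.app (op T)))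

end IsClosedDecomposition

end Locus

/-! ### The stratification of the powers -/

section Strata

variable {X Z U : PSh k} {i : Z ⟶ X} {j : U ⟶ X} {n : ℕ}

lemma powCoord_map {T T' : Sch k} (f : T' ⟶ T) (x : (powPsh X n).obj (op T)) (a : Fin n) :
    powCoord ((powPsh X n).map f.op x) a = X.map f.op (powCoord x a) :=
  rfl

variable (i) in
open scoped Classical in
/-- The indices of those components of a point of `X ^ n` that meet `Z` at `t`. -/
def hits {T : Sch k} (x : (powPsh X n).obj (op T)) (t : T.left) : Finset (Fin n) :=
  {a | t ∈ locus i (powCoord x a)}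

lemma mem_hits {T : Sch k} {x : (powPsh X n).obj (op T)} {t : T.left} {a : Fin n} :
    a ∈ hits i x t ↔ t ∈ locus i (powCoord x a) := by
  simp [hits]

lemma hits_map {T T' : Sch k} (f : T' ⟶ T) (x : (powPsh X n).obj (op T)) (t : T'.left) :
    hits i ((powPsh X n).map f.op x) t = hits i x (f.left t) := by
  ext a
  rw [mem_hits, mem_hits, powCoord_map, mem_locus_map]

lemma hits_powAct {T : Sch k} (σ : Equiv.Perm (Fin n)) (x : (powPsh X n).obj (op T)) (t : T.left) :
    hits i ((powAct X n σ).app (op T) x) t = (hits i x t).map σ.toEmbedding := by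
  ext a
  rw [mem_hits, Finset.mem_map_equiv, mem_hits]
  rfl

variable (i n) in
/-- The subfunctor of `X ^ n` of those points at which fewer than `c` components meet `Z`. -/
def fewPsh (c : ℕ) : PSh k where
  obj T := {x : (powPsh X n).obj (op (unop T)) // ∀ t, (hits i x t).card < c}
  map {T T'} f := TypeCat.ofHom fun x ↦ ⟨(powPsh X n).map f x.1, fun t ↦ by
    refine lt_of_eq_of_lt ?_ (x.2 (f.unop.left t))
    exact congrArg Finset.card (hits_map f.unop x.1 t)⟩
  map_id T := by
    ext x : 3
    exact Subtype.ext (congrArg (fun φ ↦ φ x.1) ((powPsh X n).map_id T))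
  map_comp f g := by
    ext x : 3
    exact Subtype.ext (congrArg (fun φ ↦ φ x.1) ((powPsh X n).map_comp f g))

variable (i n) in
/-- The inclusion in `X ^ n` of the locus where fewer than `c` components meet `Z`. -/
def fewIncl (c : ℕ) : fewPsh i n c ⟶ powPsh X n where
  app T := TypeCat.ofHom fun x ↦ x.1

lemma fewIncl_injective (c : ℕ) (T : Sch k) : Function.Injective ((fewIncl i n c).app (op T)) :=
  fun _ _ h ↦ Subtype.ext h

lemma mem_range_fewIncl {c : ℕ} {T : Sch k} {x : (powPsh X n).obj (op T)} :
    x ∈ Set.range ((fewIncl i n c).app (op T)) ↔ ∀ t, (hits i x t).card < c :=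
  ⟨fun ⟨y, hy⟩ ↦ hy ▸ y.2, fun h ↦ ⟨⟨x, h⟩, rfl⟩⟩

namespace IsClosedDecomposition

variable (h : IsClosedDecomposition i j)

include h

/-- The number of components that meet `Z` is upper semicontinuous. -/
lemma isOpen_card_hits_lt {T : Sch k} (x : (powPsh X n).obj (op T)) (c : ℕ) :
    IsOpen {t : T.left | (hits i x t).card < c} := by
  have : {t : T.left | (hits i x t).card < c} =
      ⋂ A : {A : Finset (Fin n) // c ≤ A.card}, ⋃ a : A.1, (locus i (powCoord x a))ᶜ := by
    ext t
    simp only [Set.mem_ofPred_eq, Set.mem_iInter, Set.mem_iUnion, Set.mem_compl_iff]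
    constructor
    · rintro ht ⟨A, hA⟩
      by_contra! hcon
      have : A ⊆ hits i x t := fun a ha ↦ mem_hits.2 (hcon ⟨a, ha⟩)
      have := Finset.card_le_card this
      omega
    · intro ht
      by_contra! hcon
      obtain ⟨⟨a, ha⟩, ha'⟩ := ht ⟨_, hcon⟩
      exact ha' (mem_hits.1 ha)
  rw [this]
  exact isOpen_iInter_of_finite fun A ↦ isOpen_iUnion fun a ↦ (h.isClosed_locus _).isOpen_compl

lemma rep_fewIncl (c : ℕ) : Rep k openImmersion (fewIncl i n c) := by
  refine Rep.of_represents (fewIncl_injective c) fun T x ↦ ?_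
  let W : T.left.Opens := ⟨_, h.isOpen_card_hits_lt x c⟩
  let m : Over.mk (W.ι ≫ T.hom) ⟶ T := Over.homMk W.ι
  have hm : IsOpenImmersion m.left := inferInstanceAs (IsOpenImmersion W.ι)
  refine ⟨_, m, mono_of_left m, hm, fun T' f ↦ ?_⟩
  have h₁ : pointSieve (fewIncl i n c) x f ↔ ∀ t, f.left t ∈ W := by
    refine mem_range_fewIncl.trans (forall_congr' fun t ↦ ?_)
    rw [hits_map]
    rfl
  rw [h₁]
  constructor
  · intro hf
    have hr : Set.range f.left ⊆ Set.range W.ι := by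
      rintro _ ⟨t, rfl⟩
      simpa using hf t
    refine ⟨Over.homMk (IsOpenImmersion.lift W.ι f.left hr) ?_, Over.OverMorphism.ext ?_⟩
    · exact (IsOpenImmersion.lift_fac_assoc _ _ _ _).trans (Over.w f)
    · exact IsOpenImmersion.lift_fac _ _ _
  · rintro ⟨g, rfl⟩ t
    exact (g.left t).2

/-- The sheaf condition holds because membership is tested at points, and coverings are jointly
surjective. -/
lemma isVariety_fewPsh (hX : IsVariety k X) (c : ℕ) : IsVariety k (fewPsh i n c) := by
  refine (isVariety_powPsh hX n).of_openImmersion (fewIncl_injective c) ?_ (h.rep_fewIncl c)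
  refine isSheaf_of_injective (isVariety_powPsh hX n).isSheaf (fewIncl_injective c)
    fun T x R hR hx ↦ mem_range_fewIncl.2 fun t ↦ ?_
  obtain ⟨T', f, t', hf, rfl⟩ := exists_mem_range_of_mem_etale hR t
  rw [← hits_map]
  exact mem_range_fewIncl.1 (hx T' f hf) t'

end IsClosedDecomposition

variable (i n) in
/-- The action of a permutation on the locus where fewer than `c` components meet `Z`. -/
def fewAct (c : ℕ) (σ : Equiv.Perm (Fin n)) : fewPsh i n c ⟶ fewPsh i n c where
  app T := TypeCat.ofHom fun x ↦ ⟨(powAct X n σ).app T x.1, fun t ↦ by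
    refine lt_of_eq_of_lt ?_ (x.2 t)
    exact (congrArg Finset.card (hits_powAct σ x.1 t)).trans (Finset.card_map _)⟩

end Strata

section Equivariant

variable {X Z U : Var k} {i : Z ⟶ X} {j : U ⟶ X}
  (h : IsClosedDecomposition i.hom j.hom) (n : ℕ)

/-- The open subvariety of `X ^ n` where fewer than `c` components meet `Z`, with the action of
the symmetric group. -/
def GVar.few (c : ℕ) : GVar k (Equiv.Perm (Fin n)) :=
  GVar.of (fewPsh i.hom n c) (h.isVariety_fewPsh X.property c) (fewAct i.hom n c)
    (by ext; rfl) (fun σ τ ↦ by ext; rfl)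

/-- If fewer than `c` components meet `Z`, then fewer than `c + 1` do. -/
def GVar.fewSucc (c : ℕ) : GVar.few h n c ⟶ GVar.few h n (c + 1) :=
  GVar.homMk
    { app := fun T ↦ TypeCat.ofHom fun x ↦ ⟨x.1, fun t ↦ (x.2 t).trans (Nat.lt_succ_self c)⟩ }
    fun _ ↦ rfl

/-- If fewer than `n + 1` components may meet `Z`, there is no condition. -/
def GVar.fewTopIso : GVar.few h n (n + 1) ≅ GVar.pow X n :=
  GVar.isoMk (NatIso.ofComponents (fun _ ↦ Equiv.toIso
    { toFun := fun x ↦ x.1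
      invFun := fun x ↦ ⟨x, fun _ ↦ Nat.lt_succ_of_le
        ((Finset.card_le_univ _).trans_eq (Fintype.card_fin n))⟩
      left_inv := fun _ ↦ rfl
      right_inv := fun _ ↦ rfl }) (fun _ ↦ rfl)) (fun _ ↦ rfl)

/-- The empty variety is decomposed into two copies of itself, and so its class is zero. -/
lemma cls_few_zero : K0.cls (GVar.few h n 0) = 0 := by
  have hd : IsClosedDecomposition (pshHom (𝟙 (GVar.few h n 0))) (pshHom (𝟙 (GVar.few h n 0))) := by
    refine ⟨MorphismProperty.relative.of_exists fun T g ↦ ?_, fun T x y hxy ↦ hxy, fun T x ↦ ?_⟩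
    · refine ⟨T, g, 𝟙 T, ?_, (inferInstance : IsClosedImmersion (𝟙 T.left))⟩
      rw [CategoryTheory.Functor.map_id]
      exact IsPullback.of_id_snd
    · refine ⟨fun _ T' f ⟨t⟩ ↦ ?_, fun _ ↦ ⟨x, rfl⟩⟩
      exact absurd ((x : (fewPsh i.hom n 0).obj (op T)).2 (f.left t)) (Nat.not_lt_zero _)
  have := K0.cls_eq_add hd
  simpa using this

variable {b c : ℕ} (hbc : b + c = n)

variable (i j) in
/-- The point of `X ^ n` whose first `b` components are given by a point of `U ^ b` and whose last
`c` components are given by a point of `Z ^ c`. -/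
def joinPt {T : Sch k} (y : (powPsh U.obj b ⊗ powPsh Z.obj c).obj (op T)) :
    (powPsh X.obj n).obj (op T) := fun a ↦
  Sum.elim (fun a ↦ j.hom.app (op T) (powCoord y.1 a)) (fun a ↦ i.hom.app (op T) (powCoord y.2 a))
    ((youngEquiv hbc).symm a)

lemma joinPt_inl {T : Sch k} (y : (powPsh U.obj b ⊗ powPsh Z.obj c).obj (op T)) (a : Fin b) :
    powCoord (joinPt i j n hbc y) (youngEquiv hbc (Sum.inl a)) =
      j.hom.app (op T) (powCoord y.1 a) := by
  simp only [powCoord, joinPt, Equiv.symm_apply_apply]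
  rfl

lemma joinPt_inr {T : Sch k} (y : (powPsh U.obj b ⊗ powPsh Z.obj c).obj (op T)) (a : Fin c) :
    powCoord (joinPt i j n hbc y) (youngEquiv hbc (Sum.inr a)) =
      i.hom.app (op T) (powCoord y.2 a) := by
  simp only [powCoord, joinPt, Equiv.symm_apply_apply]
  rfl

include h in
lemma mem_hits_joinPt {T : Sch k} (y : (powPsh U.obj b ⊗ powPsh Z.obj c).obj (op T)) (t : T.left)
    (a : Fin n) : a ∈ hits i.hom (joinPt i j n hbc y) t ↔
      a ∈ Set.range (youngEquiv hbc ∘ Sum.inr) := by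
  obtain ⟨a | a, rfl⟩ := (youngEquiv hbc).surjective a
  · refine iff_of_false ?_ ?_
    · rw [mem_hits, joinPt_inl]
      exact (h.mem_range_iff_locus _).1 ⟨_, rfl⟩ t
    · rintro ⟨a', ha'⟩
      simp at ha'
  · refine iff_of_true ?_ ⟨a, rfl⟩
    rw [mem_hits, joinPt_inr]
    exact mem_locus_of_mem_range ⟨_, rfl⟩ t

include h in
lemma card_hits_joinPt {T : Sch k} (y : (powPsh U.obj b ⊗ powPsh Z.obj c).obj (op T))
    (t : T.left) : (hits i.hom (joinPt i j n hbc y) t).card = c := by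
  have : hits i.hom (joinPt i j n hbc y) t =
      Finset.univ.map ⟨youngEquiv hbc ∘ Sum.inr,
        (youngEquiv hbc).injective.comp Sum.inr_injective⟩ := by
    ext a
    rw [mem_hits_joinPt h]
    simp
  rw [this, Finset.card_map, Finset.card_univ, Fintype.card_fin]

lemma pow_ext {Y : PSh k} {T : Sch k} {x y : (powPsh Y n).obj (op T)}
    (hxy : ∀ a, powCoord x a = powCoord y a) : x = y :=
  funext hxy

lemma pow_ext_young {Y : PSh k} {T : Sch k} {x y : (powPsh Y n).obj (op T)}
    (hl : ∀ a, powCoord x (youngEquiv hbc (Sum.inl a)) = powCoord y (youngEquiv hbc (Sum.inl a)))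
    (hr : ∀ a, powCoord x (youngEquiv hbc (Sum.inr a)) = powCoord y (youngEquiv hbc (Sum.inr a))) :
    x = y := by
  refine pow_ext n fun a ↦ ?_
  obtain ⟨a | a, rfl⟩ := (youngEquiv hbc).surjective a
  · exact hl a
  · exact hr a

lemma map_joinPt {T T' : Sch k} (f : T' ⟶ T)
    (y : (powPsh U.obj b ⊗ powPsh Z.obj c).obj (op T)) :
    (powPsh X.obj n).map f.op (joinPt i j n hbc y) =
      joinPt i j n hbc ((powPsh U.obj b ⊗ powPsh Z.obj c).map f.op y) := by
  refine pow_ext_young n hbc (fun a ↦ ?_) (fun a ↦ ?_)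
  · rw [joinPt_inl, powCoord_map, joinPt_inl]
    exact (app_map j.hom f _).symm
  · rw [joinPt_inr, powCoord_map, joinPt_inr]
    exact (app_map i.hom f _).symm

/-- The inclusion of `U ^ b × Z ^ c` in the locus where at most `c` components meet `Z`. -/
def join : ((GVar.pow U b).box (GVar.pow Z c)).psh ⟶ (GVar.few h n (c + 1)).psh where
  app T := TypeCat.ofHom fun y ↦ ⟨joinPt i j n hbc (T := unop T) y, fun t ↦
    Nat.lt_succ_of_le (card_hits_joinPt h n hbc (T := unop T) y t).le⟩
  naturality T T' f := by
    ext y : 3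
    exact Subtype.ext (map_joinPt n hbc f.unop y).symm

/-- If a permutation carries a point of `U ^ b × Z ^ c` to another one, then it preserves the set of the
last `c` indices, which are those that meet `Z`, and so it belongs to `Σ_b × Σ_c`. -/
lemma isInducing_join : IsInducing (young hbc) (X := (GVar.pow U b).box (GVar.pow Z c))
    (Y := GVar.few h n (c + 1)) (join h n hbc) where
  equivariant p T y := by
    have hinv : (young hbc p)⁻¹ = young hbc p⁻¹ := (map_inv _ _).symm
    refine Subtype.ext (pow_ext_young n hbc (fun a ↦ ?_) (fun a ↦ ?_))
    · refine (joinPt_inl n hbc _ a).trans ?_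
      change _ = powCoord (joinPt i j n hbc y) ((young hbc p)⁻¹ _)
      rw [hinv, young_inl]
      exact (joinPt_inl n hbc (T := T) y _).symm
    · refine (joinPt_inr n hbc _ a).trans ?_
      change _ = powCoord (joinPt i j n hbc y) ((young hbc p)⁻¹ _)
      rw [hinv, young_inr]
      exact (joinPt_inr n hbc (T := T) y _).symm
  injective T y y' hy := by
    have hy' : ∀ a, powCoord (joinPt i j n hbc y) a = powCoord (joinPt i j n hbc y') a :=
      congrFun (congrArg Subtype.val hy)
    refine Prod.ext (pow_ext b fun a ↦ ?_) (pow_ext c fun a ↦ ?_)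
    · have := hy' (youngEquiv hbc (Sum.inl a))
      exact h.injective T (((joinPt_inl n hbc (T := T) y a).symm.trans this).trans
        (joinPt_inl n hbc (T := T) y' a))
    · have := hy' (youngEquiv hbc (Sum.inr a))
      exact h.closed_injective T (((joinPt_inr n hbc (T := T) y a).symm.trans this).trans
        (joinPt_inr n hbc (T := T) y' a))
  mem_range := by
    rintro T ⟨t⟩ σ y y' hy
    have hy' : (powAct X.obj n σ).app (op T) (joinPt i j n hbc y) = joinPt i j n hbc y' :=
      congrArg Subtype.val hy
    have hσ : ∀ a, σ a ∈ Set.range (youngEquiv hbc ∘ Sum.inr) ↔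
        a ∈ Set.range (youngEquiv hbc ∘ Sum.inr) := by
      intro a
      rw [← mem_hits_joinPt h n hbc y' t, ← mem_hits_joinPt h n hbc y t, ← hy', hits_powAct]
      simp
    obtain ⟨p, hp⟩ := Equiv.Perm.mem_sumCongrHom_range_of_perm_mapsTo_inl
      (σ := (youngEquiv hbc).permCongr.symm σ) (by
        rintro _ ⟨a, rfl⟩
        rcases hs : (youngEquiv hbc).permCongr.symm σ (Sum.inl a) with a' | a'
        · exact ⟨a', rfl⟩
        · have h₁ : σ (youngEquiv hbc (Sum.inl a)) = youngEquiv hbc (Sum.inr a') := by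
            rw [← hs]
            simp
          obtain ⟨a'', ha''⟩ := (hσ _).1 ⟨a', h₁.symm⟩
          simp at ha'')
    refine ⟨p, ?_⟩
    have : σ = (youngEquiv hbc).permCongr (Equiv.Perm.sumCongrHom (Fin b) (Fin c) p) := by
      rw [hp, Equiv.apply_symm_apply]
    rw [this]
    rfl

/-- Every set of `c` indices is the image of the set of the last `c` indices. -/
lemma exists_perm_young (A : Finset (Fin n)) (hA : A.card = c) : ∃ σ : Equiv.Perm (Fin n),
    (∀ a, σ (youngEquiv hbc (Sum.inl a)) ∉ A) ∧ ∀ a, σ (youngEquiv hbc (Sum.inr a)) ∈ A := by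
  have e₁ : Fintype.card (Fin c) = Fintype.card {a // a ∈ A} := by simp [hA]
  have e₂ : Fintype.card (Fin b) = Fintype.card {a // a ∉ A} := by
    rw [Fintype.card_subtype_compl, Fintype.card_fin, Fintype.card_fin, ← e₁, Fintype.card_fin]
    omega
  refine ⟨(youngEquiv hbc).symm.trans ((Equiv.sumComm _ _).trans
    ((Equiv.sumCongr (Fintype.equivOfCardEq e₁) (Fintype.equivOfCardEq e₂)).trans
      (Equiv.sumCompl (· ∈ A)))), fun a ↦ ?_, fun a ↦ ?_⟩
  · simpa using (Fintype.equivOfCardEq e₂ a).2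
  · simp

/-- A point whose components belong to `Z` for `c` indices and to `U` for the others is a translate of a
point of `U ^ b × Z ^ c`. -/
lemma exists_eq_act_join {T : Sch k} (x : (GVar.few h n (c + 1)).psh.obj (op T))
    (A : Finset (Fin n)) (hA : A.card = c)
    (hZ : ∀ a ∈ A, powCoord (n := n) x.1 a ∈ Set.range (i.hom.app (op T)))
    (hU : ∀ a ∉ A, powCoord (n := n) x.1 a ∈ Set.range (j.hom.app (op T))) :
    ∃ (σ : Equiv.Perm (Fin n)) (y : ((GVar.pow U b).box (GVar.pow Z c)).psh.obj (op T)),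
      x = ((GVar.few h n (c + 1)).act σ).app (op T) ((join h n hbc).app (op T) y) := by
  obtain ⟨σ, hσ, hσ'⟩ := exists_perm_young n hbc A hA
  choose z hz using fun a ↦ hZ _ (hσ' a)
  choose w hw using fun a ↦ hU _ (hσ a)
  let y : (powPsh U.obj b ⊗ powPsh Z.obj c).obj (op T) := (w, z)
  have key : (powAct X.obj n σ⁻¹).app (op T) x.1 = joinPt i j n hbc y := by
    refine pow_ext_young n hbc (fun a ↦ ?_) (fun a ↦ ?_)
    · rw [joinPt_inl]
      refine Eq.trans ?_ (hw a).symm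
      exact congrArg (fun τ : Equiv.Perm (Fin n) ↦
        powCoord (n := n) x.1 (τ (youngEquiv hbc (Sum.inl a)))) (inv_inv σ)
    · rw [joinPt_inr]
      refine Eq.trans ?_ (hz a).symm
      exact congrArg (fun τ : Equiv.Perm (Fin n) ↦
        powCoord (n := n) x.1 (τ (youngEquiv hbc (Sum.inr a)))) (inv_inv σ)
  refine ⟨σ, y, ?_⟩
  rw [← act_act_inv (GVar.few h n (c + 1)) σ x]
  exact congrArg _ (Subtype.ext key)

end Equivariant

/-! ### Symmetric powers of a closed decomposition -/

section Decomposition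

variable {X Z U : Var k} {i : Z ⟶ X} {j : U ⟶ X}
  (h : IsClosedDecomposition i.hom j.hom) (n : ℕ) {b c : ℕ} (hbc : b + c = n)

/-- The inclusion of the locus where exactly `c` components meet `Z`, as an induced variety. -/
def stratumHom : GVar.ind (young hbc) (young_injective hbc) ((GVar.pow U b).box (GVar.pow Z c)) ⟶
    GVar.few h n (c + 1) :=
  GVar.indDesc (young_injective hbc) (isInducing_join h n hbc)

lemma stratumHom_injective (T : Sch k) :
    Function.Injective ((pshHom (stratumHom h n hbc)).app (op T)) :=
  indDescPsh_injective (isInducing_join h n hbc) T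

lemma exists_cover_of_mem_range_stratumHom {T : Sch k} {x : (GVar.few h n (c + 1)).psh.obj (op T)}
    (hx : x ∈ Set.range ((pshHom (stratumHom h n hbc)).app (op T))) :
    ∃ R ∈ etale k T, ∀ (T' : Sch k) (p : T' ⟶ T), R p → ∃ (σ : Equiv.Perm (Fin n))
      (y : ((GVar.pow U b).box (GVar.pow Z c)).psh.obj (op T')),
      (GVar.few h n (c + 1)).psh.map p.op x =
        ((GVar.few h n (c + 1)).act σ).app (op T') ((join h n hbc).app (op T') y) :=
  exists_cover_of_mem_range_indDescPsh (isInducing_join h n hbc) hx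

/-- A point at which the components with indices in a set of cardinality `c` belong to `Z`, and
at most `c` components meet `Z`, belongs to the stratum. -/
lemma mem_range_stratumHom {T : Sch k} (x : (GVar.few h n (c + 1)).psh.obj (op T))
    (A : Finset (Fin n)) (hA : A.card = c)
    (hZ : ∀ a ∈ A, powCoord (n := n) x.1 a ∈ Set.range (i.hom.app (op T))) :
    x ∈ Set.range ((pshHom (stratumHom h n hbc)).app (op T)) := by
  obtain ⟨σ, y, rfl⟩ := exists_eq_act_join h n hbc x A hA hZ fun a ha ↦ by
    refine (h.mem_range_iff_locus _).2 fun t ht ↦ ?_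
    have hsub : insert a A ⊆ hits i.hom (n := n) x.1 t := by
      intro a' ha'
      rw [mem_hits]
      rcases Finset.mem_insert.1 ha' with rfl | ha'
      · exact ht
      · exact mem_locus_of_mem_range (hZ a' ha') t
    have h₁ := Finset.card_le_card hsub
    have h₂ : (hits i.hom (n := n) x.1 t).card < c + 1 := x.2 t
    rw [Finset.card_insert_of_notMem ha, hA] at h₁
    omega
  exact act_mem_range_indDescPsh (isInducing_join h n hbc) σ y

include h in
/-- The closed subscheme on which the components with indices in a given set belong to `Z`. -/
lemma exists_represents_components {T : Sch k} (x : (powPsh X.obj n).obj (op T))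
    (A : Finset (Fin n)) : ∃ (M : Sch k) (m : M ⟶ T), IsClosedImmersion m.left ∧
      Represents m (⨅ a ∈ A, pointSieve i.hom (powCoord x a)) ∧
      ∀ t, t ∈ Set.range m.left ↔ A ⊆ hits i.hom x t := by
  obtain ⟨M, m, hm, hM, hr⟩ := exists_represents_biInf
    (fun a ↦ pointSieve i.hom (powCoord x a)) (fun a ↦ locus i.hom (powCoord x a))
    (fun a ↦ h.exists_represents _) A
  refine ⟨M, m, hm, hM, fun t ↦ ?_⟩
  rw [hr, Set.mem_iInter₂]
  exact forall₂_congr fun a _ ↦ mem_hits.symm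

lemma mem_biInf_pointSieve {T T' : Sch k} {x : (powPsh X.obj n).obj (op T)}
    {A : Finset (Fin n)} {f : T' ⟶ T} :
    (⨅ a ∈ A, pointSieve i.hom (powCoord x a)) f ↔
      ∀ a ∈ A, X.obj.map f.op (powCoord x a) ∈ Set.range (i.hom.app (op T')) := by
  refine ⟨fun hf a ha ↦ iInf₂_le (f := fun a (_ : a ∈ A) ↦ pointSieve i.hom (powCoord x a)) a ha _
    hf, fun hf ↦ ?_⟩
  have hle : Sieve.generate (Presieve.singleton f) ≤
      ⨅ a ∈ A, pointSieve i.hom (powCoord x a) := le_iInf₂ fun a ha ↦ by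
    rw [Sieve.generate_le_iff]
    rintro _ _ ⟨⟩
    exact hf a ha
  exact hle _ ⟨_, 𝟙 _, f, Presieve.singleton_self f, Category.id_comp f⟩

/-- The stratum where exactly `c` components meet `Z` is closed where at most `c` components do. Over a
scheme it is the disjoint union of the closed subschemes on which the components with indices in a
given set of cardinality `c` belong to `Z`. -/
lemma rep_stratumHom : Rep k closedImmersion (pshHom (stratumHom h n hbc)) := by
  refine Rep.of_represents (stratumHom_injective h n hbc) fun T x ↦ ?_
  choose M m hm hM hr using fun A : {A : Finset (Fin n) // A.card = c} ↦
    exists_represents_components h n (T := T) x.1 A.1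
  let N : Sch k := Over.mk (Limits.Sigma.desc fun A ↦ (M A).hom)
  let ι : ∀ A, M A ⟶ N := fun A ↦ Over.homMk (Limits.Sigma.ι (fun A ↦ (M A).left) A)
    (Limits.Sigma.ι_desc _ _)
  let l : N ⟶ T := Over.homMk (Limits.Sigma.desc fun A ↦ (m A).left)
    (Limits.Sigma.hom_ext _ _ fun A ↦ by simp [N])
  have hι : ∀ A, ι A ≫ l = m A := fun A ↦ Over.OverMorphism.ext (Limits.Sigma.ι_desc _ _)
  have hl : IsClosedImmersion l.left := by
    refine isClosedImmersion_sigmaDesc (fun A ↦ (m A).left) hm fun A B y z hyz ↦ ?_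
    -- Both index sets consist of all the components that meet `Z` at the given point.
    have key : ∀ (C : {A : Finset (Fin n) // A.card = c}) (t : T.left),
        t ∈ Set.range (m C).left → C.1 = hits i.hom (n := n) x.1 t := fun C t ht ↦
      Finset.eq_of_subset_of_card_le ((hr C t).1 ht) (by
        rw [C.2]
        exact Nat.le_of_lt_succ (x.2 t))
    exact Subtype.ext ((key A _ ⟨y, rfl⟩).trans (key B _ ⟨z, hyz.symm⟩).symm)
  have : Mono l := mono_of_left l
  refine ⟨N, l, this, hl, fun T' f ↦ ⟨fun hf ↦ ?_, ?_⟩⟩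
  · obtain ⟨R, hR, hloc⟩ := exists_cover_of_mem_range_stratumHom h n hbc hf
    refine factors_of_locally l f hR fun T'' p hp ↦ ?_
    obtain ⟨σ, y, hy⟩ := hloc T'' p hp
    have hy' : (powPsh X.obj n).map p.op ((powPsh X.obj n).map f.op x.1) =
        (powAct X.obj n σ).app (op T'') (joinPt i j n hbc y) := congrArg Subtype.val hy
    rw [map_map] at hy'
    -- The indices whose components are those of the factor `Z ^ c`.
    let A : Finset (Fin n) := Finset.univ.map ⟨fun a : Fin c ↦ σ (youngEquiv hbc (Sum.inr a)),
      σ.injective.comp ((youngEquiv hbc).injective.comp Sum.inr_injective)⟩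
    have hA : A.card = c := by rw [Finset.card_map, Finset.card_univ, Fintype.card_fin]
    obtain ⟨g, hg⟩ := (hM ⟨A, hA⟩ T'' (p ≫ f)).1 (by
      rw [mem_biInf_pointSieve]
      intro a ha
      obtain ⟨a, -, rfl⟩ := Finset.mem_map.1 ha
      refine ⟨powCoord (n := c) y.2 a, ?_⟩
      rw [← powCoord_map, hy']
      refine (joinPt_inr (i := i) (j := j) n hbc (T := T'') y a).symm.trans ?_
      exact congrArg (powCoord (joinPt i j n hbc y)) (σ.symm_apply_apply _).symm)
    exact ⟨g ≫ ι ⟨A, hA⟩, by rw [Category.assoc, hι, hg]⟩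
  · rintro ⟨g, rfl⟩
    refine (pointSieve _ x).downward_closed ?_ g
    -- The condition is local, and `N` is covered by its summands.
    have hcov : Sieve.ofArrows M ι ∈ etale k N := by
      rw [GrothendieckTopology.mem_over_iff]
      refine Scheme.zariskiTopology_le_etaleTopology _ ?_
      refine GrothendieckTopology.superset_covering _
        (S := Sieve.ofArrows (fun A ↦ (M A).left) fun A ↦ (ι A).left) ?_
        (Precoverage.generate_mem_toGrothendieck ?_)
      · rw [Sieve.ofArrows, Sieve.generate_le_iff]
        rintro _ _ ⟨A⟩
        rw [Sieve.overEquiv_iff]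
        refine ⟨M A, Over.homMk (𝟙 _) ((Category.id_comp _).trans (Over.w (ι A)).symm), ι A, ⟨A⟩,
          Over.OverMorphism.ext ?_⟩
        exact Category.id_comp _
      · rw [Scheme.ofArrows_mem_precoverage_iff]
        refine ⟨fun t ↦ ?_, fun A ↦
          inferInstanceAs (IsOpenImmersion (Limits.Sigma.ι (fun A ↦ (M A).left) A))⟩
        obtain ⟨A, y, hy⟩ := (sigmaOpenCover fun A ↦ (M A).left).exists_eq t
        exact ⟨A, y, hy⟩
    refine mem_range_of_locally (GVar.isSheaf _) (GVar.isSheaf _) _ (stratumHom_injective h n hbc) _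
      hcov ?_
    rintro T' _ ⟨_, q, _, ⟨A⟩, rfl⟩
    have hx := mem_range_stratumHom h n hbc ((GVar.few h n (c + 1)).psh.map (ι A ≫ l).op x)
      A.1 A.2 (by rw [hι]; exact (mem_biInf_pointSieve n).1 (hM A).self)
    have := (pointSieve (pshHom (stratumHom h n hbc)) x).downward_closed hx q
    rw [map_map, Category.assoc]
    exact this

/-- The locus where fewer than `c + 1` components meet `Z` is decomposed into the closed stratum where
exactly `c` do and the open locus where fewer than `c` do. -/
lemma isClosedDecomposition_stratum :
    IsClosedDecomposition (pshHom (stratumHom h n hbc)) (pshHom (GVar.fewSucc h n c)) where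
  closed := rep_stratumHom h n hbc
  injective T x y hxy := Subtype.ext
    (congrArg (fun z : (fewPsh i.hom n (c + 1)).obj (op T) ↦ z.1) hxy)
  mem_range_iff T x := by
    have h₁ : x ∈ Set.range ((pshHom (GVar.fewSucc h n c)).app (op T)) ↔
        ∀ t, (hits i.hom (n := n) (T := T) x.1 t).card < c :=
      ⟨fun ⟨y, hy⟩ ↦ hy ▸ y.2, fun h ↦ ⟨⟨x.1, h⟩, rfl⟩⟩
    rw [h₁]
    constructor
    · intro hx T' f hT' hf
      obtain ⟨R, hR, hloc⟩ := exists_cover_of_mem_range_stratumHom h n hbc hf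
      obtain ⟨T'', p, hp, ⟨t⟩⟩ := exists_nonempty_of_mem_etale hT' hR
      obtain ⟨σ, y, hy⟩ := hloc T'' p hp
      have hy' : (powPsh X.obj n).map p.op ((powPsh X.obj n).map f.op x.1) =
          (powAct X.obj n σ).app (op T'') (joinPt i j n hbc y) := congrArg Subtype.val hy
      have hc := congrArg (fun z ↦ (hits i.hom z t).card) hy'
      simp only [hits_map, hits_powAct, Finset.card_map] at hc
      exact (hx _).ne (hc.trans (card_hits_joinPt h n hbc (T := T'') y t))
    · intro hx t
      by_contra hcon
      have hc : (hits i.hom (n := n) (T := T) x.1 t).card = c :=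
        le_antisymm (Nat.le_of_lt_succ (x.2 t)) (not_lt.1 hcon)
      obtain ⟨M, m, -, hM, hr⟩ := exists_represents_components h n (T := T) x.1 (hits i.hom x.1 t)
      obtain ⟨s, -⟩ := (hr t).2 subset_rfl
      exact hx M m ⟨s⟩ (mem_range_stratumHom h n hbc _ _ hc (mem_biInf_pointSieve n |>.1 hM.self))

/-- The class of the open subvariety of `X ^ n` where fewer than `c` components meet `Z`. -/
lemma cls_few (c : ℕ) (hc : c ≤ n + 1) : K0.cls (GVar.few h n c) =
    ∑ a ∈ Finset.range c,
      SymSeq.mulAt n a (n - a) (K0.cls (GVar.pow Z a)) (K0.cls (GVar.pow U (n - a))) := by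
  induction c with
  | zero => rw [cls_few_zero, Finset.sum_range_zero]
  | succ c ih =>
    have hbc : n - c + c = n := by omega
    rw [K0.cls_eq_add (isClosedDecomposition_stratum h n hbc), ih (by omega),
      Finset.sum_range_succ, ← inductionProduct_cls, SymSeq.mulAt_comm, SymSeq.mulAt_of_eq hbc]

include h in
/-- The symmetric powers of a variety that is decomposed into `U` and `Z`. -/
lemma cls_pow_eq_star : (fun n ↦ K0.cls (GVar.pow X n) : SymSeq k) =
    SymSeq.star (fun n ↦ K0.cls (GVar.pow U n)) (fun n ↦ K0.cls (GVar.pow Z n)) := by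
  funext n
  rw [SymSeq.star_comm, SymSeq.star_apply, Finset.Nat.sum_antidiagonal_eq_sum_range_succ_mk,
    ← cls_few h n (n + 1) le_rfl]
  exact (K0.cls_eq_of_iso (GVar.fewTopIso h n)).symm

end Decomposition

/-! ### The exponential homomorphism -/

section Exponential

/-- The isomorphism of symmetric powers induced by an isomorphism of varieties. -/
def GVar.powIso {X Y : Var k} (e : X ≅ Y) (n : ℕ) : GVar.pow X n ≅ GVar.pow Y n where
  hom := GVar.powHom e.hom n
  inv := GVar.powHom e.inv n
  hom_inv_id := by
    apply Action.hom_ext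
    apply ObjectProperty.hom_ext
    ext T x
    exact funext fun a ↦ congrArg (fun φ : X ⟶ X ↦ φ.hom.app T (x a)) e.hom_inv_id
  inv_hom_id := by
    apply Action.hom_ext
    apply ObjectProperty.hom_ext
    ext T x
    exact funext fun a ↦ congrArg (fun φ : Y ⟶ Y ↦ φ.hom.app T (x a)) e.inv_hom_id

/-- The sequence of the classes of the symmetric powers of a variety. -/
def powSeq (X : Var k) : UnitSeq k :=
  ⟨fun n ↦ K0.cls (GVar.pow X n), by
    rw [← K0.cls_unit]
    exact K0.cls_eq_of_iso (GVar.isoMk (NatIso.ofComponents (fun T ↦ Equiv.toIso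
      { toFun := fun _ ↦ PUnit.unit
        invFun := fun _ ↦ Fin.elim0
        left_inv := fun _ ↦ funext fun i ↦ i.elim0
        right_inv := fun _ ↦ rfl }) (fun f ↦ rfl)) fun _ ↦ rfl)⟩

variable (k) in
/-- The homomorphism from the Grothendieck ring of varieties to the group of sequences with constant
term `1` that sends the class of a variety to the sequence of its symmetric powers. -/
def K0Var.exp : K0Var k →+ Additive (UnitSeq k) :=
  K0.lift (fun X ↦ Additive.ofMul (powSeq X.V))
    (fun _ _ ⟨e⟩ ↦ congrArg Additive.ofMul (Subtype.ext (funext fun n ↦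
      K0.cls_eq_of_iso (GVar.powIso ((Action.forget _ _).mapIso e) n))))
    (fun _ _ _ i j h ↦ congrArg Additive.ofMul (Subtype.ext
      (cls_pow_eq_star (i := i.hom) (j := j.hom) h)))
    (fun _ X p d ⟨inst, hp, _⟩ ↦ congrArg Additive.ofMul (Subtype.ext (funext fun n ↦
      (cls_pow_of_isVectorBundle p.hom ⟨inst, hp⟩ n).trans
        (cls_pow_of_isVectorBundle (E := affineSpace k d ⊗ X.V)
          (ObjectProperty.homMk (CartesianMonoidalCategory.snd (affineSpace k d).obj X.V.obj))
          (isVectorBundle_snd X.V.obj d) n).symm)))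

lemma K0Var.exp_cls (X : GVar k Unit) : (exp k (K0.cls X)).toMul = powSeq X.V :=
  congrArg Additive.toMul (K0.lift_cls _ _ _ _ X)

lemma K0Var.cls_eq (X : GVar k Unit) : K0.cls X = K0Var.cls X.V :=
  K0.cls_eq_of_iso (GVar.isoMk (Y := Action.trivial Unit X.V) (Iso.refl X.psh) fun _ ↦
    congrArg (·.hom) X.ρ.map_one)

/-- A homomorphism from the Grothendieck ring of varieties is determined by its values on the
classes of varieties. -/
lemma K0Var.addHom_ext {A : Type*} [AddCommGroup A] {f g : K0Var k →+ A}
    (h : ∀ X : Var k, f (K0Var.cls X) = g (K0Var.cls X)) : f = g :=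
  K0.addHom_ext fun X ↦ by rw [K0Var.cls_eq, h]

end Exponential

end

end EquivariantVarieties

theorem mainTheorem1 (k : Type u) [Field k] :
    -- the product of the groups `K0 k Σ_n` is a commutative ring with the induction product
    ((∀ a b c : SymSeq k, (a.star b).star c = a.star (b.star c)) ∧
      (∀ a b : SymSeq k, a.star b = b.star a) ∧
      (∀ a : SymSeq k, (SymSeq.unit k).star a = a) ∧
      (∀ a b c : SymSeq k, a.star (b + c) = a.star b + a.star c)) ∧
    -- the elements with constant term `1` form a group under the induction product
    ((∀ a b : SymSeq k, a 0 = 1 → b 0 = 1 → a.star b 0 = 1) ∧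
      (∀ a : SymSeq k, a 0 = 1 → ∃ b : SymSeq k, b 0 = 1 ∧ a.star b = SymSeq.unit k)) ∧
    -- there is an exponential homomorphism that extends the symmetric powers
    (∃ exp : K0Var k → SymSeq k,
      (∀ x, exp x 0 = 1) ∧
      (∀ x y, exp (x + y) = (exp x).star (exp y)) ∧
      (∀ (X : Var k) (n : ℕ), exp (K0Var.cls X) n = K0.cls (GVar.pow X n)) ∧
      -- it is unique
      (∀ exp' : K0Var k → SymSeq k, (∀ x, exp' x 0 = 1) →
        (∀ x y, exp' (x + y) = (exp' x).star (exp' y)) →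
        (∀ (X : Var k) (n : ℕ), exp' (K0Var.cls X) n = K0.cls (GVar.pow X n)) → exp' = exp) ∧
      -- its components satisfy the binomial formula
      (∀ (n : ℕ) (x y : K0Var k), exp (x + y) n =
        ∑ p : {p : ℕ × ℕ // p ∈ Finset.HasAntidiagonal.antidiagonal n},
          K0.ind (young (Finset.HasAntidiagonal.mem_antidiagonal.1 p.2)) (young_injective _)
            (K0.box (exp x p.1.1) (exp y p.1.2))) ∧
      -- and the formula for vector bundles
      (∀ (E X : Var k) (p : E ⟶ X) (d : ℕ), IsVectorBundle p.hom d → ∀ n : ℕ,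
        exp (K0Var.cls E) n =
          K0.lefschetz k (Equiv.Perm (Fin n)) ^ (d * n) * exp (K0Var.cls X) n)) := by
  refine ⟨⟨SymSeq.star_assoc, SymSeq.star_comm, SymSeq.unit_star, SymSeq.star_add⟩,
    ⟨fun a b ↦ SymSeq.star_zero_eq_one, fun a ha ↦ ⟨SymSeq.inv a, by rw [SymSeq.inv],
      SymSeq.star_inv ha⟩⟩, ?_⟩
  have hadd : ∀ x y : K0Var k, ((K0Var.exp k (x + y)).toMul).1 =
      SymSeq.star ((K0Var.exp k x).toMul).1 ((K0Var.exp k y).toMul).1 := fun x y ↦ by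
    rw [map_add, toMul_add, UnitSeq.mul_val]
  have hcls : ∀ (X : Var k) (n : ℕ), ((K0Var.exp k (K0Var.cls X)).toMul).1 n =
      K0.cls (GVar.pow X n) := fun X n ↦
    congrFun (congrArg Subtype.val (K0Var.exp_cls (Action.trivial Unit X))) n
  refine ⟨fun x ↦ ((K0Var.exp k x).toMul).1, fun x ↦ (K0Var.exp k x).toMul.2, hadd, hcls, ?_,
    fun n x y ↦ congrFun (hadd x y) n, fun E X p d h n ↦ ?_⟩
  · intro f hf hf_add hf_cls
    -- A map that satisfies the functional equation is a homomorphism to the group of sequences with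
    -- constant term `1`.
    let F : K0Var k →+ Additive (UnitSeq k) :=
      AddMonoidHom.mk' (fun x ↦ Additive.ofMul ⟨f x, hf x⟩) fun x y ↦
        congrArg Additive.ofMul (Subtype.ext (hf_add x y))
    have hF : F = K0Var.exp k := K0Var.addHom_ext fun X ↦
      congrArg Additive.ofMul (Subtype.ext (funext fun n ↦ (hf_cls X n).trans (hcls X n).symm))
    funext x
    exact congrArg (fun G : K0Var k →+ Additive (UnitSeq k) ↦ ((G x).toMul).1) hF
  · exact (hcls E n).trans ((cls_pow_of_isVectorBundle p h n).trans
      (congrArg (_ * ·) (hcls X n).symm))
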